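/- **Setting.** Let $r,n\ge 1$ be integers, let $K$ be an algebraically closed field of characteristic $p$ (possibly $p=0$) with $p\nmid r$, and let $q\in K^{*}$. Let $\widehat Y=\widehat Y_{r,n}^{K}$ be the affine Yokonuma–Hecke algebra: the associative $K$-algebra generated by $t_1,\dots,t_n,\ g_1,\dots,g_{n-1},\ X_1^{\pm1}$ with the relations - $g_ig_j=g_jg_i$ for $|i-j|\ge2$, $\ g_ig_{i+1}g_i=g_{i+1}g_ig_{i+1}$, $\ t_it_j=t_jt_i$, $\ g_it_j=t_{s_i(j)}g_i$, $\ t_i^r=1$, $\ g_i^2=1+(q-q^{-1})e_ig_i$, where $s_i=(i,i+1)$ and $e_i=\frac1r\sum_{s=0}^{r-1}t_i^st_{i+1}^{-s}$; - $X_1X_1^{-1}=X_1^{-1}X_1=1$, $\ g_1X_1g_1X_1=X_1g_1X_1g_1$, $\ g_iX_1=X_1g_i$ for $i\ge2$, $\ t_jX_1=X_1t_j$ for all $j$. Put $X_{i+1}=g_iX_ig_i$ for $1\le i\le n-1$ (the $g_i$, hence all $X_i$, are invertible). For $m\ge0$ let $\widehat{\mathcal H}_m$ be the (extended) affine Hecke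 algebra of type $A$ over $K$: it is generated by $T_1,\dots,T_{m-1},Y_1^{\pm1},\dots,Y_m^{\pm1}$ with the relations $(T_i-q)(T_i+q^{-1})=0$; $T_iT_{i+1}T_i=T_{i+1}T_iT_{i+1}$; $T_iT_j=T_jT_i$ for $|i-j|\ge2$; $Y_jY_j^{-1}=Y_j^{-1}Y_j=1$; $Y_iY_j=Y_jY_i$; $T_iY_iT_i=Y_{i+1}$; $T_iY_j=Y_jT_i$ for $j\ne i,i+1$ (so $\widehat{\mathcal H}_0=K$). Let $\mathcal C_r(n)$ be the set of $\mu=(\mu_1,\dots,\mu_r)\in\mathbb Z_{\ge0}^r$ with $\sum_k\mu_k=n$. Put $\widehat{\mathcal H}_\mu=\widehat{\mathcal H}_{\mu_1}\otimes_K\cdots\otimes_K\widehat{\mathcal H}_{\mu_r}$ and $\widehat{\mathcal H}_{r,n}=\bigoplus_{\mu\in\mathcal C_r(n)}\widehat{\mathcal H}_\mu$. The consecutive blocks of $\mu$ are the intervals of lengths $\mu_1,\dots,\mu_r$ into which $\{1,\dots,n\}$ is cut. The generators of the $k$-th factor of $\widehat{\mathcal H}_\mu$ are numbered by the places of the $k$-th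 block, so that $\widehat{\mathcal H}_\mu$ has generators $Y_1^{\pm1},\dots,Y_n^{\pm1}$ and $T_i$ for those $i$ such that $i,i+1$ lie in one block. Let $\mathfrak S_\mu\subseteq\mathfrak S_n$ be the Young subgroup. For a reduced expression $w=s_{i_1}\cdots s_{i_l}$ put $g_w=g_{i_1}\cdots g_{i_l}$ and, if $w\in\mathfrak S_\mu$, $T_w=T_{i_1}\cdots T_{i_l}$. Let $\widehat Y_\mu=\widehat Y_{r,\mu}^K\subseteq\widehat Y$ be the subalgebra generated by $t_1,\dots,t_n$, $X_1^{\pm1},\dots,X_n^{\pm1}$ and the $g_w$, $w\in\mathfrak S_\mu$. Let $G=\mathbb Z/r\mathbb Z$ and $T=G^n$; the generator of the $j$-th factor of $T$ acts on each $\widehat Y$-module as $t_j$. Let $V_1,\dots,V_r$ be a complete set of pairwise non-isomorphic finite-dimensional simple $KG$-modules, and put $V(\mu)=V_1^{\otimes\mu_1}\otimes\cdots\otimes V_r^{\otimes\mu_r}$, a simple $KT$-module. For a $\widehat Y$-module $N$ let $I_\mu N$ be the sum of all $KT$-submodules of $N$ isomorphic to $V(\mu)$. For an algebra $A$ let $A\text{-}\mathbf{mod}$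 be the category of finite-dimensional left $A$-modules. For $N\in\widehat Y\text{-}\mathbf{mod}$ the space $\mathrm{Hom}_{KT}(V(\mu),I_\mu N)$ is an $\widehat{\mathcal H}_\mu$-module via $(T_w\diamond\varphi)(v)=g_w\varphi(v)$ and $(Y_k^{\pm1}\diamond\varphi)(v)=X_k^{\pm1}\varphi(v)$, for $v\in V(\mu)$, $w\in\mathfrak S_\mu$, $1\le k\le n$. This gives the functor $$\mathcal F:\widehat Y\text{-}\mathbf{mod}\to\widehat{\mathcal H}_{r,n}\text{-}\mathbf{mod},\qquad \mathcal F(N)=\bigoplus_{\mu\in\mathcal C_r(n)}\mathrm{Hom}_{KT}(V(\mu),I_\mu N).$$ **Theorem.** 1. For each $\mu\in\mathcal C_r(n)$ there is a $K$-algebra homomorphism $\rho_\mu:\widehat Y_\mu\to\mathrm{End}_K(V(\mu))\otimes_K\widehat{\mathcal H}_\mu$ (necessarily unique) with $\rho_\mu(t_k)=t_k|_{V(\mu)}\otimes1$, $\rho_\mu(g_w)=1\otimes T_w$ and $\rho_\mu(X_k^{\pm1})=1\otimes Y_k^{\pm1}$ for $1\le k\le n$, $w\in\mathfrak S_\mu$.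 Hence for each $\widehat{\mathcal H}_\mu$-module $M$ the space $V(\mu)\otimes M$ is a $\widehat Y_\mu$-module with $t_k(v\otimes z)=t_kv\otimes z$, $g_w(v\otimes z)=v\otimes T_wz$, $X_k^{\pm1}(v\otimes z)=v\otimes Y_k^{\pm1}z$. 2. For each $P=\bigoplus_\mu P_\mu$ in $\widehat{\mathcal H}_{r,n}\text{-}\mathbf{mod}$ (with $P_\mu$ the component on which the summand $\widehat{\mathcal H}_\mu$ acts), the $\widehat Y$-module $$\mathcal G(P)=\bigoplus_{\mu\in\mathcal C_r(n)}\mathrm{Ind}_{\widehat Y_\mu}^{\widehat Y}\bigl(V(\mu)\otimes P_\mu\bigr),\qquad \mathrm{Ind}_{\widehat Y_\mu}^{\widehat Y}W=\widehat Y\otimes_{\widehat Y_\mu}W,$$ is finite-dimensional, so that $\mathcal G$ is a functor $\widehat{\mathcal H}_{r,n}\text{-}\mathbf{mod}\to\widehat Y\text{-}\mathbf{mod}$. 3. $\mathcal F$ is an equivalence of categories, with (quasi-)inverse $\mathcal G$: one has $\mathcal G\mathcal F\cong\mathrm{id}$ and $\mathcal F\mathcal G\cong\mathrm{id}$. -/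

import Mathlib

open CategoryTheory
open scoped TensorProduct ModuleCat

universe u

noncomputable section

namespace AYH

/-! ### The affine Yokonuma-Hecke algebra -/

/-- Generators of the affine Yokonuma-Hecke algebra.  All indices start at `0`: `t j` is the
framing generator `t_{j+1}`, `g i _` is the braid generator `g_{i+1}`, and `X`, `Xinv` are
`X_1`, `X_1⁻¹`. -/
inductive YGen (n : ℕ) : Type
  | t (j : Fin n) : YGen n
  | g (i : ℕ) (hi : i + 1 < n) : YGen n
  | X : YGen n
  | Xinv : YGen n

section Presentation

variable (K : Type u) [Field K] (r n : ℕ) (q : Kˣ)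

/-- The free generator `t_{j+1}`. -/
abbrev ft (j : Fin n) : FreeAlgebra K (YGen n) := FreeAlgebra.ι K (YGen.t j)
/-- The free generator `g_{i+1}`. -/
abbrev fg (i : ℕ) (hi : i + 1 < n) : FreeAlgebra K (YGen n) := FreeAlgebra.ι K (YGen.g i hi)
/-- The free generator `X_1`. -/
abbrev fX : FreeAlgebra K (YGen n) := FreeAlgebra.ι K YGen.X
/-- The free generator `X_1⁻¹`. -/
abbrev fXinv : FreeAlgebra K (YGen n) := FreeAlgebra.ι K YGen.Xinv

/-- The element `e_i = (1/r) ∑_{0 ≤ s < r} t_i^s t_{i+1}^{-s}`; as `t_{i+1}^r = 1`, the power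
`t_{i+1}^{-s}` is written `t_{i+1}^{r-s}`. -/
def fe (i : ℕ) (hi : i + 1 < n) : FreeAlgebra K (YGen n) :=
  (r : K)⁻¹ • ∑ s ∈ Finset.range r,
    ft K n ⟨i, Nat.lt_of_succ_lt hi⟩ ^ s * ft K n ⟨i + 1, hi⟩ ^ (r - s)

/-- The simple transposition `s_i` of `Fin n` exchanging `i` and `i + 1`. -/
def sw {n : ℕ} (i : ℕ) (hi : i + 1 < n) : Equiv.Perm (Fin n) :=
  Equiv.swap ⟨i, Nat.lt_of_succ_lt hi⟩ ⟨i + 1, hi⟩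

/-- The defining relations of the affine Yokonuma-Hecke algebra. -/
inductive YRel : FreeAlgebra K (YGen n) → FreeAlgebra K (YGen n) → Prop
  | g_comm (i j : ℕ) (hi : i + 1 < n) (hj : j + 1 < n) (hij : i + 2 ≤ j ∨ j + 2 ≤ i) :
      YRel (fg K n i hi * fg K n j hj) (fg K n j hj * fg K n i hi)
  | braid (i : ℕ) (hi : i + 1 < n) (hi' : i + 1 + 1 < n) :
      YRel (fg K n i hi * fg K n (i + 1) hi' * fg K n i hi)
        (fg K n (i + 1) hi' * fg K n i hi * fg K n (i + 1) hi')
  | t_comm (i j : Fin n) : YRel (ft K n i * ft K n j) (ft K n j * ft K n i)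
  | g_t (i : ℕ) (hi : i + 1 < n) (j : Fin n) :
      YRel (fg K n i hi * ft K n j) (ft K n (sw i hi j) * fg K n i hi)
  | t_pow (j : Fin n) : YRel (ft K n j ^ r) 1
  | g_sq (i : ℕ) (hi : i + 1 < n) :
      YRel (fg K n i hi ^ 2)
        (1 + ((q : K) - ((q⁻¹ : Kˣ) : K)) • (fe K r n i hi * fg K n i hi))
  | X_Xinv : YRel (fX K n * fXinv K n) 1
  | Xinv_X : YRel (fXinv K n * fX K n) 1
  | gXgX (h : 0 + 1 < n) :
      YRel (fg K n 0 h * fX K n * fg K n 0 h * fX K n) (fX K n * fg K n 0 h * fX K n * fg K n 0 h)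
  | g_X (i : ℕ) (hi : i + 1 < n) (hpos : 1 ≤ i) :
      YRel (fg K n i hi * fX K n) (fX K n * fg K n i hi)
  | t_X (j : Fin n) : YRel (ft K n j * fX K n) (fX K n * ft K n j)

/-- The affine Yokonuma-Hecke algebra over the field `K` with parameter `q`. -/
def Y : Type u := RingQuot (YRel K r n q)

instance : Ring (Y K r n q) := inferInstanceAs (Ring (RingQuot (YRel K r n q)))
instance : Algebra K (Y K r n q) := inferInstanceAs (Algebra K (RingQuot (YRel K r n q)))

end Presentation

section YElements

variable {K : Type u} [Field K] {r n : ℕ} {q : Kˣ}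

/-- The quotient map from the free algebra. -/
def ymk : FreeAlgebra K (YGen n) →ₐ[K] Y K r n q := RingQuot.mkAlgHom K (YRel K r n q)

theorem ymk_rel {a b : FreeAlgebra K (YGen n)} (h : YRel K r n q a b) :
    (ymk a : Y K r n q) = ymk b := RingQuot.mkAlgHom_rel K h

/-- `t_{j+1}` in the affine Yokonuma-Hecke algebra. -/
def yt (j : Fin n) : Y K r n q := ymk (ft K n j)
/-- `g_{i+1}` in the affine Yokonuma-Hecke algebra. -/
def yg (i : ℕ) (hi : i + 1 < n) : Y K r n q := ymk (fg K n i hi)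
/-- `e_{i+1}` in the affine Yokonuma-Hecke algebra. -/
def ye (i : ℕ) (hi : i + 1 < n) : Y K r n q := ymk (fe K r n i hi)
/-- `q - q⁻¹`. -/
def qq (q : Kˣ) : K := (q : K) - ((q⁻¹ : Kˣ) : K)

theorem ye_eq (i : ℕ) (hi : i + 1 < n) : (ye i hi : Y K r n q) =
    (r : K)⁻¹ • ∑ s ∈ Finset.range r,
      yt ⟨i, Nat.lt_of_succ_lt hi⟩ ^ s * yt ⟨i + 1, hi⟩ ^ (r - s) := by
  simp only [ye, fe, map_smul, map_sum, map_mul, map_pow, yt]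

theorem yg_comm (i j : ℕ) (hi : i + 1 < n) (hj : j + 1 < n) (hij : i + 2 ≤ j ∨ j + 2 ≤ i) :
    Commute (yg i hi : Y K r n q) (yg j hj) := by
  have := ymk_rel (YRel.g_comm (r := r) (q := q) i j hi hj hij)
  rwa [map_mul, map_mul] at this

theorem yg_braid (i : ℕ) (hi : i + 1 < n) (hi' : i + 1 + 1 < n) :
    (yg i hi * yg (i + 1) hi' * yg i hi : Y K r n q) =
      yg (i + 1) hi' * yg i hi * yg (i + 1) hi' := by
  have := ymk_rel (YRel.braid (r := r) (q := q) i hi hi')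
  simpa only [map_mul, yg, yt] using this

theorem yt_comm (i j : Fin n) : Commute (yt i : Y K r n q) (yt j) := by
  have := ymk_rel (YRel.t_comm (K := K) (r := r) (q := q) i j)
  rwa [map_mul, map_mul] at this

theorem yg_t (i : ℕ) (hi : i + 1 < n) (j : Fin n) :
    (yg i hi * yt j : Y K r n q) = yt (sw i hi j) * yg i hi := by
  have := ymk_rel (YRel.g_t (K := K) (r := r) (q := q) i hi j)
  simpa only [map_mul, yg, yt] using this

theorem yt_pow (j : Fin n) : (yt j : Y K r n q) ^ r = 1 := by
  have := ymk_rel (YRel.t_pow (K := K) (r := r) (q := q) j)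
  simpa only [map_pow, map_one, yt] using this

theorem yg_sq (i : ℕ) (hi : i + 1 < n) :
    (yg i hi * yg i hi : Y K r n q) = 1 + qq q • (ye i hi * yg i hi) := by
  have := ymk_rel (YRel.g_sq (K := K) (r := r) (q := q) i hi)
  rw [← pow_two]
  simpa only [map_pow, map_add, map_one, map_smul, map_mul, yg, ye, qq] using this

/-- `X_1` as a unit of the affine Yokonuma-Hecke algebra. -/
def yX1 : (Y K r n q)ˣ where
  val := ymk (fX K n)
  inv := ymk (fXinv K n)
  val_inv := by
    have := ymk_rel (YRel.X_Xinv (K := K) (n := n) (r := r) (q := q))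
    simpa only [map_mul, map_one] using this
  inv_val := by
    have := ymk_rel (YRel.Xinv_X (K := K) (n := n) (r := r) (q := q))
    simpa only [map_mul, map_one] using this

theorem yg_pow_t (i : ℕ) (hi : i + 1 < n) (j : Fin n) (s : ℕ) :
    (yg i hi * yt j ^ s : Y K r n q) = yt (sw i hi j) ^ s * yg i hi :=
  (SemiconjBy.pow_right (show SemiconjBy (yg i hi : Y K r n q) (yt j) (yt (sw i hi j)) from
    yg_t i hi j) s)

theorem ye_g_comm (i : ℕ) (hi : i + 1 < n) :
    Commute (ye i hi : Y K r n q) (yg i hi) := by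
  have key : (yg i hi : Y K r n q) * (∑ s ∈ Finset.range r,
      yt ⟨i, Nat.lt_of_succ_lt hi⟩ ^ s * yt ⟨i + 1, hi⟩ ^ (r - s)) =
      (∑ s ∈ Finset.range r,
      yt ⟨i, Nat.lt_of_succ_lt hi⟩ ^ s * yt ⟨i + 1, hi⟩ ^ (r - s)) * yg i hi := by
    have h1 : ∀ (a b : Fin n), (∑ s ∈ Finset.range r, (yt a ^ s * yt b ^ (r - s) : Y K r n q)) =
        ∑ s ∈ Finset.range r, (yt b ^ s * yt a ^ (r - s) : Y K r n q) := by
      intro a b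
      have h2 : ∀ (a b : Fin n), (∑ s ∈ Finset.range (r + 1), (yt a ^ s * yt b ^ (r - s) :
          Y K r n q)) = (∑ s ∈ Finset.range r, (yt a ^ s * yt b ^ (r - s) : Y K r n q)) + 1 := by
        intro a b
        rw [Finset.sum_range_succ]; simp [yt_pow]
      apply add_right_cancel (b := (1 : Y K r n q))
      rw [← h2, ← h2, ← Finset.sum_range_reflect]
      apply Finset.sum_congr rfl
      intro s hs
      have hs' : s ≤ r := Nat.lt_succ_iff.mp (Finset.mem_range.mp hs)
      rw [show r + 1 - 1 - s = r - s by omega, show r - (r - s) = s by omega]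
      exact ((yt_comm a b).pow_pow _ _).eq
    rw [Finset.mul_sum]
    simp_rw [← mul_assoc, yg_pow_t, mul_assoc, yg_pow_t, ← mul_assoc]
    rw [← Finset.sum_mul, sw, Equiv.swap_apply_left, Equiv.swap_apply_right, h1]
  rw [ye_eq]
  exact (Commute.smul_right (show Commute (yg i hi : Y K r n q) _ from key) _).symm

/-- `g_{i+1}` as a unit, with inverse `g_{i+1} - (q - q⁻¹) e_{i+1}`. -/
def ygU (i : ℕ) (hi : i + 1 < n) : (Y K r n q)ˣ where
  val := yg i hi
  inv := yg i hi - qq q • ye i hi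
  val_inv := by
    rw [mul_sub, mul_smul_comm, ← (ye_g_comm i hi).eq, yg_sq]; simp
  inv_val := by
    rw [sub_mul, smul_mul_assoc, yg_sq]; simp

/-- `X_{k+1}` as a unit, defined inductively by `X_{i+1} = g_i X_i g_i`. -/
def yX : (k : ℕ) → k < n → (Y K r n q)ˣ
  | 0, _ => yX1
  | k + 1, h => ygU k h * yX k (Nat.lt_of_succ_lt h) * ygU k h

/-- `X_{k+1}` as an element. -/
abbrev yXv (k : ℕ) (hk : k < n) : Y K r n q := ((yX k hk : (Y K r n q)ˣ) : Y K r n q)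

theorem yX_t (k : ℕ) (hk : k < n) (j : Fin n) :
    Commute (yXv k hk : Y K r n q) (yt j) := by
  induction k generalizing j with
  | zero =>
    have := ymk_rel (YRel.t_X (K := K) (r := r) (q := q) j)
    rw [map_mul, map_mul] at this
    exact this.symm
  | succ k ih =>
    have h1 : SemiconjBy (yg k hk : Y K r n q) (yt j) (yt (sw k hk j)) := yg_t k hk j
    have h2 : SemiconjBy (yg k hk : Y K r n q) (yt (sw k hk j)) (yt j) := by
      have := yg_t (K := K) (r := r) (q := q) k hk (sw k hk j)
      rwa [sw, Equiv.swap_apply_self] at this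
    exact (h2.mul_left (ih (Nat.lt_of_succ_lt hk) _)).mul_left h1

theorem yX_g_gt (k : ℕ) (hk : k < n) (i : ℕ) (hi : i + 1 < n) (h : k < i) :
    Commute (yXv k hk : Y K r n q) (yg i hi) := by
  induction k with
  | zero =>
    have := ymk_rel (YRel.g_X (K := K) (r := r) (q := q) i hi h)
    rw [map_mul, map_mul] at this
    exact this.symm
  | succ k ih =>
    have h1 : Commute (yg k hk : Y K r n q) (yg i hi) := yg_comm _ _ _ _ (by omega)
    exact (h1.mul_left (ih _ (by omega))).mul_left h1

theorem yX_g_lt (k : ℕ) (hk : k < n) (i : ℕ) (hi : i + 1 < n) (h : i + 1 < k) :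
    Commute (yXv k hk : Y K r n q) (yg i hi) := by
  induction k with
  | zero => omega
  | succ k ih =>
    rcases Nat.lt_or_ge (i + 1) k with h' | h'
    · have h1 : Commute (yg k hk : Y K r n q) (yg i hi) := yg_comm _ _ _ _ (by omega)
      exact (h1.mul_left (ih _ h')).mul_left h1
    · obtain rfl : k = i + 1 := by omega
      have hb := yg_braid (K := K) (r := r) (q := q) i hi hk
      have hx := yX_g_gt (K := K) (r := r) (q := q) i (by omega) (i + 1) hk (by omega)
      change (yg (i + 1) hk * (yg i hi * (yXv i _ : Y K r n q) * yg i hi) * yg (i + 1) hk) * yg i hi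
        = yg i hi * (yg (i + 1) hk * (yg i hi * (yXv i _ : Y K r n q) * yg i hi) * yg (i + 1) hk)
      generalize (yg i hi : Y K r n q) = a at *
      generalize (yg (i + 1) hk : Y K r n q) = b at *
      generalize (yXv i _ : Y K r n q) = x at *
      have hx' : x * b = b * x := hx
      calc (b * (a * x * a) * b) * a = b * a * x * (a * b * a) := by noncomm_ring
        _ = b * a * (x * b) * a * b := by rw [hb]; noncomm_ring
        _ = (b * a * b) * x * a * b := by rw [hx']; noncomm_ring
        _ = a * (b * (a * x * a) * b) := by rw [← hb]; noncomm_ring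

theorem yX_comm_succ (k : ℕ) (hk : k + 1 < n) :
    Commute (yXv k (Nat.lt_of_succ_lt hk) : Y K r n q) (yXv (k + 1) hk) := by
  induction k with
  | zero =>
    have := ymk_rel (YRel.gXgX (K := K) (r := r) (q := q) hk)
    simp only [map_mul] at this
    change ymk (fX K n) * (ymk (fg K n 0 hk) * ymk (fX K n) * ymk (fg K n 0 hk)) =
      (ymk (fg K n 0 hk) * ymk (fX K n) * ymk (fg K n 0 hk)) * ymk (fX K n)
    rw [this]; noncomm_ring
  | succ k ih =>
    have h1 : Commute (yXv (k + 1 + 1) hk : Y K r n q) (yg k (by omega)) :=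
      yX_g_lt _ _ _ _ (by omega)
    have h2 : Commute (yXv (k + 1 + 1) hk : Y K r n q) (yXv k (by omega)) := by
      have h3 : Commute (yg (k + 1) hk : Y K r n q) (yXv k (by omega)) :=
        (yX_g_gt _ _ _ _ (by omega)).symm
      exact (h3.mul_left (ih _).symm).mul_left h3
    exact ((h1.mul_right h2).mul_right h1).symm

theorem yX_comm_add (k d : ℕ) (hk : k + 1 + d < n) :
    Commute (yXv k (by omega) : Y K r n q) (yXv (k + 1 + d) hk) := by
  induction d with
  | zero => exact yX_comm_succ k hk
  | succ d ih =>
    have h3 : Commute (yXv k (by omega) : Y K r n q) (yg (k + 1 + d) hk) :=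
      yX_g_gt _ _ _ _ (by omega)
    exact (h3.mul_right (ih _)).mul_right h3

theorem yX_comm (k l : ℕ) (hk : k < n) (hl : l < n) :
    Commute (yXv k hk : Y K r n q) (yXv l hl) := by
  rcases lt_trichotomy k l with h | rfl | h
  · obtain ⟨d, rfl⟩ := Nat.exists_eq_add_of_le (show k + 1 ≤ l from h)
    exact yX_comm_add k d hl
  · exact Commute.refl _
  · obtain ⟨d, rfl⟩ := Nat.exists_eq_add_of_le (show l + 1 ≤ k from h)
    exact (yX_comm_add l d hk).symm

end YElements

/-! ### The affine Hecke algebra of type A -/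

/-- Generators of the extended affine Hecke algebra: `T i _` is `T_{i+1}`, and `Y j`, `Yinv j` are
`Y_{j+1}`, `Y_{j+1}⁻¹`. -/
inductive HGen (m : ℕ) : Type
  | T (i : ℕ) (hi : i + 1 < m) : HGen m
  | Y (j : Fin m) : HGen m
  | Yinv (j : Fin m) : HGen m

section HeckePresentation

variable (K : Type u) [Field K] (m : ℕ) (q : Kˣ)

/-- The free generator `T_{i+1}`. -/
abbrev fT (i : ℕ) (hi : i + 1 < m) : FreeAlgebra K (HGen m) := FreeAlgebra.ι K (HGen.T i hi)
/-- The free generator `Y_{j+1}`. -/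
abbrev fY (j : Fin m) : FreeAlgebra K (HGen m) := FreeAlgebra.ι K (HGen.Y j)
/-- The free generator `Y_{j+1}⁻¹`. -/
abbrev fYinv (j : Fin m) : FreeAlgebra K (HGen m) := FreeAlgebra.ι K (HGen.Yinv j)

/-- The defining relations of the extended affine Hecke algebra of type A. -/
inductive HRel : FreeAlgebra K (HGen m) → FreeAlgebra K (HGen m) → Prop
  | quad (i : ℕ) (hi : i + 1 < m) :
      HRel ((fT K m i hi - algebraMap K _ (q : K)) *
        (fT K m i hi + algebraMap K _ ((q⁻¹ : Kˣ) : K))) 0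
  | braid (i : ℕ) (hi : i + 1 < m) (hi' : i + 1 + 1 < m) :
      HRel (fT K m i hi * fT K m (i + 1) hi' * fT K m i hi)
        (fT K m (i + 1) hi' * fT K m i hi * fT K m (i + 1) hi')
  | T_comm (i j : ℕ) (hi : i + 1 < m) (hj : j + 1 < m) (hij : i + 2 ≤ j ∨ j + 2 ≤ i) :
      HRel (fT K m i hi * fT K m j hj) (fT K m j hj * fT K m i hi)
  | Y_Yinv (j : Fin m) : HRel (fY K m j * fYinv K m j) 1
  | Yinv_Y (j : Fin m) : HRel (fYinv K m j * fY K m j) 1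
  | Y_comm (i j : Fin m) : HRel (fY K m i * fY K m j) (fY K m j * fY K m i)
  | T_Y_T (i : ℕ) (hi : i + 1 < m) :
      HRel (fT K m i hi * fY K m ⟨i, Nat.lt_of_succ_lt hi⟩ * fT K m i hi) (fY K m ⟨i + 1, hi⟩)
  | T_Y (i : ℕ) (hi : i + 1 < m) (j : Fin m) (h : (j : ℕ) ≠ i) (h' : (j : ℕ) ≠ i + 1) :
      HRel (fT K m i hi * fY K m j) (fY K m j * fT K m i hi)

/-- The extended affine Hecke algebra of type A over the field `K` with parameter `q`. -/
def H : Type u := RingQuot (HRel K m q)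

instance : Ring (H K m q) := inferInstanceAs (Ring (RingQuot (HRel K m q)))
instance : Algebra K (H K m q) := inferInstanceAs (Algebra K (RingQuot (HRel K m q)))

end HeckePresentation

section HElements

variable {K : Type u} [Field K] {m : ℕ} {q : Kˣ}

/-- The quotient map from the free algebra. -/
def hmk : FreeAlgebra K (HGen m) →ₐ[K] H K m q := RingQuot.mkAlgHom K (HRel K m q)

theorem hmk_surjective (a : H K m q) : ∃ b, hmk b = a :=
  RingQuot.mkAlgHom_surjective K (HRel K m q) a

/-- `T_{i+1}` in the affine Hecke algebra. -/
def hT (i : ℕ) (hi : i + 1 < m) : H K m q := hmk (fT K m i hi)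
/-- `Y_{j+1}` in the affine Hecke algebra. -/
def hY (j : Fin m) : H K m q := hmk (fY K m j)
/-- `Y_{j+1}⁻¹` in the affine Hecke algebra. -/
def hYinv (j : Fin m) : H K m q := hmk (fYinv K m j)

variable {A : Type u} [Ring A] [Algebra K A]

/-- The images of the generators under a homomorphism out of the affine Hecke algebra. -/
def hGenMap (T : ∀ i, i + 1 < m → A) (Y Yinv : Fin m → A) : HGen m → A
  | HGen.T i hi => T i hi
  | HGen.Y j => Y j
  | HGen.Yinv j => Yinv j

theorem hLift_aux (q : Kˣ) (T : ∀ i, i + 1 < m → A) (Y Yinv : Fin m → A)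
    (quad : ∀ i hi, T i hi * T i hi = 1 + qq q • T i hi)
    (braid : ∀ i hi hi', T i hi * T (i + 1) hi' * T i hi = T (i + 1) hi' * T i hi * T (i + 1) hi')
    (T_comm : ∀ i j hi hj, (i + 2 ≤ j ∨ j + 2 ≤ i) → T i hi * T j hj = T j hj * T i hi)
    (Y_Yinv : ∀ j, Y j * Yinv j = 1) (Yinv_Y : ∀ j, Yinv j * Y j = 1)
    (Y_comm : ∀ i j, Y i * Y j = Y j * Y i)
    (T_Y_T : ∀ i hi, T i hi * Y ⟨i, Nat.lt_of_succ_lt hi⟩ * T i hi = Y ⟨i + 1, hi⟩)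
    (T_Y : ∀ i hi (j : Fin m), (j : ℕ) ≠ i → (j : ℕ) ≠ i + 1 → T i hi * Y j = Y j * T i hi) :
    ∀ ⦃a b⦄, HRel K m q a b → FreeAlgebra.lift K (hGenMap T Y Yinv) a =
      FreeAlgebra.lift K (hGenMap T Y Yinv) b := by
    intro a b hab
    induction hab with
    | quad i hi =>
      simp only [map_mul, map_sub, map_add, FreeAlgebra.lift_ι_apply, hGenMap, AlgHom.commutes,
        map_zero]
      rw [sub_mul, mul_add, mul_add, quad, ← Algebra.commutes ((q⁻¹ : Kˣ) : K) (T i hi),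
        ← map_mul, Units.mul_inv, map_one, ← Algebra.smul_def, ← Algebra.smul_def, qq, sub_smul]
      abel
    | braid i hi hi' => simpa [hGenMap] using braid i hi hi'
    | T_comm i j hi hj hij => simpa [hGenMap] using T_comm i j hi hj hij
    | Y_Yinv j => simpa [hGenMap] using Y_Yinv j
    | Yinv_Y j => simpa [hGenMap] using Yinv_Y j
    | Y_comm i j => simpa [hGenMap] using Y_comm i j
    | T_Y_T i hi => simpa [hGenMap] using T_Y_T i hi
    | T_Y i hi j h h' => simpa [hGenMap] using T_Y i hi j h h'

/-- A map on generators satisfying the relations extends to the affine Hecke algebra. -/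
def hLift (q : Kˣ) (T : ∀ i, i + 1 < m → A) (Y Yinv : Fin m → A)
    (h : ∀ ⦃a b⦄, HRel K m q a b → FreeAlgebra.lift K (hGenMap T Y Yinv) a =
      FreeAlgebra.lift K (hGenMap T Y Yinv) b) : H K m q →ₐ[K] A :=
  RingQuot.liftAlgHom K ⟨FreeAlgebra.lift K (hGenMap T Y Yinv), h⟩

theorem hLift_hmk (T : ∀ i, i + 1 < m → A) (Y Yinv : Fin m → A)
    (h : ∀ ⦃a b⦄, HRel K m q a b → FreeAlgebra.lift K (hGenMap T Y Yinv) a =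
      FreeAlgebra.lift K (hGenMap T Y Yinv) b) (x : FreeAlgebra K (HGen m)) :
    hLift q T Y Yinv h (hmk x) = FreeAlgebra.lift K (hGenMap T Y Yinv) x :=
  RingQuot.liftAlgHom_mkAlgHom_apply K _ h x

/-- An operator commuting with the images of the generators commutes with the image of the whole
affine Hecke algebra. -/
theorem commute_of_gens (f : H K m q →ₐ[K] A) (z : A)
    (hT' : ∀ i hi, Commute (f (hT i hi)) z) (hY' : ∀ j, Commute (f (hY j)) z)
    (hYi' : ∀ j, Commute (f (hYinv j)) z) (a : H K m q) : Commute (f a) z := by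
  obtain ⟨a, rfl⟩ := hmk_surjective a
  induction a using FreeAlgebra.induction with
  | grade0 c =>
    rw [AlgHom.commutes, AlgHom.commutes]
    exact Algebra.commutes c z
  | grade1 x =>
    cases x with
    | T i hi => exact hT' i hi
    | Y j => exact hY' j
    | Yinv j => exact hYi' j
  | mul a b ha hb => rw [map_mul, map_mul]; exact ha.mul_left hb
  | add a b ha hb => rw [map_add, map_add]; exact ha.add_left hb

end HElements

/-! ### Compositions, and the direct sum of tensor products of affine Hecke algebras -/

/-- The set of `r`-compositions of `n`. -/
abbrev Comp (r n : ℕ) : Type := {μ : Fin r → ℕ // ∑ k, μ k = n}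

section Compositions

variable {r n : ℕ} (μ : Comp r n)

/-- The consecutive blocks of `μ`: the `a`-th place of the `k`-th block is the place
`μ_1 + ⋯ + μ_{k-1} + a` in `{1, …, n}` (all indices starting at `0` in the code). -/
def pos : (Σ k : Fin r, Fin (μ.1 k)) ≃ Fin n := finSigmaFinEquiv.trans (finCongr μ.2)

/-- The index of the block which contains the place `j`. -/
def blk (j : Fin n) : Fin r := ((pos μ).symm j).1

/-- The place of the `a`-th element of the `k`-th block, as a natural number. -/
def place (k : Fin r) (a : ℕ) (ha : a < μ.1 k) : ℕ := (pos μ ⟨k, ⟨a, ha⟩⟩ : ℕ)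

theorem place_lt (k : Fin r) (a : ℕ) (ha : a < μ.1 k) : place μ k a ha < n := (pos μ _).2

theorem place_succ (k : Fin r) (a : ℕ) (ha : a + 1 < μ.1 k) :
    place μ k (a + 1) ha = place μ k a (Nat.lt_of_succ_lt ha) + 1 := by
  simp only [place, pos, Equiv.trans_apply, finCongr_apply, Fin.val_cast, finSigmaFinEquiv_apply]
  omega

theorem place_add (k : Fin r) (a b : ℕ) (ha : a < μ.1 k) (hb : b < μ.1 k) :
    place μ k a ha + b = place μ k b hb + a := by
  simp only [place, pos, Equiv.trans_apply, finCongr_apply, Fin.val_cast, finSigmaFinEquiv_apply]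
  omega

theorem place_succ_lt (k : Fin r) (a : ℕ) (ha : a + 1 < μ.1 k) :
    place μ k a (Nat.lt_of_succ_lt ha) + 1 < n := by
  rw [← place_succ]; exact place_lt μ k _ ha

theorem blk_place (k : Fin r) (a : ℕ) (ha : a < μ.1 k) :
    blk μ ⟨place μ k a ha, place_lt μ k a ha⟩ = k := by
  simp [blk, place]

theorem blk_place_succ (k : Fin r) (a : ℕ) (ha : a + 1 < μ.1 k) :
    blk μ ⟨place μ k a (Nat.lt_of_succ_lt ha) + 1, place_succ_lt μ k a ha⟩ = k := by
  have := blk_place μ k (a + 1) ha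
  simpa only [place_succ] using this

theorem place_inj {k l : Fin r} {a b : ℕ} {ha : a < μ.1 k} {hb : b < μ.1 l}
    (h : place μ k a ha = place μ l b hb) : k = l ∧ a = b := by
  have h1 := (pos μ).injective (Fin.ext h)
  obtain ⟨h2, h3⟩ := Sigma.mk.inj_iff.mp h1
  subst h2
  exact ⟨rfl, by simpa using h3⟩

theorem place_ne {k l : Fin r} (hkl : k ≠ l) (a b : ℕ) (ha : a < μ.1 k) (hb : b < μ.1 l) :
    place μ k a ha ≠ place μ l b hb := fun h => hkl (place_inj μ h).1

end Compositions

section HeckeSum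

variable (K : Type u) [Field K] (r n : ℕ) (q : Kˣ)

variable {r n} in
/-- The tensor product of the affine Hecke algebras attached to the parts of `μ`. -/
abbrev Hmu (μ : Comp r n) : Type u := ⨂[K] k : Fin r, H K (μ.1 k) q

/-- The direct sum over all `r`-compositions `μ` of `n` of the algebras `Hmu μ` (a finite direct
sum of algebras, that is, their product). -/
abbrev Hrn : Type u := ∀ μ : Comp r n, Hmu K q μ

end HeckeSum

/-! ### The groups `G` and `T`, their simple modules -/

/-- The group `G = ℤ/rℤ`, written multiplicatively. -/
abbrev G (r : ℕ) : Type := Multiplicative (ZMod r)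

/-- The group `T = G^n`. -/
abbrev T (r n : ℕ) : Type := Fin n → G r

/-- A complete set `V_1, …, V_r` of pairwise non-isomorphic finite dimensional simple
`K G`-modules. -/
structure SimpleFamily (K : Type u) [Field K] (r : ℕ) where
  V : Fin r → Type u
  [acg : ∀ k, AddCommGroup (V k)]
  [mod : ∀ k, Module K (V k)]
  σ : ∀ k, Representation K (G r) (V k)
  finite : ∀ k, FiniteDimensional K (V k)
  irreducible : ∀ k, (σ k).IsIrreducible
  not_iso : ∀ k l, k ≠ l → IsEmpty ((σ k).Equiv (σ l))
  complete : ∀ (W : Type u) [AddCommGroup W] [Module K W] (τ : Representation K (G r) W),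
    FiniteDimensional K W → τ.IsIrreducible → ∃ k, Nonempty (τ.Equiv (σ k))

attribute [instance] SimpleFamily.acg SimpleFamily.mod

section VMu

variable {K : Type u} [Field K] {r n : ℕ} (S : SimpleFamily K r) (μ : Comp r n)

/-- The vector space `V(μ) = V_1^{⊗ μ_1} ⊗ ⋯ ⊗ V_r^{⊗ μ_r}`. -/
abbrev Vsp : Type u := ⨂[K] j : Fin n, S.V (blk μ j)

/-- The action of `T` on `V(μ)`, where the `j`-th factor of `T` acts on the `j`-th tensor factor. -/
def Vrep : Representation K (T r n) (Vsp S μ) where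
  toFun h := PiTensorProduct.map fun j => S.σ (blk μ j) (h j)
  map_one' := by
    simp only [Pi.one_apply, map_one]
    exact PiTensorProduct.map_one
  map_mul' h h' := by
    simp only [Pi.mul_apply, map_mul]
    exact PiTensorProduct.map_mul _ _

variable [IsAlgClosed K]

/-- Every element of `G` acts on `V_k` by a scalar. -/
theorem exists_scalar (k : Fin r) (g : G r) : ∃ c : K, S.σ k g = c • LinearMap.id := by
  have := S.finite k
  have := S.irreducible k
  have h1 : Module.finrank K (S.V k) = 1 :=
    Representation.IsIrreducible.finrank_eq_one_of_isMulCommutative (S.σ k)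
  obtain ⟨v, hv, hspan⟩ := finrank_eq_one_iff'.mp h1
  obtain ⟨c, hc⟩ := hspan (S.σ k g v)
  refine ⟨c, LinearMap.ext fun w => ?_⟩
  obtain ⟨d, rfl⟩ := hspan w
  rw [map_smul, ← hc, smul_comm]; rfl

/-- The scalar by which an element of `G` acts on `V_k`. -/
def scal (k : Fin r) (g : G r) : K := (exists_scalar S k g).choose

theorem scal_spec (k : Fin r) (g : G r) : S.σ k g = scal S k g • LinearMap.id :=
  (exists_scalar S k g).choose_spec

theorem Vrep_scalar (h : T r n) :
    Vrep S μ h = (∏ j, scal S (blk μ j) (h j)) • LinearMap.id := by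
  refine PiTensorProduct.ext (MultilinearMap.ext fun v => ?_)
  change PiTensorProduct.map (fun j => S.σ (blk μ j) (h j)) (PiTensorProduct.tprod K v) =
    (∏ j, scal S (blk μ j) (h j)) • PiTensorProduct.tprod K v
  rw [PiTensorProduct.map_tprod]
  simp only [scal_spec, LinearMap.smul_apply, LinearMap.id_coe, id_eq]
  exact MultilinearMap.map_smul_univ _ _ _

theorem finrank_Vsp : Module.finrank K (Vsp S μ) = 1 := by
  have h1 : ∀ k, Module.finrank K (S.V k) = 1 := fun k => by
    have := S.finite k
    have := S.irreducible k
    exact Representation.IsIrreducible.finrank_eq_one_of_isMulCommutative (S.σ k)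
  have b := Basis.piTensorProduct fun j : Fin n => Module.basisUnique Unit (h1 (blk μ j))
  rw [Module.finrank_eq_card_basis b]
  simp

instance isSimpleModule_Vrep : IsSimpleModule (MonoidAlgebra K (T r n)) (Vrep S μ).asModule := by
  have h1 : IsSimpleModule K (Vrep S μ).asModule :=
    isSimpleModule_iff_finrank_eq_one.mpr (finrank_Vsp S μ)
  have := IsSimpleModule.nontrivial K (Vrep S μ).asModule
  refine (isSimpleModule_iff _ _).mpr { eq_bot_or_eq_top := fun N => ?_ }
  rcases eq_bot_or_eq_top (N.restrictScalars K) with h | h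
  · exact Or.inl ((Submodule.restrictScalars_eq_bot_iff K _ _).mp h)
  · exact Or.inr ((Submodule.restrictScalars_eq_top_iff K _ _).mp h)

theorem Vrep_sw (i : ℕ) (hi : i + 1 < n)
    (hb : blk μ ⟨i, Nat.lt_of_succ_lt hi⟩ = blk μ ⟨i + 1, hi⟩) (h : T r n) :
    Vrep S μ (fun j => h (sw i hi j)) = Vrep S μ h := by
  rw [Vrep_scalar, Vrep_scalar]
  congr 1
  have hblk : ∀ j, blk μ j = blk μ (sw i hi j) := by
    intro j
    unfold sw
    rw [Equiv.swap_apply_def]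
    split_ifs with h1 h2
    · rw [h1, hb]
    · rw [h2, hb]
    · rfl
  rw [← Equiv.prod_comp (sw i hi) (fun j => scal S (blk μ j) (h j))]
  exact Finset.prod_congr rfl fun j _ => by rw [← hblk]

end VMu

/-! ### `K T` acting on modules over the affine Yokonuma-Hecke algebra -/

section TAction

variable {K : Type u} [Field K] {r n : ℕ} [NeZero r] {q : Kˣ}

/-- `t_{j+1}` as a unit. -/
def ytU (j : Fin n) : (Y K r n q)ˣ := Units.ofPowEqOne (yt j) r (yt_pow j) (NeZero.ne r)

/-- The homomorphism from the `j`-th factor `G` of `T` sending the generator to `t_{j+1}`. -/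
def tHomOne (j : Fin n) : G r →* Y K r n q :=
  (Units.coeHom _).comp
    (AddMonoidHom.toMultiplicativeLeft (ZMod.lift r ⟨(zmultiplesHom (Additive (Y K r n q)ˣ))
      (Additive.ofMul (ytU j)), by
        simp [← ofMul_pow, ytU]⟩))

theorem tHomOne_ofAdd (j : Fin n) (s : ℤ) :
    (tHomOne j (Multiplicative.ofAdd (s : ZMod r)) : Y K r n q) = ((ytU j ^ s : (Y K r n q)ˣ)) := by
  simp [tHomOne]

theorem exists_eq_ofAdd (g : G r) : ∃ s : ℕ, g = Multiplicative.ofAdd ((s : ℤ) : ZMod r) :=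
  ⟨(Multiplicative.toAdd g).val, by simp⟩

theorem tHomOne_pow (j : Fin n) (s : ℕ) :
    (tHomOne j (Multiplicative.ofAdd ((s : ℤ) : ZMod r)) : Y K r n q) = yt j ^ s := by
  rw [tHomOne_ofAdd]; simp [ytU]

theorem tHomOne_comm (i j : Fin n) (x y : G r) :
    Commute (tHomOne i x : Y K r n q) (tHomOne j y) := by
  obtain ⟨s, rfl⟩ := exists_eq_ofAdd x
  obtain ⟨s', rfl⟩ := exists_eq_ofAdd y
  rw [tHomOne_pow, tHomOne_pow]
  exact (yt_comm i j).pow_pow _ _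

/-- The homomorphism from `T` to the affine Yokonuma-Hecke algebra sending the generator of the
`j`-th factor to `t_{j+1}`. -/
def tHom : T r n →* Y K r n q :=
  MonoidHom.noncommPiCoprod (N := fun _ : Fin n => G r) (fun j => tHomOne j) fun i j _ x y => tHomOne_comm i j x y

theorem tHom_single (j : Fin n) (x : G r) :
    (tHom (Pi.mulSingle j x) : Y K r n q) = tHomOne j x :=
  MonoidHom.noncommPiCoprod_mulSingle (N := fun _ : Fin n => G r) (fun j => tHomOne j) j x

theorem yX_tHom (k : ℕ) (hk : k < n) (h : T r n) :
    Commute (yXv k hk : Y K r n q) (tHom h) := by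
  let Z : Submonoid (Y K r n q) := Submonoid.centralizer {yXv k hk}
  have : tHom h ∈ Z := by
    refine Submonoid.noncommProd_mem Z Finset.univ (fun j => (tHomOne j (h j) : Y K r n q))
      (fun _ _ _ _ _ => tHomOne_comm _ _ _ _) fun j _ => ?_
    obtain ⟨s, hs⟩ := exists_eq_ofAdd (h j)
    rw [hs, tHomOne_pow]
    refine Submonoid.pow_mem _ ?_ _
    rw [Submonoid.mem_centralizer_iff]
    rintro _ rfl
    exact yX_t k hk j
  rw [Submonoid.mem_centralizer_iff] at this
  exact this _ rfl

theorem yg_tHom (i : ℕ) (hi : i + 1 < n) (h : T r n) :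
    (yg i hi * tHom h : Y K r n q) = tHom (fun j => h (sw i hi j)) * yg i hi := by
  let f₁ : T r n →* Y K r n q :=
    { toFun := fun h => (ygU i hi : (Y K r n q)ˣ).val * tHom h * ((ygU i hi)⁻¹ : (Y K r n q)ˣ).val
      map_one' := by simp
      map_mul' := by intro a b; simp [mul_assoc] }
  let f₂ : T r n →* Y K r n q :=
    { toFun := fun h => tHom (fun j => h (sw i hi j))
      map_one' := by
        rw [← map_one (tHom (K := K) (q := q))]; rfl
      map_mul' := by intro a b; rw [← map_mul]; rfl }
  have hf : f₁ = f₂ := by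
    apply MonoidHom.pi_ext
    intro j x
    obtain ⟨s, rfl⟩ := exists_eq_ofAdd x
    have hs : (fun l => (Pi.mulSingle j (Multiplicative.ofAdd ((s : ℤ) : ZMod r)) : T r n)
        (sw i hi l)) = Pi.mulSingle (sw i hi j) (Multiplicative.ofAdd ((s : ℤ) : ZMod r)) := by
      funext l
      by_cases hl : l = sw i hi j
      · subst hl; simp [sw]
      · rw [Pi.mulSingle_eq_of_ne hl, Pi.mulSingle_eq_of_ne]
        rintro rfl
        exact hl (by simp [sw])
    change (ygU i hi : (Y K r n q)ˣ).val * (tHom (Pi.mulSingle j _ : T r n) : Y K r n q) *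
      ((ygU i hi)⁻¹ : (Y K r n q)ˣ).val =
      tHom (fun l => (Pi.mulSingle j (Multiplicative.ofAdd ((s : ℤ) : ZMod r)) : T r n) (sw i hi l))
    rw [hs, tHom_single, tHom_single, tHomOne_pow, tHomOne_pow, Units.mul_inv_eq_iff_eq_mul]
    exact yg_pow_t i hi j s
  have := congrArg (fun f => f h * (ygU i hi : (Y K r n q)ˣ).val) hf
  change (ygU i hi).val * tHom h * ((ygU i hi)⁻¹).val * (ygU i hi).val = _ at this
  rwa [Units.inv_mul_cancel_right] at this

end TAction

/-! ### Isotypic subspaces and the `Hmu`-module `Hom_{KT}(V(μ), I_μ N)` -/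

section HomSpace

variable {K : Type u} [Field K] {r n : ℕ} [NeZero r] (q : Kˣ)
variable (S : SimpleFamily K r) (μ : Comp r n)
variable (N : Type u) [AddCommGroup N] [Module K N] [Module (Y K r n q) N]
  [IsScalarTower K (Y K r n q) N]

variable (r n) in
/-- The restriction to `T` of a module over the affine Yokonuma-Hecke algebra. -/
def tRep : Representation K (T r n) N :=
  ((Algebra.lsmul K K N : Y K r n q →ₐ[K] Module.End K N) : Y K r n q →* Module.End K N).comp tHom

theorem tRep_apply (h : T r n) (x : N) : tRep r n q N h x = (tHom h : Y K r n q) • x := rfl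

/-- The isotypic subspace `I_μ N`: the sum of all `K T`-submodules of `N` isomorphic to `V(μ)`. -/
abbrev Isot : Submodule (MonoidAlgebra K (T r n)) (tRep r n q N).asModule :=
  isotypicComponent (MonoidAlgebra K (T r n)) (tRep r n q N).asModule (Vrep S μ).asModule

/-- The space `Hom_{KT}(V(μ), I_μ N)`. -/
def HomMu : Type u :=
  (Vrep S μ).asModule →ₗ[MonoidAlgebra K (T r n)] Isot q S μ N

instance : AddCommGroup (HomMu q S μ N) :=
  inferInstanceAs (AddCommGroup ((Vrep S μ).asModule →ₗ[MonoidAlgebra K (T r n)] Isot q S μ N))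

instance : SMulCommClass (MonoidAlgebra K (T r n)) K (tRep r n q N).asModule :=
  IsScalarTower.to_smulCommClass'

instance : Module K (HomMu q S μ N) :=
  inferInstanceAs (Module K ((Vrep S μ).asModule →ₗ[MonoidAlgebra K (T r n)] Isot q S μ N))

variable {q S μ N}

/-- An element of `Hom_{KT}(V(μ), I_μ N)` as a linear map. -/
def toLin (φ : HomMu q S μ N) :
    (Vrep S μ).asModule →ₗ[MonoidAlgebra K (T r n)] Isot q S μ N := φ

/-- The `K`-linear map underlying an element of `Hom_{KT}(V(μ), I_μ N)`, with values in `N`. -/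
def ev (φ : HomMu q S μ N) : Vsp S μ →ₗ[K] N where
  toFun v := (tRep r n q N).asModuleEquiv
    (toLin φ ((Vrep S μ).asModuleEquiv.symm v)).1
  map_add' a b := by simp only [map_add, Submodule.coe_add]
  map_smul' c a := by
    rw [map_smul, ← algebraMap_smul (MonoidAlgebra K (T r n)) c, map_smul, Submodule.coe_smul,
      algebraMap_smul, map_smul]
    rfl

theorem ev_ext {φ ψ : HomMu q S μ N} (h : ∀ v, ev φ v = ev ψ v) : φ = ψ :=
  LinearMap.ext fun v => Subtype.ext (h v)

theorem ev_add (φ ψ : HomMu q S μ N) (v) : ev (φ + ψ) v = ev φ v + ev ψ v := rfl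

theorem ev_smul (c : K) (φ : HomMu q S μ N) (v) : ev (c • φ) v = c • ev φ v := rfl

theorem ev_T (φ : HomMu q S μ N) (h : T r n) (v : Vsp S μ) :
    ev φ (Vrep S μ h v) = (tHom h : Y K r n q) • ev φ v := by
  change (tRep r n q N).asModuleEquiv
    (toLin φ ((Vrep S μ).asModuleEquiv.symm (Vrep S μ h v))).1 = _
  rw [Representation.asModuleEquiv_symm_map_rho, map_smul, Submodule.coe_smul,
    Representation.asModuleEquiv_map_smul, Representation.asAlgebraHom_of]
  rfl

variable (S μ N) in
/-- The elements `a` such that `v ↦ a • φ v` commutes with `T` for each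
`φ` in `Hom_{KT}(V(μ), I_μ N)`. -/
def Good (a : Y K r n q) : Prop :=
  ∀ (φ : HomMu q S μ N) (h : T r n) (v : Vsp S μ),
    a • ev φ (Vrep S μ h v) = (tHom h : Y K r n q) • (a • ev φ v)

theorem good_of_commute {a : Y K r n q} (h : ∀ h : T r n, Commute a (tHom h)) :
    Good S μ N a := fun φ h' v => by
  rw [ev_T, smul_smul, smul_smul, (h h').eq]

theorem good_X (k : ℕ) (hk : k < n) : Good S μ N (yXv k hk : Y K r n q) :=
  good_of_commute (yX_tHom k hk)

theorem good_Xinv (k : ℕ) (hk : k < n) : Good S μ N ((yX k hk)⁻¹ : (Y K r n q)ˣ).val :=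
  good_of_commute fun h => (yX_tHom k hk h).units_inv_left

variable [IsAlgClosed K]

/-- A `K`-linear map from `V(μ)` to `N` which commutes with `T` takes its values in `I_μ N`. -/
def mkHom (f : Vsp S μ →ₗ[K] N)
    (hf : ∀ (h : T r n) v, f (Vrep S μ h v) = (tHom h : Y K r n q) • f v) : HomMu q S μ N :=
  let f' : (Vrep S μ).asModule →ₗ[MonoidAlgebra K (T r n)] (tRep r n q N).asModule :=
    Representation.IntertwiningMap.equivLinearMapAsModule (Vrep S μ) (tRep r n q N)
      ⟨f, fun h => LinearMap.ext (hf h)⟩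
  f'.codRestrict (Isot q S μ N) fun v => by
    have h1 := LinearMap.le_comap_isotypicComponent (Vrep S μ).asModule f'
    have h2 : (⊤ : Submodule (MonoidAlgebra K (T r n)) (Vrep S μ).asModule) ≤
        isotypicComponent _ _ (Vrep S μ).asModule := le_sSup ⟨Submodule.topEquiv⟩
    exact h1 (h2 trivial)

theorem ev_mkHom (f : Vsp S μ →ₗ[K] N)
    (hf : ∀ (h : T r n) v, f (Vrep S μ h v) = (tHom h : Y K r n q) • f v) (v) :
    ev (mkHom f hf : HomMu q S μ N) v = f v := rfl

variable (S μ N) in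
/-- The operator `φ ↦ (v ↦ a • φ v)` on `Hom_{KT}(V(μ), I_μ N)`. -/
def op (a : Y K r n q) (ha : Good S μ N a) : Module.End K (HomMu q S μ N) where
  toFun φ := mkHom ((Algebra.lsmul K K N a).comp (ev φ)) (ha φ)
  map_add' _ _ := ev_ext fun _ => smul_add a _ _
  map_smul' c _ := ev_ext fun _ => (Algebra.lsmul K K N a).map_smul c _

theorem ev_op (a : Y K r n q) (ha : Good S μ N a) (φ) (v) : ev (op S μ N a ha φ) v = a • ev φ v :=
  rfl

theorem good_g (i : ℕ) (hi : i + 1 < n)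
    (hb : blk μ ⟨i, Nat.lt_of_succ_lt hi⟩ = blk μ ⟨i + 1, hi⟩) :
    Good S μ N (yg i hi : Y K r n q) := fun φ h v => by
  rw [← Vrep_sw S μ i hi hb h, ev_T, smul_smul, smul_smul, yg_tHom]
  congr 3
  funext j
  simp [sw]

theorem t_pow_smul (i : ℕ) (hi : i + 1 < n)
    (hb : blk μ ⟨i, Nat.lt_of_succ_lt hi⟩ = blk μ ⟨i + 1, hi⟩) (s : ℕ)
    (φ : HomMu q S μ N) (v : Vsp S μ) :
    (yt ⟨i + 1, hi⟩ ^ s : Y K r n q) • ev φ v =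
      (yt ⟨i, Nat.lt_of_succ_lt hi⟩ ^ s : Y K r n q) • ev φ v := by
  rw [← tHomOne_pow, ← tHomOne_pow, ← tHom_single, ← tHom_single, ← ev_T, ← ev_T,
    ← Vrep_sw S μ i hi hb]
  congr 3
  funext l
  by_cases hl : l = ⟨i, Nat.lt_of_succ_lt hi⟩
  · subst hl; simp [sw]
  · rw [Pi.mulSingle_eq_of_ne hl, Pi.mulSingle_eq_of_ne]
    intro h
    rw [sw, Equiv.swap_apply_eq_iff, Equiv.swap_apply_right] at h
    exact hl h

theorem e_smul [NeZero (r : K)] (i : ℕ) (hi : i + 1 < n)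
    (hb : blk μ ⟨i, Nat.lt_of_succ_lt hi⟩ = blk μ ⟨i + 1, hi⟩)
    (φ : HomMu q S μ N) (v : Vsp S μ) : (ye i hi : Y K r n q) • ev φ v = ev φ v := by
  have h1 : ∀ s ∈ Finset.range r, (yt ⟨i, Nat.lt_of_succ_lt hi⟩ ^ s * yt ⟨i + 1, hi⟩ ^ (r - s) :
      Y K r n q) • ev φ v = ev φ v := by
    intro s hs
    rw [mul_smul, t_pow_smul i hi hb, smul_smul, ← pow_add,
      Nat.add_sub_cancel' (Finset.mem_range.mp hs).le, yt_pow, one_smul]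
  rw [ye_eq, smul_assoc, Finset.sum_smul, Finset.sum_congr rfl h1, Finset.sum_const,
    Finset.card_range, ← Nat.cast_smul_eq_nsmul K, smul_smul, inv_mul_cancel₀ (NeZero.ne _),
    one_smul]

variable (S μ N) in
/-- The operator `T_a ⋄ φ` for the `a`-th simple transposition of the `k`-th block. -/
def opT (k : Fin r) (a : ℕ) (ha : a + 1 < μ.1 k) : Module.End K (HomMu q S μ N) :=
  op S μ N (yg (place μ k a (Nat.lt_of_succ_lt ha)) (place_succ_lt μ k a ha))
    (good_g _ _ (by rw [blk_place μ k a, blk_place_succ μ k a ha]))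

variable (S μ N) in
/-- The operator `Y_j ⋄ φ` for the `j`-th place of the `k`-th block. -/
def opY (k : Fin r) (j : Fin (μ.1 k)) : Module.End K (HomMu q S μ N) :=
  op S μ N (yXv (place μ k j j.2) (place_lt μ k j j.2)) (good_X _ _)

variable (S μ N) in
/-- The operator `Y_j⁻¹ ⋄ φ` for the `j`-th place of the `k`-th block. -/
def opYinv (k : Fin r) (j : Fin (μ.1 k)) : Module.End K (HomMu q S μ N) :=
  op S μ N ((yX (place μ k j j.2) (place_lt μ k j j.2))⁻¹ : (Y K r n q)ˣ).val (good_Xinv _ _)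

theorem ev_opT (k : Fin r) (a : ℕ) (ha : a + 1 < μ.1 k) (φ : HomMu q S μ N) (v : Vsp S μ) :
    ev (opT S μ N k a ha φ) v =
      (yg (place μ k a (Nat.lt_of_succ_lt ha)) (place_succ_lt μ k a ha) : Y K r n q) • ev φ v :=
  rfl

theorem ev_opY (k : Fin r) (j : Fin (μ.1 k)) (φ : HomMu q S μ N) (v : Vsp S μ) :
    ev (opY S μ N k j φ) v =
      (yXv (place μ k j j.2) (place_lt μ k j j.2) : Y K r n q) • ev φ v := rfl

theorem ev_opYinv (k : Fin r) (j : Fin (μ.1 k)) (φ : HomMu q S μ N) (v : Vsp S μ) :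
    ev (opYinv S μ N k j φ) v =
      ((yX (place μ k j j.2) (place_lt μ k j j.2))⁻¹ : (Y K r n q)ˣ).val • ev φ v := rfl

theorem act_rel [NeZero (r : K)] (k : Fin r) ⦃a b⦄ (h : HRel K (μ.1 k) q a b) :
    FreeAlgebra.lift K (hGenMap (opT (q := q) S μ N k) (opY S μ N k) (opYinv S μ N k)) a =
      FreeAlgebra.lift K (hGenMap (opT S μ N k) (opY S μ N k) (opYinv S μ N k)) b := by
  refine hLift_aux q (opT S μ N k) (opY S μ N k) (opYinv S μ N k)
    (fun a ha => LinearMap.ext fun φ => ev_ext fun v => by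
      change (yg _ _ : Y K r n q) • (yg _ _ : Y K r n q) • ev φ v =
        ev φ v + qq q • ((yg _ _ : Y K r n q) • ev φ v)
      rw [smul_smul, yg_sq, add_smul, one_smul, smul_assoc, (ye_g_comm _ _).eq, mul_smul, e_smul]
      rw [blk_place μ k a, blk_place_succ μ k a ha])
    (fun a ha ha' => LinearMap.ext fun φ => ev_ext fun v => by
      simp only [Module.End.mul_apply, ev_opT, smul_smul]
      simp only [place_succ, ← mul_assoc]
      rw [yg_braid])
    (fun a b ha hb hab => LinearMap.ext fun φ => ev_ext fun v => by
      simp only [Module.End.mul_apply, ev_opT, smul_smul]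
      have h1 := place_add μ k a b (Nat.lt_of_succ_lt ha) (Nat.lt_of_succ_lt hb)
      rw [(yg_comm _ _ _ _ (by omega)).eq])
    (fun j => LinearMap.ext fun φ => ev_ext fun v => by
      simp [Module.End.mul_apply, ev_opY, ev_opYinv, smul_smul])
    (fun j => LinearMap.ext fun φ => ev_ext fun v => by
      simp [Module.End.mul_apply, ev_opY, ev_opYinv, smul_smul])
    (fun i j => LinearMap.ext fun φ => ev_ext fun v => by
      simp only [Module.End.mul_apply, ev_opY, smul_smul]
      rw [(yX_comm _ _ _ _).eq])
    (fun a ha => LinearMap.ext fun φ => ev_ext fun v => by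
      simp only [Module.End.mul_apply, ev_opT, ev_opY, smul_smul]
      simp only [place_succ]
      rw [← mul_assoc]; rfl)
    (fun a ha j hj hj' => LinearMap.ext fun φ => ev_ext fun v => by
      simp only [Module.End.mul_apply, ev_opT, ev_opY, smul_smul]
      have h1 := place_add μ k a j (Nat.lt_of_succ_lt ha) j.2
      rcases Nat.lt_or_ge j a with h | h
      · rw [(yX_g_gt _ _ _ _ (by omega)).eq]
      · rw [(yX_g_lt _ _ _ _ (by omega)).eq]) h

variable (S μ N) in
/-- The action of the `k`-th tensor factor of `Hmu` on `Hom_{KT}(V(μ), I_μ N)`: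
`(T_i ⋄ φ)(v) = g_i φ(v)` and `(Y_j^{±1} ⋄ φ)(v) = X_j^{±1} φ(v)`, where the indices `i`, `j` of
the `k`-th block are shifted to the corresponding places of `{1, …, n}`. -/
def actOne [NeZero (r : K)] (k : Fin r) : H K (μ.1 k) q →ₐ[K] Module.End K (HomMu q S μ N) :=
  hLift q (opT S μ N k) (opY S μ N k) (opYinv S μ N k) (act_rel k)

theorem actOne_T [NeZero (r : K)] (k : Fin r) (a : ℕ) (ha : a + 1 < μ.1 k)
    (φ : HomMu q S μ N) (v : Vsp S μ) :
    ev (actOne S μ N k (hT a ha : H K (μ.1 k) q) φ) v =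
      (yg (place μ k a (Nat.lt_of_succ_lt ha)) (place_succ_lt μ k a ha) : Y K r n q) • ev φ v := by
  rw [actOne, hT, hLift_hmk, FreeAlgebra.lift_ι_apply]
  rfl

theorem actOne_Y [NeZero (r : K)] (k : Fin r) (j : Fin (μ.1 k))
    (φ : HomMu q S μ N) (v : Vsp S μ) :
    ev (actOne S μ N k (hY j : H K (μ.1 k) q) φ) v =
      (yXv (place μ k j j.2) (place_lt μ k j j.2) : Y K r n q) • ev φ v := by
  rw [actOne, hY, hLift_hmk, FreeAlgebra.lift_ι_apply]
  rfl

theorem actOne_Yinv [NeZero (r : K)] (k : Fin r) (j : Fin (μ.1 k))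
    (φ : HomMu q S μ N) (v : Vsp S μ) :
    ev (actOne S μ N k (hYinv j : H K (μ.1 k) q) φ) v =
      ((yX (place μ k j j.2) (place_lt μ k j j.2))⁻¹ : (Y K r n q)ˣ).val • ev φ v := by
  rw [actOne, hYinv, hLift_hmk, FreeAlgebra.lift_ι_apply]
  rfl

theorem actOne_commute [NeZero (r : K)] {k l : Fin r} (hkl : k ≠ l) (x : H K (μ.1 k) q)
    (y : H K (μ.1 l) q) : Commute (actOne S μ N k x) (actOne S μ N l y) := by
  have key : ∀ (k l : Fin r), k ≠ l → ∀ (a : ℕ) (ha : a + 1 < μ.1 k) (j : Fin (μ.1 l)),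
      Commute (yg (place μ k a (Nat.lt_of_succ_lt ha)) (place_succ_lt μ k a ha) : Y K r n q)
        (yXv (place μ l j j.2) (place_lt μ l j j.2)) := by
    intro k l hkl a ha j
    have h1 := place_ne (μ := μ) hkl a j (Nat.lt_of_succ_lt ha) j.2
    have h2 := place_ne (μ := μ) hkl (a + 1) j ha j.2
    rw [place_succ] at h2
    rcases Nat.lt_or_ge (place μ l j j.2) (place μ k a (Nat.lt_of_succ_lt ha)) with h | h
    · exact (yX_g_gt _ _ _ _ h).symm
    · exact (yX_g_lt _ _ _ _ (by omega)).symm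
  have ext2 : ∀ {f g : Module.End K (HomMu q S μ N)},
      (∀ φ v, ev (f (g φ)) v = ev (g (f φ)) v) → Commute f g :=
    fun h => LinearMap.ext fun φ => ev_ext (h φ)
  refine commute_of_gens _ _ ?_ ?_ ?_ x
  · intro i hi
    refine (commute_of_gens _ _ ?_ ?_ ?_ y).symm
    · intro j hj
      refine ext2 fun φ v => ?_
      simp only [actOne_T, smul_smul]
      have h1 := place_ne (μ := μ) hkl i j (Nat.lt_of_succ_lt hi) (Nat.lt_of_succ_lt hj)
      have h2 := place_ne (μ := μ) hkl (i + 1) j hi (Nat.lt_of_succ_lt hj)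
      have h3 := place_ne (μ := μ) hkl i (j + 1) (Nat.lt_of_succ_lt hi) hj
      rw [place_succ] at h2 h3
      rw [(yg_comm _ _ _ _ (by omega)).eq]
    · intro j
      refine ext2 fun φ v => ?_
      simp only [actOne_T, actOne_Y, smul_smul]
      rw [(key k l hkl i hi j).eq]
    · intro j
      refine ext2 fun φ v => ?_
      simp only [actOne_T, actOne_Yinv, smul_smul]
      rw [((key k l hkl i hi j).units_inv_right).eq]
  · intro i
    refine (commute_of_gens _ _ ?_ ?_ ?_ y).symm
    · intro j hj
      refine ext2 fun φ v => ?_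
      simp only [actOne_T, actOne_Y, smul_smul]
      rw [(key l k hkl.symm j hj i).eq]
    · intro j
      refine ext2 fun φ v => ?_
      simp only [actOne_Y, smul_smul]
      rw [(yX_comm _ _ _ _).eq]
    · intro j
      refine ext2 fun φ v => ?_
      simp only [actOne_Y, actOne_Yinv, smul_smul]
      rw [((yX_comm _ _ _ _).units_inv_right).eq]
  · intro i
    refine (commute_of_gens _ _ ?_ ?_ ?_ y).symm
    · intro j hj
      refine ext2 fun φ v => ?_
      simp only [actOne_T, actOne_Yinv, smul_smul]
      rw [((key l k hkl.symm j hj i).units_inv_right).eq]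
    · intro j
      refine ext2 fun φ v => ?_
      simp only [actOne_Y, actOne_Yinv, smul_smul]
      rw [((yX_comm _ _ _ _).units_inv_right).eq]
    · intro j
      refine ext2 fun φ v => ?_
      simp only [actOne_Yinv, smul_smul]
      rw [((yX_comm _ _ _ _).units_inv_right.units_inv_left).eq]

end HomSpace

/-! ### Homomorphisms out of a tensor product of algebras -/

section TensorLift

variable {K : Type u} [Field K] {E : Type u} [Ring E] [Algebra K E]

theorem prod_ofFn_mul {s : ℕ} (x y : Fin s → E) (h : ∀ i j, i ≠ j → Commute (x i) (y j)) :
    (List.ofFn fun i => x i * y i).prod = (List.ofFn x).prod * (List.ofFn y).prod := by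
  induction s with
  | zero => simp
  | succ s ih =>
    have h1 : Commute (List.ofFn fun i : Fin s => x i.succ).prod (y 0) := by
      refine Commute.list_prod_left _ _ fun z hz => ?_
      obtain ⟨i, rfl⟩ := List.mem_ofFn.mp hz
      exact h _ _ (Fin.succ_ne_zero i)
    simp only [List.ofFn_succ, List.prod_cons]
    rw [ih (fun i => x i.succ) (fun i => y i.succ) fun i j hij =>
      h _ _ fun h' => hij (Fin.succ_injective _ h')]
    rw [mul_assoc, mul_assoc, ← mul_assoc (y 0), ← h1.eq, mul_assoc]

/-- Pairwise commuting homomorphisms `f_k : A_k → E` induce a homomorphism from the tensor product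
of the algebras `A_k`, sending `a_1 ⊗ ⋯ ⊗ a_s` to `f_1(a_1) ⋯ f_s(a_s)`. -/
def tensorLift {s : ℕ} {A : Fin s → Type u} [∀ k, Ring (A k)] [∀ k, Algebra K (A k)]
    (f : ∀ k, A k →ₐ[K] E) (hf : ∀ k l, k ≠ l → ∀ x y, Commute (f k x) (f l y)) :
    (⨂[K] k, A k) →ₐ[K] E :=
  PiTensorProduct.liftAlgHom
    ((MultilinearMap.mkPiAlgebraFin K s E).compLinearMap fun k => (f k).toLinearMap)
    (by simp)
    (fun x y => by
      simp only [MultilinearMap.compLinearMap_apply, MultilinearMap.mkPiAlgebraFin_apply,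
        AlgHom.toLinearMap_apply, Pi.mul_apply, map_mul]
      exact prod_ofFn_mul _ _ fun i j hij => hf i j hij _ _)

theorem tensorLift_tprod {s : ℕ} {A : Fin s → Type u} [∀ k, Ring (A k)] [∀ k, Algebra K (A k)]
    (f : ∀ k, A k →ₐ[K] E) (hf : ∀ k l, k ≠ l → ∀ x y, Commute (f k x) (f l y)) (a : ∀ k, A k) :
    tensorLift f hf (PiTensorProduct.tprod K a) = (List.ofFn fun k => f k (a k)).prod := by
  simp [tensorLift, MultilinearMap.mkPiAlgebraFin_apply]

variable {M M' : Type u} [AddCommGroup M] [Module K M] [AddCommGroup M'] [Module K M']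

theorem intertwine_list {s : ℕ} (L : M →ₗ[K] M') (x : Fin s → Module.End K M)
    (y : Fin s → Module.End K M') (h : ∀ k m, L (x k m) = y k (L m)) (m : M) :
    L ((List.ofFn x).prod m) = (List.ofFn y).prod (L m) := by
  induction s generalizing m with
  | zero => simp
  | succ s ih =>
    simp only [List.ofFn_succ, List.prod_cons, Module.End.mul_apply]
    rw [h, ih (fun i => x i.succ) (fun i => y i.succ) fun k => h _]

theorem intertwine_tensorLift {s : ℕ} {A : Fin s → Type u} [∀ k, Ring (A k)]
    [∀ k, Algebra K (A k)] (f : ∀ k, A k →ₐ[K] Module.End K M)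
    (hf : ∀ k l, k ≠ l → ∀ x y, Commute (f k x) (f l y)) (f' : ∀ k, A k →ₐ[K] Module.End K M')
    (hf' : ∀ k l, k ≠ l → ∀ x y, Commute (f' k x) (f' l y)) (L : M →ₗ[K] M')
    (h : ∀ k a m, L (f k a m) = f' k a (L m)) (a : ⨂[K] k, A k) (m : M) :
    L (tensorLift f hf a m) = tensorLift f' hf' a (L m) := by
  induction a using PiTensorProduct.induction_on generalizing m with
  | smul_tprod c a =>
    rw [map_smul, map_smul, LinearMap.smul_apply, LinearMap.smul_apply, map_smul,
      tensorLift_tprod, tensorLift_tprod, intertwine_list L _ _ fun k => h k _]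
  | add a b ha hb =>
    rw [map_add, map_add, LinearMap.add_apply, LinearMap.add_apply, map_add, ha, hb]

theorem intertwine_hecke {q : Kˣ} {m : ℕ} (f : H K m q →ₐ[K] Module.End K M)
    (f' : H K m q →ₐ[K] Module.End K M') (L : M →ₗ[K] M')
    (hT' : ∀ i hi x, L (f (hT i hi) x) = f' (hT i hi) (L x))
    (hY' : ∀ j x, L (f (hY j) x) = f' (hY j) (L x))
    (hYi' : ∀ j x, L (f (hYinv j) x) = f' (hYinv j) (L x)) (a : H K m q) (x : M) :
    L (f a x) = f' a (L x) := by
  obtain ⟨a, rfl⟩ := hmk_surjective a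
  induction a using FreeAlgebra.induction generalizing x with
  | grade0 c =>
    rw [AlgHom.commutes, AlgHom.commutes, AlgHom.commutes]
    simp [Module.algebraMap_end_apply]
  | grade1 z =>
    cases z with
    | T i hi => exact hT' i hi _
    | Y j => exact hY' j _
    | Yinv j => exact hYi' j _
  | mul a b ha hb =>
    rw [map_mul, map_mul, map_mul, Module.End.mul_apply, Module.End.mul_apply, ha, hb]
  | add a b ha hb =>
    rw [map_add, map_add, map_add, LinearMap.add_apply, LinearMap.add_apply, map_add, ha, hb]

end TensorLift

/-! ### Categories of finite dimensional modules -/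

section FiniteDimensional

variable (K : Type u) [Field K] (A : Type u) [Ring A] [Algebra K A]

/-- The property of being finite dimensional over `K`, for a module over the `K`-algebra `A`. -/
def fd : ObjectProperty (ModuleCat.{u} A) := fun M => Module.Finite K M

/-- The category `A`-`mod` of finite dimensional left `A`-modules. -/
abbrev FDMod := (fd K A).FullSubcategory

variable {A} in
theorem fd_of (M : Type u) [AddCommGroup M] [Module K M] [Module A M] [IsScalarTower K A M]
    [Module.Finite K M] : fd K A (ModuleCat.of A M) := by
  have h : (ModuleCat.of A M).moduleOfAlgebraModule (k := K) = ‹Module K M› :=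
    Module.ext' _ _ fun c x => algebraMap_smul A c x
  change @Module.Finite K M _ _ ((ModuleCat.of A M).moduleOfAlgebraModule (k := K))
  rw [h]
  infer_instance

end FiniteDimensional

/-! ### The functor `F` -/

section FunctorF

variable {K : Type u} [Field K] [IsAlgClosed K] {r n : ℕ} [NeZero r] [NeZero (r : K)] (q : Kˣ)
variable (S : SimpleFamily K r)

section Objects

variable (N : Type u) [AddCommGroup N] [Module K N] [Module (Y K r n q) N]
  [IsScalarTower K (Y K r n q) N]
variable (N' : Type u) [AddCommGroup N'] [Module K N'] [Module (Y K r n q) N']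
  [IsScalarTower K (Y K r n q) N']

/-- The action of `Hmu μ` on `Hom_{KT}(V(μ), I_μ N)`. -/
def actMu (μ : Comp r n) : Hmu K q μ →ₐ[K] Module.End K (HomMu q S μ N) :=
  tensorLift (fun k => actOne S μ N k) fun _ _ hkl => actOne_commute hkl

instance (μ : Comp r n) : Module (Hmu K q μ) (HomMu q S μ N) :=
  Module.compHom (HomMu q S μ N) (actMu q S N μ).toRingHom

instance (μ : Comp r n) : IsScalarTower K (Hmu K q μ) (HomMu q S μ N) where
  smul_assoc c a φ := by
    change actMu q S N μ (c • a) φ = c • actMu q S N μ a φ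
    rw [map_smul]; rfl

variable (r n) in
/-- The vector space `⨁_μ Hom_{KT}(V(μ), I_μ N)`, with the componentwise action of the direct sum
of the algebras `Hmu μ`. -/
abbrev FObj : Type u := ∀ μ : Comp r n, HomMu q S μ N

/-- A homomorphism `N → N'` restricts to `I_μ N → I_μ N'` and induces by composition a map
`Hom_{KT}(V(μ), I_μ N) → Hom_{KT}(V(μ), I_μ N')`. -/
def homMap (f : N →ₗ[Y K r n q] N') (μ : Comp r n) : HomMu q S μ N →ₗ[Hmu K q μ] HomMu q S μ N' :=
  let L : HomMu q S μ N →ₗ[K] HomMu q S μ N' :=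
    { toFun := fun φ => mkHom ((f.restrictScalars K).comp (ev φ)) fun h v => by
        simp [ev_T]
      map_add' := fun _ _ => ev_ext fun _ => f.map_add _ _
      map_smul' := fun c _ => ev_ext fun _ => (f.restrictScalars K).map_smul c _ }
  have hL : ∀ (φ : HomMu q S μ N) (v : Vsp S μ), ev (L φ) v = f (ev φ v) := fun _ _ => rfl
  { toFun := L
    map_add' := L.map_add
    map_smul' := fun a φ => intertwine_tensorLift _
      (fun _ _ hkl => actOne_commute hkl) _ (fun _ _ hkl => actOne_commute hkl) L (fun k a x => intertwine_hecke _ _ L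
      (fun i hi x => ev_ext fun v => by rw [hL, actOne_T, actOne_T, hL, map_smul])
      (fun j x => ev_ext fun v => by rw [hL, actOne_Y, actOne_Y, hL, map_smul])
      (fun j x => ev_ext fun v => by rw [hL, actOne_Yinv, actOne_Yinv, hL, map_smul]) a x) a φ }

theorem ev_homMap (f : N →ₗ[Y K r n q] N') (μ : Comp r n) (φ : HomMu q S μ N) (v : Vsp S μ) :
    ev (homMap q S N N' f μ φ) v = f (ev φ v) := rfl

/-- The map `⨁_μ Hom_{KT}(V(μ), I_μ N) → ⨁_μ Hom_{KT}(V(μ), I_μ N')` induced by `N → N'`. -/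
def FMap (f : N →ₗ[Y K r n q] N') : FObj r n q S N →ₗ[Hrn K r n q] FObj r n q S N' where
  toFun x μ := homMap q S N N' f μ (x μ)
  map_add' _ _ := funext fun μ => (homMap q S N N' f μ).map_add _ _
  map_smul' _ _ := funext fun μ => (homMap q S N N' f μ).map_smul _ _

instance finite_HomMu [Module.Finite K N] (μ : Comp r n) : Module.Finite K (HomMu q S μ N) := by
  have hfin : ∀ k, Module.Finite K (S.V k) := S.finite
  have hV : Module.Finite K (Vsp S μ) := inferInstance
  let L : HomMu q S μ N →ₗ[K] (Vsp S μ →ₗ[K] N) :=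
    { toFun := ev
      map_add' := fun _ _ => rfl
      map_smul' := fun _ _ => rfl }
  exact Module.Finite.of_injective L fun φ ψ h => ev_ext fun v => LinearMap.congr_fun h v

instance finite_Comp : Finite (Comp r n) := by
  refine Finite.of_injective (β := Fin r → Fin (n + 1)) (fun μ k => ⟨μ.1 k, ?_⟩) ?_
  · have h := Finset.single_le_sum (f := μ.1) (fun _ _ => Nat.zero_le _) (Finset.mem_univ k)
    rw [μ.2] at h
    exact Nat.lt_succ_of_le h
  · intro μ ν h
    exact Subtype.ext (funext fun k => by simpa using congrFun h k)

instance : IsScalarTower K (Hrn K r n q) (FObj r n q S N) where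
  smul_assoc c a x := funext fun μ => smul_assoc c (a μ) (x μ)

end Objects

/-- The functor `F(N) = ⨁_μ Hom_{KT}(V(μ), I_μ N)` from finite dimensional modules over the affine
Yokonuma-Hecke algebra to finite dimensional modules over the direct sum of the tensor products of
affine Hecke algebras. -/
def functorF : FDMod K (Y K r n q) ⥤ FDMod K (Hrn K r n q) where
  obj N := ⟨ModuleCat.of (Hrn K r n q) (FObj r n q S N.obj), by
    have : Module.Finite K N.obj := N.property
    exact fd_of K (FObj r n q S N.obj)⟩
  map f := ObjectProperty.homMk (ModuleCat.ofHom (FMap q S _ _ f.hom.hom))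
  map_id N := rfl
  map_comp f g := rfl

end FunctorF

/-! ### Induction from a subalgebra -/

section Induction

variable {K : Type u} [Field K] {A : Type u} [Ring A] [Algebra K A] (B : Subalgebra K A)
variable {W : Type u} [AddCommGroup W] [Module K W] (θ : B →ₐ[K] Module.End K W)
variable {W' : Type u} [AddCommGroup W'] [Module K W'] (θ' : B →ₐ[K] Module.End K W')

/-- The relations `a b ⊗ w = a ⊗ b w` defining the tensor product over `B`. -/
def indRel : Submodule A (A ⊗[K] W) :=
  Submodule.span A {x | ∃ (a : A) (b : B) (w : W), x = (a * (b : A)) ⊗ₜ[K] w - a ⊗ₜ[K] θ b w}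

/-- The induced module `Ind_B^A W = A ⊗_B W`, where `W` is the `B`-module given by `θ`. -/
def Ind : Type u := (A ⊗[K] W) ⧸ indRel B θ

instance : AddCommGroup (Ind B θ) := inferInstanceAs (AddCommGroup ((A ⊗[K] W) ⧸ indRel B θ))
instance : Module A (Ind B θ) := inferInstanceAs (Module A ((A ⊗[K] W) ⧸ indRel B θ))

/-- The element `a ⊗ w` of the induced module. -/
def indMk (a : A) (w : W) : Ind B θ := Submodule.Quotient.mk (a ⊗ₜ[K] w)

/-- The map `Ind_B^A W → Ind_B^A W'` induced by a `B`-homomorphism `W → W'`. -/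
def indMap (L : W →ₗ[K] W') (hL : ∀ b w, L (θ b w) = θ' b (L w)) : Ind B θ →ₗ[A] Ind B θ' :=
  Submodule.mapQ _ _ (TensorProduct.AlgebraTensorModule.lTensor A A L) (by
    rw [indRel, Submodule.span_le]
    rintro _ ⟨a, b, w, rfl⟩
    refine Submodule.subset_span ⟨a, b, L w, ?_⟩
    rw [map_sub, ← hL]
    rfl)

theorem indMap_mk (L : W →ₗ[K] W') (hL : ∀ b w, L (θ b w) = θ' b (L w)) (a : A) (w : W) :
    indMap B θ θ' L hL (indMk B θ a w) = indMk B θ' a (L w) := rfl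

theorem ind_hom_ext {Z : Type u} [AddCommGroup Z] [Module A Z] {f g : Ind B θ →ₗ[A] Z}
    (h : ∀ a w, f (indMk B θ a w) = g (indMk B θ a w)) :
    f = g := by
  have h1 : ∀ x : A ⊗[K] W, f (Submodule.Quotient.mk x : (A ⊗[K] W) ⧸ indRel B θ) =
      g (Submodule.Quotient.mk x : (A ⊗[K] W) ⧸ indRel B θ) := by
    intro x
    induction x using TensorProduct.induction_on with
    | zero => exact f.map_zero.trans g.map_zero.symm
    | tmul a w => exact h a w
    | add x y hx hy =>
      exact (f.map_add _ _).trans ((congrArg₂ _ hx hy).trans (g.map_add _ _).symm)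
  refine LinearMap.ext fun x => ?_
  obtain ⟨x, rfl⟩ := Submodule.Quotient.mk_surjective (indRel B θ) x
  exact h1 x

end Induction

/-! ### The subalgebras attached to compositions -/

section Subalgebras

variable {K : Type u} [Field K] {r n : ℕ} (q : Kˣ) (μ : Comp r n)

/-- The subalgebra generated by `t_1, …, t_n`, `X_1^{±1}, …, X_n^{±1}` and the `g_w` for `w` in the
Young subgroup of `μ`.  As `g_w` is the product of the `g_i` along a reduced expression of `w`, and
the simple transpositions occurring in it belong to the Young subgroup, it is generated by the
`t_j`, the `X_j^{±1}` and the `g_i` such that `i` and `i + 1` lie in the same block of `μ`. -/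
def Ymu : Subalgebra K (Y K r n q) :=
  Algebra.adjoin K (
    {a | ∃ j : Fin n, a = yt j} ∪
    {a | ∃ (k : ℕ) (hk : k < n), a = yXv k hk} ∪
    {a | ∃ (k : ℕ) (hk : k < n), a = ((yX k hk)⁻¹ : (Y K r n q)ˣ).val} ∪
    {a | ∃ (i : ℕ) (hi : i + 1 < n),
      blk μ ⟨i, Nat.lt_of_succ_lt hi⟩ = blk μ ⟨i + 1, hi⟩ ∧ a = yg i hi})

/-- `t_{j+1}` in the subalgebra. -/
def mt (j : Fin n) : Ymu q μ :=
  ⟨yt j, Algebra.subset_adjoin (Or.inl (Or.inl (Or.inl ⟨j, rfl⟩)))⟩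

/-- The generator `X` at the `j`-th place of the `k`-th block, in the subalgebra. -/
def mX (k : Fin r) (j : Fin (μ.1 k)) : Ymu q μ :=
  ⟨yXv (place μ k j j.2) (place_lt μ k j j.2),
    Algebra.subset_adjoin (Or.inl (Or.inl (Or.inr ⟨_, _, rfl⟩)))⟩

/-- The inverse of the generator `X` at the `j`-th place of the `k`-th block. -/
def mXinv (k : Fin r) (j : Fin (μ.1 k)) : Ymu q μ :=
  ⟨((yX (place μ k j j.2) (place_lt μ k j j.2))⁻¹ : (Y K r n q)ˣ).val,
    Algebra.subset_adjoin (Or.inl (Or.inr ⟨_, _, rfl⟩))⟩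

/-- The generator `g` for the `a`-th simple transposition of the `k`-th block. -/
def mg (k : Fin r) (a : ℕ) (ha : a + 1 < μ.1 k) : Ymu q μ :=
  ⟨yg (place μ k a (Nat.lt_of_succ_lt ha)) (place_succ_lt μ k a ha),
    Algebra.subset_adjoin (Or.inr ⟨_, _, by
      rw [blk_place μ k a, blk_place_succ μ k a ha], rfl⟩)⟩

variable (S : SimpleFamily K r)

/-- The homomorphism from the subalgebra `Ymu` to `End(V(μ)) ⊗ Hmu` which defines the action of
`Ymu` on `V(μ) ⊗ M`, for each `Hmu`-module `M`: it is characterized by its values on generators,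
`t_j (v ⊗ z) = t_j v ⊗ z`, `g_i (v ⊗ z) = v ⊗ T_i z` and `X_j^{±1} (v ⊗ z) = v ⊗ Y_j^{±1} z`. -/
structure IsTensorAction
    (ρ : Ymu q μ →ₐ[K] Module.End K (Vsp S μ) ⊗[K] Hmu K q μ) : Prop where
  t : ∀ j, ρ (mt q μ j) = Vrep S μ (Pi.mulSingle j (Multiplicative.ofAdd 1)) ⊗ₜ[K] 1
  g : ∀ k a ha, ρ (mg q μ k a ha) = 1 ⊗ₜ[K] PiTensorProduct.singleAlgHom k (hT a ha)
  X : ∀ k j, ρ (mX q μ k j) = 1 ⊗ₜ[K] PiTensorProduct.singleAlgHom k (hY j)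
  Xinv : ∀ k j, ρ (mXinv q μ k j) = 1 ⊗ₜ[K] PiTensorProduct.singleAlgHom k (hYinv j)

variable {q μ S}
variable (ρ : Ymu q μ →ₐ[K] Module.End K (Vsp S μ) ⊗[K] Hmu K q μ)
variable {W : Type u} [AddCommGroup W] [Module K W] (α : Hmu K q μ →ₐ[K] Module.End K W)
variable {W' : Type u} [AddCommGroup W'] [Module K W'] (α' : Hmu K q μ →ₐ[K] Module.End K W')

/-- The action of `Ymu` on `V(μ) ⊗ W` for an `Hmu`-module `W` (whose action is `α`). -/
def vAct : Ymu q μ →ₐ[K] Module.End K (Vsp S μ ⊗[K] W) :=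
  (Module.endTensorEndAlgHom (R := K) (S := K) (A := K)).comp
    ((Algebra.TensorProduct.map (AlgHom.id K (Module.End K (Vsp S μ))) α).comp ρ)

theorem vAct_lTensor (L : W →ₗ[K] W') (hL : ∀ a w, L (α a w) = α' a (L w)) (b : Ymu q μ)
    (x : Vsp S μ ⊗[K] W) :
    L.lTensor (Vsp S μ) (vAct ρ α b x) = vAct ρ α' b (L.lTensor (Vsp S μ) x) := by
  simp only [vAct, AlgHom.comp_apply]
  generalize ρ b = y
  induction y using TensorProduct.induction_on with
  | zero => simp
  | add y z hy hz => simp only [map_add, LinearMap.add_apply, hy, hz]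
  | tmul f a =>
    rw [Algebra.TensorProduct.map_tmul, Algebra.TensorProduct.map_tmul,
      Module.endTensorEndAlgHom_apply, Module.endTensorEndAlgHom_apply]
    induction x using TensorProduct.induction_on with
    | zero => simp
    | add x y hx hy => simp only [map_add, hx, hy]
    | tmul v w => simp [hL]

end Subalgebras

/-! ### The functor `G` -/

section FunctorG

variable {K : Type u} [Field K] {r n : ℕ} {q : Kˣ}

section Parts

variable (P : Type u) [AddCommGroup P] [Module K P] [Module (Hrn K r n q) P]
  [IsScalarTower K (Hrn K r n q) P]
variable (P' : Type u) [AddCommGroup P'] [Module K P'] [Module (Hrn K r n q) P']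
  [IsScalarTower K (Hrn K r n q) P']
variable (μ : Comp r n)

variable (q) in
/-- The component `P_μ` of a module `P = ⨁_μ P_μ`: the image of the unit of the summand `Hmu μ`. -/
def part : Submodule K P :=
  LinearMap.range (Algebra.lsmul K K P (Pi.single μ 1 : Hrn K r n q))

theorem single_smul_mem (a : Hmu K q μ) (x : P) :
    (Pi.single μ a : Hrn K r n q) • x ∈ part q P μ :=
  ⟨(Pi.single μ a : Hrn K r n q) • x, by
    change (Pi.single μ 1 : Hrn K r n q) • (Pi.single μ a : Hrn K r n q) • x = _
    rw [smul_smul, ← Pi.single_mul, one_mul]⟩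

theorem single_one_smul (x : part q P μ) : (Pi.single μ 1 : Hrn K r n q) • (x : P) = x := by
  obtain ⟨_, y, rfl⟩ := x
  change (Pi.single μ 1 : Hrn K r n q) • (Pi.single μ 1 : Hrn K r n q) • y =
    (Pi.single μ 1 : Hrn K r n q) • y
  rw [smul_smul, ← Pi.single_mul, one_mul]

/-- The action of the summand `Hmu μ` on `P_μ`. -/
def partAct : Hmu K q μ →ₐ[K] Module.End K (part q P μ) where
  toFun a :=
    { toFun := fun x => ⟨(Pi.single μ a : Hrn K r n q) • (x : P), single_smul_mem P μ a x⟩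
      map_add' := fun _ _ => Subtype.ext (smul_add _ _ _)
      map_smul' := fun c _ =>
        Subtype.ext ((Algebra.lsmul K K P (Pi.single μ a : Hrn K r n q)).map_smul c _) }
  map_one' := LinearMap.ext fun x => Subtype.ext (single_one_smul P μ x)
  map_mul' a b := LinearMap.ext fun x => Subtype.ext (by
    change (Pi.single μ (a * b) : Hrn K r n q) • (x : P) =
      (Pi.single μ a : Hrn K r n q) • (Pi.single μ b : Hrn K r n q) • (x : P)
    rw [smul_smul, ← Pi.single_mul])
  map_zero' := LinearMap.ext fun x => Subtype.ext (by
    change (Pi.single μ 0 : Hrn K r n q) • (x : P) = 0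
    rw [Pi.single_zero, zero_smul])
  map_add' a b := LinearMap.ext fun x => Subtype.ext (by
    change (Pi.single μ (a + b) : Hrn K r n q) • (x : P) =
      (Pi.single μ a : Hrn K r n q) • (x : P) + (Pi.single μ b : Hrn K r n q) • (x : P)
    rw [Pi.single_add, add_smul])
  commutes' c := LinearMap.ext fun x => Subtype.ext (by
    change (Pi.single μ (algebraMap K (Hmu K q μ) c) : Hrn K r n q) • (x : P) = c • (x : P)
    rw [Algebra.algebraMap_eq_smul_one, Pi.single_smul, smul_assoc, single_one_smul])

variable {P P'}

/-- The restriction `P_μ → P'_μ` of a homomorphism `P → P'`. -/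
def partMap (f : P →ₗ[Hrn K r n q] P') : part q P μ →ₗ[K] part q P' μ where
  toFun x := ⟨f x, by
    rw [← single_one_smul P μ x, map_smul]
    exact single_smul_mem P' μ 1 _⟩
  map_add' _ _ := Subtype.ext (f.map_add _ _)
  map_smul' c _ := Subtype.ext ((f.restrictScalars K).map_smul c _)

theorem partMap_act (f : P →ₗ[Hrn K r n q] P') (a : Hmu K q μ) (x : part q P μ) :
    partMap μ f (partAct P μ a x) = partAct P' μ a (partMap μ f x) :=
  Subtype.ext (f.map_smul _ _)

end Parts

variable {S : SimpleFamily K r}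
variable (ρ : ∀ μ : Comp r n, Ymu q μ →ₐ[K] Module.End K (Vsp S μ) ⊗[K] Hmu K q μ)

/-- The module `⨁_μ Ind (V(μ) ⊗ P_μ)`, the induction being from `Ymu μ` to the affine
Yokonuma-Hecke algebra. -/
def GObj (P : Type u) [AddCommGroup P] [Module K P] [Module (Hrn K r n q) P]
    [IsScalarTower K (Hrn K r n q) P] : Type u :=
  ∀ μ : Comp r n, Ind (Ymu q μ) (vAct (ρ μ) (partAct P μ))

section GObjInstances

variable (P : Type u) [AddCommGroup P] [Module K P] [Module (Hrn K r n q) P]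
  [IsScalarTower K (Hrn K r n q) P]
variable (P' : Type u) [AddCommGroup P'] [Module K P'] [Module (Hrn K r n q) P']
  [IsScalarTower K (Hrn K r n q) P']

instance : AddCommGroup (GObj ρ P) :=
  inferInstanceAs (AddCommGroup (∀ μ : Comp r n, Ind (Ymu q μ) (vAct (ρ μ) (partAct P μ))))
instance : Module (Y K r n q) (GObj ρ P) :=
  inferInstanceAs (Module (Y K r n q) (∀ μ : Comp r n, Ind (Ymu q μ) (vAct (ρ μ) (partAct P μ))))

variable {P P'}

/-- The component `Ind (V(μ) ⊗ P_μ) → Ind (V(μ) ⊗ P'_μ)` of the map between the direct sums. -/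
def GMapAt (f : P →ₗ[Hrn K r n q] P') (μ : Comp r n) :
    Ind (Ymu q μ) (vAct (ρ μ) (partAct P μ)) →ₗ[Y K r n q]
      Ind (Ymu q μ) (vAct (ρ μ) (partAct P' μ)) :=
  indMap (Ymu q μ) _ _ ((partMap μ f).lTensor (Vsp S μ)) (vAct_lTensor (ρ μ) _ _ _ (partMap_act μ f))

theorem GMapAt_mk (f : P →ₗ[Hrn K r n q] P') (μ : Comp r n) (a : Y K r n q)
    (w : Vsp S μ ⊗[K] part q P μ) :
    GMapAt ρ f μ (indMk _ _ a w) = indMk _ _ a ((partMap μ f).lTensor (Vsp S μ) w) := rfl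

/-- The map `⨁_μ Ind (V(μ) ⊗ P_μ) → ⨁_μ Ind (V(μ) ⊗ P'_μ)` induced by `P → P'`. -/
def GMap (f : P →ₗ[Hrn K r n q] P') : GObj ρ P →ₗ[Y K r n q] GObj ρ P' where
  toFun x μ := GMapAt ρ f μ (x μ)
  map_add' _ _ := funext fun μ => (GMapAt ρ f μ).map_add _ _
  map_smul' _ _ := funext fun μ => (GMapAt ρ f μ).map_smul _ _

theorem GMap_id : GMap ρ (LinearMap.id : P →ₗ[Hrn K r n q] P) = LinearMap.id := by
  have h : ∀ μ, GMapAt ρ (LinearMap.id : P →ₗ[Hrn K r n q] P) μ = LinearMap.id := fun μ =>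
    ind_hom_ext _ _ fun a w => by
      rw [GMapAt_mk]
      change indMk _ _ a ((LinearMap.id : part q P μ →ₗ[K] _).lTensor _ w) = _
      rw [LinearMap.lTensor_id]; rfl
  exact LinearMap.ext fun x => funext fun μ => LinearMap.congr_fun (h μ) (x μ)

theorem GMap_comp {P'' : Type u} [AddCommGroup P''] [Module K P''] [Module (Hrn K r n q) P'']
    [IsScalarTower K (Hrn K r n q) P''] (g : P' →ₗ[Hrn K r n q] P'') (f : P →ₗ[Hrn K r n q] P') :
    GMap ρ (g.comp f) = (GMap ρ g).comp (GMap ρ f) := by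
  have h : ∀ μ, GMapAt ρ (g.comp f) μ = (GMapAt ρ g μ).comp (GMapAt ρ f μ) := fun μ =>
    ind_hom_ext _ _ fun a w => by
      rw [LinearMap.comp_apply, GMapAt_mk, GMapAt_mk, GMapAt_mk]
      change indMk _ _ a (((partMap μ g).comp (partMap μ f)).lTensor _ w) = _
      rw [LinearMap.lTensor_comp]; rfl
  exact LinearMap.ext fun x => funext fun μ => LinearMap.congr_fun (h μ) (x μ)

end GObjInstances

/-- The functor `G(⨁_μ P_μ) = ⨁_μ Ind (V(μ) ⊗ P_μ)`, with values in all modules over the affine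
Yokonuma-Hecke algebra. -/
def functorGAll : FDMod K (Hrn K r n q) ⥤ ModuleCat.{u} (Y K r n q) where
  obj P := ModuleCat.of (Y K r n q) (GObj ρ P.obj)
  map f := ModuleCat.ofHom (GMap ρ f.hom.hom)
  map_id P := ModuleCat.hom_ext (GMap_id ρ)
  map_comp f g := ModuleCat.hom_ext (GMap_comp ρ g.hom.hom f.hom.hom)

/-- The functor `G(⨁_μ P_μ) = ⨁_μ Ind (V(μ) ⊗ P_μ)` between categories of finite dimensional
modules, given that the induced modules are finite dimensional. -/
def functorG (hfd : ∀ P, fd K (Y K r n q) ((functorGAll ρ).obj P)) :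
    FDMod K (Hrn K r n q) ⥤ FDMod K (Y K r n q) :=
  (fd K (Y K r n q)).lift (functorGAll ρ) hfd

end FunctorG

end AYH

end

/-!
# Finite dimensional modules over the affine Yokonuma-Hecke algebra

As `r` is invertible in `K` and `K` contains the `r`-th roots of unity, the commuting elements `t_j`
act diagonalizably on each module `N`. A simultaneous eigenspace is indexed by a *colouring*
`c : Fin n → Fin r` of the places, the colour `k` standing for the scalar `zeta S k` by which the
generator of `G` acts on `V_k`; these scalars are precisely the `r`-th roots of unity, without
repetition. So `N` is the direct sum of its weight spaces `N_c` (`weightSpace`,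
`span_weightSpace`, `weightProj_smul`). The *content* of `c` is the composition `μ` for which each
colour `k` is used `μ_k` times, and the space `Hom_{KT}(V(μ), I_μ N)` is the weight space of the
standard colouring `blk μ` by the blocks of `μ`, because `V(μ)` is a line (`homOfWeight`,
`ev_ext_vgen`).

On a weight vector whose colours at `i` and `i + 1` differ, the idempotent `e_i` acts by zero, so
`g_i` is an involution which exchanges the two weight spaces; if the colours agree, `e_i` acts by
one and `g_i` satisfies the quadratic relation of the Hecke algebra. Sorting a colouring `c` of
content `μ` by removing descents gives an invertible element `d_c`, a product of generators `g_i`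
(`sortElt`), which maps `N_{blk μ}` isomorphically onto `N_c`. That `d_c` is independent of the way
of sorting is a diamond argument using the braid relations (`sortElt_of_descent`), and moving
`g_i`, `t_j`, `X_j` through `d_c` relabels the places by the stable sorting of `c`
(`ygU_mul_sortElt`, `yt_mul_sortElt`, `yX_sortElt_smul`). Therefore the module `N` is recovered from
the spaces `N_{blk μ}`, with their action of the subalgebras `Ymu`, as the direct sum of the spaces
`d_c N_{blk μ}`.

What remains is to see that induction creates no collapse. For an `Hmu`-module `W` the algebra acts
explicitly on the direct sum of copies of `W` indexed by the colourings of content `μ` (`model`).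
The component of the standard colouring is stable under `Ymu`, which acts on it through a
surjective homomorphism onto `Hmu` (`corner`); this yields `ρ_μ` (`rho`), and it shows that `W`
embeds into the induced module (`indOne_injective`). The induced module is thus the direct sum of
the weight spaces `d_c ⊗ W`, and it is finite dimensional if `W` is (`exists_indOne_sum`,
`finite_ind`).

The functor `G` is left adjoint to `F`. Both the counit and the unit are bijective by comparison of
weight spaces: on the weight space of a colouring `c` of content `μ`, the counit `GF(N) → N` is
`d_c ⊗ x ↦ d_c x` for `x ∈ N_{blk μ}` (`counitMap_injective`, `counitMap_surjective`), and the unit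
`P → FG(P)` identifies `P_μ` with the weight space of `blk μ` in `G(P)` (`unitMap_injective`,
`unitMap_surjective`).
-/

noncomputable section

namespace AYH

/-! ### Colourings and their stable sorting -/

section Colourings

variable {r n : ℕ}

theorem sw_lo (i : ℕ) (hi : i + 1 < n) : sw i hi ⟨i, Nat.lt_of_succ_lt hi⟩ = ⟨i + 1, hi⟩ :=
  Equiv.swap_apply_left _ _

theorem sw_hi (i : ℕ) (hi : i + 1 < n) : sw i hi ⟨i + 1, hi⟩ = ⟨i, Nat.lt_of_succ_lt hi⟩ :=
  Equiv.swap_apply_right _ _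

theorem sw_of_ne (i : ℕ) (hi : i + 1 < n) (j : Fin n) (h : (j : ℕ) ≠ i) (h' : (j : ℕ) ≠ i + 1) :
    sw i hi j = j :=
  Equiv.swap_apply_of_ne_of_ne (fun e => h (by rw [e])) (fun e => h' (by rw [e]))

theorem sw_sw (i : ℕ) (hi : i + 1 < n) (j : Fin n) : sw i hi (sw i hi j) = j :=
  Equiv.swap_apply_self _ _ _

theorem comp_sw_sw {X : Type*} (c : Fin n → X) (i : ℕ) (hi : i + 1 < n) :
    (c ∘ sw i hi) ∘ sw i hi = c := funext fun j => congrArg c (sw_sw i hi j)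

theorem comp_sw_eq {X : Type*} (c : Fin n → X) (i : ℕ) (hi : i + 1 < n)
    (h : c ⟨i, Nat.lt_of_succ_lt hi⟩ = c ⟨i + 1, hi⟩) : c ∘ sw i hi = c := by
  funext j
  by_cases h1 : (j : ℕ) = i
  · obtain rfl : j = ⟨i, Nat.lt_of_succ_lt hi⟩ := Fin.ext h1
    simp [sw_lo, h]
  by_cases h2 : (j : ℕ) = i + 1
  · obtain rfl : j = ⟨i + 1, hi⟩ := Fin.ext h2
    simp [sw_hi, h]
  simp [sw_of_ne i hi j h1 h2]

theorem sw_val (i : ℕ) (hi : i + 1 < n) (x : Fin n) :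
    (sw i hi x : ℕ) = if (x : ℕ) = i then i + 1 else if (x : ℕ) = i + 1 then i else x := by
  simp only [sw, Equiv.swap_apply_def, Fin.ext_iff]
  split_ifs <;> rfl

theorem sw_comm (i j : ℕ) (hi : i + 1 < n) (hj : j + 1 < n) (hij : i + 2 ≤ j ∨ j + 2 ≤ i)
    (x : Fin n) : sw i hi (sw j hj x) = sw j hj (sw i hi x) := by
  simp only [Fin.ext_iff, sw_val]
  split_ifs <;> omega

theorem sw_braid (i : ℕ) (hi : i + 1 < n) (hi' : i + 1 + 1 < n) (x : Fin n) :
    sw i hi (sw (i + 1) hi' (sw i hi x)) = sw (i + 1) hi' (sw i hi (sw (i + 1) hi' x)) := by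
  simp only [Fin.ext_iff, sw_val]
  split_ifs <;> omega

/-- The number of places before `i` which have the same colour as `i`. -/
def rank (c : Fin n → Fin r) (i : Fin n) : ℕ := (Finset.univ.filter fun j => j < i ∧ c j = c i).card

/-- The number of places whose colour is smaller than `k`. -/
def offset (c : Fin n → Fin r) (k : Fin r) : ℕ := (Finset.univ.filter fun j => c j < k).card

/-- The place of `i` after a stable sorting of the places by their colour. -/
def sortPlace (c : Fin n → Fin r) (i : Fin n) : ℕ := offset c (c i) + rank c i

theorem sw_lt_sw {c : Fin n → Fin r} {i : ℕ} {hi : i + 1 < n}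
    (h : c ⟨i, Nat.lt_of_succ_lt hi⟩ ≠ c ⟨i + 1, hi⟩) {x y : Fin n} (hxy : c x = c y) :
    sw i hi x < sw i hi y ↔ x < y := by
  have key : ∀ x y : Fin n, c x = c y → x < y → sw i hi x < sw i hi y := by
    intro x y hxy hlt
    by_cases hne : (x : ℕ) = i ∧ (y : ℕ) = i + 1
    · refine absurd ?_ h
      rw [← Fin.ext (a := x) (b := ⟨i, Nat.lt_of_succ_lt hi⟩) hne.1,
        ← Fin.ext (a := y) (b := ⟨i + 1, hi⟩) hne.2, hxy]
    · rw [Fin.lt_def] at hlt ⊢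
      simp only [sw_val]
      split_ifs <;> omega
  refine ⟨fun hlt => ?_, key x y hxy⟩
  rcases lt_trichotomy x y with h1 | h1 | h1
  · exact h1
  · rw [h1] at hlt; exact absurd hlt (lt_irrefl _)
  · exact absurd (hlt.trans (key y x hxy.symm h1)) (lt_irrefl _)

theorem rank_sw {c : Fin n → Fin r} {i : ℕ} {hi : i + 1 < n}
    (h : c ⟨i, Nat.lt_of_succ_lt hi⟩ ≠ c ⟨i + 1, hi⟩) (x : Fin n) :
    rank (c ∘ sw i hi) (sw i hi x) = rank c x := by
  unfold rank
  refine (Finset.card_bijective (sw i hi) (sw i hi).bijective fun j => ?_).symm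
  simp only [Finset.mem_filter, Finset.mem_univ, true_and, Function.comp, sw_sw]
  constructor
  · rintro ⟨h1, h2⟩; exact ⟨(sw_lt_sw h h2).mpr h1, h2⟩
  · rintro ⟨h1, h2⟩; exact ⟨(sw_lt_sw h h2).mp h1, h2⟩

theorem rank_comp_sw {c : Fin n → Fin r} {i : ℕ} {hi : i + 1 < n}
    (h : c ⟨i, Nat.lt_of_succ_lt hi⟩ ≠ c ⟨i + 1, hi⟩) (x : Fin n) :
    rank (c ∘ sw i hi) x = rank c (sw i hi x) := by
  rw [← rank_sw h, sw_sw]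

theorem offset_comp_sw (c : Fin n → Fin r) (i : ℕ) (hi : i + 1 < n) (k : Fin r) :
    offset (c ∘ sw i hi) k = offset c k := by
  unfold offset
  exact Finset.card_bijective (sw i hi) (sw i hi).bijective fun j => by simp

/-- The stable sorting commutes with exchanging neighbours of different colours. -/
theorem sortPlace_comp_sw {c : Fin n → Fin r} {i : ℕ} {hi : i + 1 < n}
    (h : c ⟨i, Nat.lt_of_succ_lt hi⟩ ≠ c ⟨i + 1, hi⟩) (x : Fin n) :
    sortPlace (c ∘ sw i hi) x = sortPlace c (sw i hi x) := by
  unfold sortPlace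
  rw [offset_comp_sw, rank_comp_sw h]; rfl

theorem rank_succ {c : Fin n → Fin r} {i : ℕ} {hi : i + 1 < n}
    (h : c ⟨i, Nat.lt_of_succ_lt hi⟩ = c ⟨i + 1, hi⟩) :
    rank c ⟨i + 1, hi⟩ = rank c ⟨i, Nat.lt_of_succ_lt hi⟩ + 1 := by
  unfold rank
  have : (Finset.univ.filter fun j => j < (⟨i + 1, hi⟩ : Fin n) ∧ c j = c ⟨i + 1, hi⟩) =
      insert ⟨i, Nat.lt_of_succ_lt hi⟩
        (Finset.univ.filter fun j => j < (⟨i, Nat.lt_of_succ_lt hi⟩ : Fin n) ∧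
          c j = c ⟨i, Nat.lt_of_succ_lt hi⟩) := by
    ext j
    simp only [Finset.mem_filter, Finset.mem_univ, true_and, Finset.mem_insert, ← h]
    constructor
    · rintro ⟨h1, h2⟩
      by_cases h3 : (j : ℕ) = i
      · exact Or.inl (Fin.ext h3)
      · exact Or.inr ⟨by simp only [Fin.lt_def] at *; omega, h2⟩
    · rintro (rfl | ⟨h1, h2⟩)
      · exact ⟨by simp [Fin.lt_def], rfl⟩
      · exact ⟨by simp only [Fin.lt_def] at *; omega, h2⟩
  rw [this, Finset.card_insert_of_notMem (by simp)]

theorem rank_lt_rank {c : Fin n → Fin r} {i j : Fin n} (h : c i = c j) (hij : i < j) :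
    rank c i < rank c j := by
  unfold rank
  refine Finset.card_lt_card (Finset.ssubset_iff_of_subset ?_ |>.mpr ⟨i, ?_, ?_⟩)
  · intro x hx
    simp only [Finset.mem_filter, Finset.mem_univ, true_and] at hx ⊢
    exact ⟨hx.1.trans hij, hx.2.trans h⟩
  · simp [hij, h]
  · simp

theorem rank_ne_rank {c : Fin n → Fin r} {i j : Fin n} (h : c i = c j) (hij : i ≠ j) :
    rank c i ≠ rank c j := by
  rcases lt_or_gt_of_ne hij with h1 | h1
  · exact (rank_lt_rank h h1).ne
  · exact (rank_lt_rank h.symm h1).ne'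

theorem rank_lt_card (c : Fin n → Fin r) (i : Fin n) :
    rank c i < (Finset.univ.filter fun j => c j = c i).card := by
  unfold rank
  refine Finset.card_lt_card (Finset.ssubset_iff_of_subset ?_ |>.mpr ⟨i, ?_, ?_⟩)
  · intro x hx
    simp only [Finset.mem_filter, Finset.mem_univ, true_and] at hx ⊢
    exact hx.2
  · simp
  · simp

/-- A stable sorting keeps neighbours of the same colour adjacent. -/
theorem sortPlace_succ {c : Fin n → Fin r} {i : ℕ} {hi : i + 1 < n}
    (h : c ⟨i, Nat.lt_of_succ_lt hi⟩ = c ⟨i + 1, hi⟩) :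
    sortPlace c ⟨i + 1, hi⟩ = sortPlace c ⟨i, Nat.lt_of_succ_lt hi⟩ + 1 := by
  unfold sortPlace
  rw [rank_succ h, ← h]; rfl

theorem sortPlace_eq_card (c : Fin n → Fin r) (i : Fin n) : sortPlace c i =
    (Finset.univ.filter fun j => c j < c i ∨ (j < i ∧ c j = c i)).card := by
  unfold sortPlace offset rank
  rw [Finset.filter_or, Finset.card_union_of_disjoint]
  rw [Finset.disjoint_filter]
  rintro j - h1 ⟨-, h2⟩
  exact h1.ne h2

theorem sortPlace_of_monotone {c : Fin n → Fin r} (hc : Monotone c) (i : Fin n) :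
    sortPlace c i = i := by
  rw [sortPlace_eq_card]
  have : (Finset.univ.filter fun j => c j < c i ∨ (j < i ∧ c j = c i)) = Finset.Iio i := by
    ext j
    simp only [Finset.mem_filter, Finset.mem_univ, true_and, Finset.mem_Iio]
    constructor
    · rintro (h | h)
      · exact hc.reflect_lt h
      · exact h.1
    · intro h
      rcases (hc h.le).lt_or_eq with h' | h'
      · exact Or.inl h'
      · exact Or.inr ⟨h, h'⟩
  rw [this, Fin.card_Iio]

theorem monotone_of_no_descent {c : Fin n → Fin r}
    (h : ∀ i (hi : i + 1 < n), ¬ c ⟨i + 1, hi⟩ < c ⟨i, Nat.lt_of_succ_lt hi⟩) : Monotone c := by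
  have key : ∀ d i (hi : i + d < n), c ⟨i, by omega⟩ ≤ c ⟨i + d, hi⟩ := by
    intro d
    induction d with
    | zero => intro i hi; exact le_rfl
    | succ d ih => intro i hi; exact (ih i (by omega)).trans (not_lt.mp (h (i + d) hi))
  intro a b hab
  obtain ⟨d, hd⟩ := Nat.exists_eq_add_of_le (Fin.le_def.mp hab)
  have := key d a (by rw [← hd]; exact b.2)
  simpa only [← hd] using this

theorem sortPlace_lt (c : Fin n → Fin r) (i : Fin n) : sortPlace c i < n := by
  rw [sortPlace_eq_card]
  calc _ < (Finset.univ : Finset (Fin n)).card := Finset.card_lt_card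
        ((Finset.ssubset_iff_of_subset (Finset.filter_subset _ _)).mpr
          ⟨i, Finset.mem_univ _, by simp⟩)
    _ = n := by simp

variable (μ : Comp r n)

/-- The colouring `c` has content `μ`: each colour `k` is used for `μ_k` places. -/
def HasContent (c : Fin n → Fin r) : Prop :=
  ∀ k, (Finset.univ.filter fun j => c j = k).card = μ.1 k

variable {μ}

theorem HasContent.comp_sw {c : Fin n → Fin r} (hc : HasContent μ c) (i : ℕ) (hi : i + 1 < n) :
    HasContent μ (c ∘ sw i hi) := fun k => by
  rw [← hc k]
  exact Finset.card_bijective (sw i hi) (sw i hi).bijective fun j => by simp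

theorem HasContent.rank_lt {c : Fin n → Fin r} (hc : HasContent μ c) (i : Fin n) :
    rank c i < μ.1 (c i) := hc (c i) ▸ rank_lt_card c i

theorem exists_hasContent (c : Fin n → Fin r) : ∃ μ : Comp r n, HasContent μ c :=
  ⟨⟨fun k => (Finset.univ.filter fun j => c j = k).card, by
    rw [← Finset.card_eq_sum_card_fiberwise (fun _ _ => Finset.mem_coe.mpr (Finset.mem_univ _))]
    simp⟩, fun _ => rfl⟩

theorem HasContent.unique {ν : Comp r n} {c : Fin n → Fin r} (h : HasContent μ c)
    (h' : HasContent ν c) : μ = ν := Subtype.ext (funext fun k => (h k).symm.trans (h' k))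

theorem place_eq_sum (k : Fin r) (a : ℕ) (ha : a < μ.1 k) :
    place μ k a ha = (∑ l ∈ Finset.univ.filter (fun l => l < k), μ.1 l) + a := by
  simp only [place, pos, Equiv.trans_apply, finCongr_apply, Fin.val_cast, finSigmaFinEquiv_apply]
  congr 1
  rw [Finset.sum_subtype (p := fun l => l < k) (F := inferInstance) _ (by simp)]
  exact Fintype.sum_equiv ⟨fun i => ⟨Fin.castLE k.2.le i, i.2⟩, fun l => ⟨l.1, l.2⟩,
    fun _ => rfl, fun _ => rfl⟩ _ _ fun i => rfl

/-- The stable sorting of a colouring of content `μ` moves the `a`-th place of colour `k` to the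
`a`-th place of the `k`-th block of `μ`. -/
theorem HasContent.sortPlace_eq {c : Fin n → Fin r} (hc : HasContent μ c) (i : Fin n) :
    sortPlace c i = place μ (c i) (rank c i) (hc.rank_lt i) := by
  rw [place_eq_sum, sortPlace, offset]
  congr 1
  rw [Finset.card_eq_sum_card_fiberwise (f := c) (t := Finset.univ.filter (fun l => l < c i))
    (by intro x; simp)]
  refine Finset.sum_congr rfl fun l hl => ?_
  rw [← hc l, Finset.filter_filter]
  congr 1
  ext j
  simp only [Finset.mem_filter, Finset.mem_univ, true_and] at hl ⊢
  exact ⟨fun h => h.2, fun h => ⟨h ▸ hl, h⟩⟩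

theorem blk_sortPlace {c : Fin n → Fin r} (hc : HasContent μ c) (i : Fin n) :
    blk μ ⟨sortPlace c i, sortPlace_lt c i⟩ = c i := by
  simp only [hc.sortPlace_eq]
  exact blk_place μ _ _ _

theorem sortPlace_injective (c : Fin n → Fin r) : Function.Injective (sortPlace c) := by
  obtain ⟨μ, hc⟩ := exists_hasContent c
  intro i j h
  rw [hc.sortPlace_eq, hc.sortPlace_eq] at h
  obtain ⟨h1, h2⟩ := place_inj μ h
  by_contra hij
  exact rank_ne_rank h1 hij h2

theorem exists_sortPlace_eq (c : Fin n → Fin r) (j : Fin n) : ∃ i, sortPlace c i = j := by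
  have h : Function.Injective fun i => (⟨sortPlace c i, sortPlace_lt c i⟩ : Fin n) := fun i j h =>
    sortPlace_injective c (Fin.mk.inj_iff.mp h)
  obtain ⟨i, hi⟩ := (Finite.injective_iff_surjective.mp h) j
  exact ⟨i, congrArg Fin.val hi⟩

variable (μ)

theorem exists_place (j : Fin n) :
    ∃ k a, ∃ ha : a < μ.1 k, (j : ℕ) = place μ k a ha :=
  ⟨((pos μ).symm j).1, ((pos μ).symm j).2, ((pos μ).symm j).2.2, by simp [place]⟩

theorem hasContent_blk : HasContent μ (blk μ) := fun k => by
  have h : (Finset.univ.filter fun j => blk μ j = k) =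
      (Finset.univ : Finset (Fin (μ.1 k))).map
        ⟨fun a => pos μ ⟨k, a⟩, fun a b h => by simpa using (pos μ).injective h⟩ := by
    ext j
    simp only [Finset.mem_filter, Finset.mem_univ, true_and, Finset.mem_map]
    constructor
    · rintro rfl
      exact ⟨((pos μ).symm j).2, (pos μ).apply_symm_apply j⟩
    · rintro ⟨a, rfl⟩
      exact blk_place μ k a a.2
  rw [h]; simp

theorem blk_monotone : Monotone (blk μ) := by
  intro i j hij
  obtain ⟨k, a, ha, hi⟩ := exists_place μ i
  obtain ⟨l, b, hb, hj⟩ := exists_place μ j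
  obtain rfl : i = ⟨place μ k a ha, place_lt μ k a ha⟩ := Fin.ext hi
  obtain rfl : j = ⟨place μ l b hb, place_lt μ l b hb⟩ := Fin.ext hj
  rw [blk_place, blk_place]
  by_contra hlt
  rw [not_le] at hlt
  rw [Fin.le_def] at hij
  simp only [place_eq_sum] at hij
  have h1 : ∑ m ∈ insert l (Finset.univ.filter fun m => m < l), μ.1 m ≤
      ∑ m ∈ Finset.univ.filter (fun m => m < k), μ.1 m := by
    refine Finset.sum_le_sum_of_subset fun m hm => ?_
    simp only [Finset.mem_insert, Finset.mem_filter, Finset.mem_univ, true_and] at hm ⊢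
    rcases hm with rfl | hm
    · exact hlt
    · exact hm.trans hlt
  rw [Finset.sum_insert (by simp)] at h1
  omega

theorem rank_blk (k : Fin r) (a : ℕ) (ha : a < μ.1 k) :
    rank (blk μ) ⟨place μ k a ha, place_lt μ k a ha⟩ = a := by
  have h1 := (hasContent_blk μ).sortPlace_eq ⟨place μ k a ha, place_lt μ k a ha⟩
  rw [sortPlace_of_monotone (blk_monotone μ)] at h1
  exact (place_inj μ h1).2.symm

end Colourings

/-! ### Sorting elements -/

section SortingElements

variable {K : Type u} [Field K] {r n : ℕ} {q : Kˣ}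

theorem ygU_comm (i j : ℕ) (hi : i + 1 < n) (hj : j + 1 < n) (hij : i + 2 ≤ j ∨ j + 2 ≤ i) :
    (ygU i hi * ygU j hj : (Y K r n q)ˣ) = ygU j hj * ygU i hi :=
  Units.ext (yg_comm i j hi hj hij)

theorem ygU_braid (i : ℕ) (hi : i + 1 < n) (hi' : i + 1 + 1 < n) :
    (ygU i hi * ygU (i + 1) hi' * ygU i hi : (Y K r n q)ˣ) =
      ygU (i + 1) hi' * ygU i hi * ygU (i + 1) hi' :=
  Units.ext (yg_braid i hi hi')

/-- The places `i`, `i + 1` form a descent of the colouring `c`. -/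
def Descent (c : Fin n → Fin r) (i : ℕ) (hi : i + 1 < n) : Prop :=
  c ⟨i + 1, hi⟩ < c ⟨i, Nat.lt_of_succ_lt hi⟩

theorem Descent.toLex_lt {c : Fin n → Fin r} {i : ℕ} {hi : i + 1 < n} (h : Descent c i hi) :
    toLex (c ∘ sw i hi) < toLex c :=
  Pi.lex_desc (Fin.mk_le_mk.mpr (Nat.le_succ i)) h

open Classical in
variable (K q) in
/-- The product `g_{i_1} ⋯ g_{i_l}` along a sequence of adjacent transpositions which sorts the
colouring `c` by removing one descent at a time. The descents are chosen arbitrarily; by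
`sortElt_of_descent` the product does not depend on them. The recursion ends because removing a
descent makes the colouring lexicographically smaller. -/
def sortElt (c : Fin n → Fin r) : (Y K r n q)ˣ :=
  if h : ∃ i, ∃ hi, Descent c i hi then
    ygU h.choose h.choose_spec.choose * sortElt (c ∘ sw h.choose h.choose_spec.choose)
  else 1
termination_by (wellFounded_lt (α := Lex (Fin n → Fin r))).wrap (toLex c)
decreasing_by exact h.choose_spec.choose_spec.toLex_lt

theorem sortElt_of_monotone {c : Fin n → Fin r} (hc : Monotone c) : sortElt K q c = 1 := by
  rw [sortElt, dif_neg]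
  rintro ⟨i, hi, h⟩
  exact absurd (hc (Fin.mk_le_mk.mpr (Nat.le_succ i))) (not_le.mpr h)

/-- The diamond property: removing either of two descents first leads to the same product. -/
theorem descent_diamond {c : Fin n → Fin r}
    (ih : ∀ c' : Fin n → Fin r, toLex c' < toLex c → ∀ i hi, Descent c' i hi →
      sortElt K q c' = ygU i hi * sortElt K q (c' ∘ sw i hi))
    {i j : ℕ} {hi : i + 1 < n} {hj : j + 1 < n} (h : Descent c i hi) (h' : Descent c j hj)
    (hij : i < j) :
    ygU i hi * sortElt K q (c ∘ sw i hi) = ygU j hj * sortElt K q (c ∘ sw j hj) := by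
  rcases Nat.lt_or_ge (i + 1) j with hlt | hge
  · have h1 : Descent (c ∘ sw i hi) j hj := by
      simpa [Descent, sw_of_ne i hi ⟨j, _⟩ (show j ≠ i by omega) (show j ≠ i + 1 by omega),
        sw_of_ne i hi ⟨j + 1, _⟩ (show j + 1 ≠ i by omega) (show j + 1 ≠ i + 1 by omega)] using h'
    have h2 : Descent (c ∘ sw j hj) i hi := by
      simpa [Descent, sw_of_ne j hj ⟨i, _⟩ (show i ≠ j by omega) (show i ≠ j + 1 by omega),
        sw_of_ne j hj ⟨i + 1, _⟩ (show i + 1 ≠ j by omega) (show i + 1 ≠ j + 1 by omega)] using h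
    rw [ih _ h.toLex_lt j hj h1, ih _ h'.toLex_lt i hi h2, ← mul_assoc, ← mul_assoc,
      ygU_comm i j hi hj (by omega)]
    congr 2
    funext x
    exact congrArg c (sw_comm i j hi hj (by omega) x)
  · -- With adjacent descents `i`, `i + 1` the colours at `i`, `i + 1`, `i + 2` decrease, and both
    -- ways of sorting them take three steps, which the braid relation compares.
    obtain rfl : j = i + 1 := by omega
    have e0 : sw (i + 1) hj ⟨i, Nat.lt_of_succ_lt hi⟩ = ⟨i, Nat.lt_of_succ_lt hi⟩ :=
      sw_of_ne _ _ _ (by simp) (by simp; omega)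
    have e2 : sw i hi ⟨i + 1 + 1, hj⟩ = ⟨i + 1 + 1, hj⟩ :=
      sw_of_ne _ _ _ (by simp; omega) (by simp)
    have h3 : c ⟨i + 1 + 1, hj⟩ < c ⟨i, Nat.lt_of_succ_lt hi⟩ := lt_trans h' h
    have h1 : Descent (c ∘ sw i hi) (i + 1) hj := by
      simpa [Descent, sw_hi, e2] using h3
    have h2 : Descent (c ∘ sw (i + 1) hj) i hi := by
      simpa [Descent, sw_lo, e0] using h3
    have h1' : Descent ((c ∘ sw i hi) ∘ sw (i + 1) hj) i hi := by
      simpa [Descent, sw_lo, e0, e2] using h'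
    have h2' : Descent ((c ∘ sw (i + 1) hj) ∘ sw i hi) (i + 1) hj := by
      simpa [Descent, sw_hi, e0, e2] using h
    rw [ih _ h.toLex_lt _ hj h1, ih _ h'.toLex_lt _ hi h2,
      ih _ (h1.toLex_lt.trans h.toLex_lt) _ hi h1', ih _ (h2.toLex_lt.trans h'.toLex_lt) _ hj h2']
    simp only [← mul_assoc]
    rw [ygU_braid]
    congr 2
    funext x
    exact congrArg c (sw_braid i hi hj x)

/-- The sorting element may be computed by removing any descent first. -/
theorem sortElt_of_descent (c : Fin n → Fin r) (i : ℕ) (hi : i + 1 < n) (h : Descent c i hi) :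
    sortElt K q c = ygU i hi * sortElt K q (c ∘ sw i hi) := by
  induction hc : toLex c using WellFoundedLT.induction generalizing c i with
  | ind x ih =>
    subst hc
    have ih' : ∀ c' : Fin n → Fin r, toLex c' < toLex c → ∀ i hi, Descent c' i hi →
      sortElt K q c' = ygU i hi * sortElt K q (c' ∘ sw i hi) :=
      fun c' hc' i hi h => ih _ hc' c' i hi h rfl
    have hex : ∃ i, ∃ hi, Descent c i hi := ⟨i, hi, h⟩
    rw [sortElt, dif_pos hex]
    have hj : Descent c hex.choose hex.choose_spec.choose := hex.choose_spec.choose_spec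
    generalize_proofs hj' at hj ⊢
    generalize hex.choose = j at *
    rcases lt_trichotomy j i with hji | rfl | hji
    · exact descent_diamond ih' hj h hji
    · rfl
    · exact (descent_diamond ih' h hj hji).symm

/-- Induction over colourings, reducing the descents one at a time. -/
theorem colouring_induction {P : (Fin n → Fin r) → Prop} (mono : ∀ c, Monotone c → P c)
    (desc : ∀ c i hi, Descent c i hi → (∀ c', toLex c' < toLex c → P c') → P c)
    (c : Fin n → Fin r) : P c := by
  induction hc : toLex c using WellFoundedLT.induction generalizing c with
  | ind x ih =>
    subst hc
    by_cases hex : ∃ i, ∃ hi, Descent c i hi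
    · obtain ⟨i, hi, h⟩ := hex
      exact desc c i hi h fun c' hc' => ih _ hc' c' rfl
    · exact mono c (monotone_of_no_descent fun i hi h => hex ⟨i, hi, h⟩)

theorem Descent.ne {c : Fin n → Fin r} {i : ℕ} {hi : i + 1 < n} (h : Descent c i hi) :
    c ⟨i, Nat.lt_of_succ_lt hi⟩ ≠ c ⟨i + 1, hi⟩ := (LT.lt.ne h).symm

/-- If `i` and `i + 1` have the same colour then `g_i` moves through the sorting element, to the
place of `i` after sorting. -/
theorem ygU_mul_sortElt (c : Fin n → Fin r) (i : ℕ) (hi : i + 1 < n)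
    (h : c ⟨i, Nat.lt_of_succ_lt hi⟩ = c ⟨i + 1, hi⟩) (j : ℕ) (hj : j + 1 < n)
    (hij : sortPlace c ⟨i, Nat.lt_of_succ_lt hi⟩ = j) :
    ygU i hi * sortElt K q c = sortElt K q c * ygU j hj := by
  induction c using colouring_induction generalizing i with
  | mono c hc =>
    obtain rfl : i = j := by rw [← hij, sortPlace_of_monotone hc]
    rw [sortElt_of_monotone hc, mul_one, one_mul]
  | desc c l hl hd ih =>
    have hne : i ≠ l := by rintro rfl; exact hd.ne h
    by_cases hfar : i + 2 ≤ l ∨ l + 2 ≤ i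
    · have e1 : sw l hl ⟨i, Nat.lt_of_succ_lt hi⟩ = ⟨i, Nat.lt_of_succ_lt hi⟩ :=
        sw_of_ne _ _ _ (by simp; omega) (by simp; omega)
      have e2 : sw l hl ⟨i + 1, hi⟩ = ⟨i + 1, hi⟩ :=
        sw_of_ne _ _ _ (by simp; omega) (by simp; omega)
      have := ih _ hd.toLex_lt i hi (by simpa [e1, e2] using h)
        (by rw [sortPlace_comp_sw hd.ne, e1, hij])
      rw [sortElt_of_descent c l hl hd, ← mul_assoc, ygU_comm _ _ _ _ hfar, mul_assoc, this,
        mul_assoc]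
    · -- The descent at `l` overlaps with the equal colours at `i`, `i + 1`. Removing it creates a
      -- second descent on the same three places, and after removing that one as well the equal
      -- colours are adjacent again.
      rcases Nat.lt_or_ge i l with hlt | hge
      · obtain rfl : l = i + 1 := by omega
        have e0 : sw (i + 1) hl ⟨i, Nat.lt_of_succ_lt hi⟩ = ⟨i, Nat.lt_of_succ_lt hi⟩ :=
          sw_of_ne _ _ _ (by simp) (by simp; omega)
        have e2 : sw i hi ⟨i + 1 + 1, hl⟩ = ⟨i + 1 + 1, hl⟩ :=
          sw_of_ne _ _ _ (by simp; omega) (by simp)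
        have h1 : Descent (c ∘ sw (i + 1) hl) i hi := by
          unfold Descent at hd ⊢
          simpa [sw_lo, e0, h] using hd
        have := ih _ (h1.toLex_lt.trans hd.toLex_lt) (i + 1) hl
          (by simp [sw_hi, e0, e2, h])
          (by rw [sortPlace_comp_sw h1.ne, sw_hi, sortPlace_comp_sw hd.ne, e0, hij])
        rw [sortElt_of_descent c _ hl hd, sortElt_of_descent _ i hi h1, ← mul_assoc, ← mul_assoc,
          ygU_braid, mul_assoc, this]
        simp only [mul_assoc]
      · obtain rfl : i = l + 1 := by omega
        have e0 : sw (l + 1) hi ⟨l, Nat.lt_of_succ_lt hl⟩ = ⟨l, Nat.lt_of_succ_lt hl⟩ :=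
          sw_of_ne _ _ _ (by simp) (by simp; omega)
        have e2 : sw l hl ⟨l + 1 + 1, hi⟩ = ⟨l + 1 + 1, hi⟩ :=
          sw_of_ne _ _ _ (by simp; omega) (by simp)
        have h1 : Descent (c ∘ sw l hl) (l + 1) hi := by
          unfold Descent at hd ⊢
          simpa [sw_hi, e2, ← h] using hd
        have := ih _ (h1.toLex_lt.trans hd.toLex_lt) l hl
          (by simp [sw_lo, e0, e2, h])
          (by rw [sortPlace_comp_sw h1.ne, e0, sortPlace_comp_sw hd.ne, sw_lo, hij])
        rw [sortElt_of_descent c _ hl hd, sortElt_of_descent _ _ hi h1, ← mul_assoc, ← mul_assoc,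
          ← ygU_braid, mul_assoc, this]
        simp only [mul_assoc]

/-- The element `t_j` moves through the sorting element, to the place of `j` after sorting. -/
theorem yt_mul_sortElt (c : Fin n → Fin r) (j : Fin n) :
    (yt j : Y K r n q) * (sortElt K q c).val =
      (sortElt K q c).val * yt ⟨sortPlace c j, sortPlace_lt c j⟩ := by
  induction c using colouring_induction generalizing j with
  | mono c hc =>
    have : (⟨sortPlace c j, sortPlace_lt c j⟩ : Fin n) = j := Fin.ext (sortPlace_of_monotone hc j)
    rw [this, sortElt_of_monotone hc, Units.val_one, mul_one, one_mul]
  | desc c i hi hd ih =>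
    have h1 : (yt j : Y K r n q) * (ygU i hi).val = (ygU i hi).val * yt (sw i hi j) := by
      have := yg_t (K := K) (r := r) (q := q) i hi (sw i hi j)
      rw [sw_sw] at this
      exact this.symm
    have h2 := ih _ hd.toLex_lt (sw i hi j)
    simp only [sortPlace_comp_sw hd.ne, sw_sw] at h2
    rw [sortElt_of_descent c i hi hd, Units.val_mul, ← mul_assoc, h1, mul_assoc, h2, mul_assoc]

end SortingElements

/-! ### The scalars by which `G` acts on its simple modules -/

section Scalars

variable {K : Type u} [Field K] [IsAlgClosed K] {r : ℕ} (S : SimpleFamily K r)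

/-- The scalar by which the generator of `G` acts on `V_k`. -/
def zeta (k : Fin r) : K := scal S k (Multiplicative.ofAdd 1)

theorem finrank_V (k : Fin r) : Module.finrank K (S.V k) = 1 := by
  have := S.finite k
  have := S.irreducible k
  exact Representation.IsIrreducible.finrank_eq_one_of_isMulCommutative (S.σ k)

theorem scal_eq_of_smul {k : Fin r} {c d : K}
    (h : c • (LinearMap.id : S.V k →ₗ[K] S.V k) = d • LinearMap.id) : c = d := by
  have : Nontrivial (S.V k) := Module.nontrivial_of_finrank_eq_succ (finrank_V S k)
  obtain ⟨v, hv⟩ := exists_ne (0 : S.V k)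
  exact smul_left_injective K hv (LinearMap.congr_fun h v)

theorem scal_one (k : Fin r) : scal S k 1 = 1 :=
  scal_eq_of_smul S (by rw [← scal_spec, map_one, one_smul]; rfl)

theorem scal_mul (k : Fin r) (g h : G r) : scal S k (g * h) = scal S k g * scal S k h :=
  scal_eq_of_smul S (by
    rw [← scal_spec, map_mul, scal_spec, scal_spec, smul_mul_smul_comm]; rfl)

theorem scal_pow (k : Fin r) (g : G r) (s : ℕ) : scal S k (g ^ s) = scal S k g ^ s := by
  induction s with
  | zero => simp [scal_one]
  | succ s ih => rw [pow_succ, scal_mul, ih, pow_succ]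

theorem scal_ofAdd (k : Fin r) (s : ℕ) :
    scal S k (Multiplicative.ofAdd ((s : ℤ) : ZMod r)) = zeta S k ^ s := by
  rw [zeta, ← scal_pow, ← ofAdd_nsmul]
  simp

theorem zeta_pow (k : Fin r) : zeta S k ^ r = 1 := by
  rw [← scal_ofAdd]
  simp [scal_one]

/-- The modules `V_k` are lines, so the scalar `zeta S k` determines `V_k` up to isomorphism. -/
theorem zeta_injective [NeZero r] : Function.Injective (zeta S) := by
  intro k l h
  by_contra hkl
  have hk := S.finite k
  have hl := S.finite l
  let e : S.V k ≃ₗ[K] S.V l := LinearEquiv.ofFinrankEq _ _ (by rw [finrank_V, finrank_V])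
  refine (S.not_iso k l hkl).false (Representation.Equiv.mk e fun g => ?_)
  obtain ⟨s, rfl⟩ := exists_eq_ofAdd g
  rw [scal_spec, scal_spec, scal_ofAdd, scal_ofAdd, h]
  ext v
  simp

/-- The scalar by which `e_i` acts on a vector of colours `a` at `i` and `b` at `i + 1`. For `a ≠ b`
the sum is `y * (x ^ r - y ^ r) / (x - y) = 0`, where `x ≠ y` are the scalars of `a` and `b`. -/
theorem zeta_sum [NeZero r] [NeZero (r : K)] (a b : Fin r) :
    (r : K)⁻¹ * ∑ s ∈ Finset.range r, zeta S a ^ s * zeta S b ^ (r - s) =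
      if a = b then 1 else 0 := by
  split_ifs with h
  · subst h
    rw [Finset.sum_congr rfl fun s hs => by
      rw [← pow_add, Nat.add_sub_cancel' (Finset.mem_range.mp hs).le, zeta_pow]]
    simp [NeZero.ne (r : K)]
  · have h1 : ∑ s ∈ Finset.range r, zeta S a ^ s * zeta S b ^ (r - s) =
        (∑ s ∈ Finset.range r, zeta S a ^ s * zeta S b ^ (r - 1 - s)) * zeta S b := by
      rw [Finset.sum_mul]
      refine Finset.sum_congr rfl fun s hs => ?_
      have := Finset.mem_range.mp hs
      rw [mul_assoc, ← pow_succ]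
      congr 2
      omega
    have h2 : (∑ s ∈ Finset.range r, zeta S a ^ s * zeta S b ^ (r - 1 - s)) = 0 := by
      have := geom_sum₂_mul (zeta S a) (zeta S b) r
      rw [zeta_pow, zeta_pow, sub_self] at this
      exact (mul_eq_zero.mp this).resolve_right (sub_ne_zero.mpr fun e => h (zeta_injective S e))
    rw [h1, h2, zero_mul, mul_zero]

end Scalars

/-! ### Relations in the affine Hecke algebras and their tensor products -/

section HeckeRelations

variable {K : Type u} [Field K] {m : ℕ} {q : Kˣ}

theorem hmk_rel {a b : FreeAlgebra K (HGen m)} (h : HRel K m q a b) :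
    (hmk a : H K m q) = hmk b := RingQuot.mkAlgHom_rel K h

theorem hT_sq (i : ℕ) (hi : i + 1 < m) :
    (hT i hi * hT i hi : H K m q) = 1 + qq q • hT i hi := by
  have h := hmk_rel (HRel.quad (q := q) i hi)
  rw [map_mul, map_sub, map_add, map_zero, AlgHom.commutes, AlgHom.commutes] at h
  change (hT i hi - algebraMap K (H K m q) q) *
    (hT i hi + algebraMap K (H K m q) (q⁻¹ : Kˣ)) = 0 at h
  rw [sub_mul, mul_add, mul_add, ← map_mul, Units.mul_inv, map_one,
    ← Algebra.commutes ((q⁻¹ : Kˣ) : K) (hT i hi), ← Algebra.smul_def, ← Algebra.smul_def,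
    sub_eq_zero, ← eq_sub_iff_add_eq] at h
  rw [h, qq, sub_smul]
  abel

theorem hT_braid (i : ℕ) (hi : i + 1 < m) (hi' : i + 1 + 1 < m) :
    (hT i hi * hT (i + 1) hi' * hT i hi : H K m q) = hT (i + 1) hi' * hT i hi * hT (i + 1) hi' := by
  have h := hmk_rel (HRel.braid (q := q) i hi hi')
  rw [map_mul, map_mul, map_mul, map_mul] at h
  exact h

theorem hT_comm (i j : ℕ) (hi : i + 1 < m) (hj : j + 1 < m) (hij : i + 2 ≤ j ∨ j + 2 ≤ i) :
    Commute (hT i hi : H K m q) (hT j hj) := by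
  have h := hmk_rel (HRel.T_comm (q := q) i j hi hj hij)
  rwa [map_mul, map_mul] at h

theorem hY_hYinv (j : Fin m) : (hY j * hYinv j : H K m q) = 1 := by
  have h := hmk_rel (HRel.Y_Yinv (K := K) (q := q) j)
  rwa [map_mul, map_one] at h

theorem hYinv_hY (j : Fin m) : (hYinv j * hY j : H K m q) = 1 := by
  have h := hmk_rel (HRel.Yinv_Y (K := K) (q := q) j)
  rwa [map_mul, map_one] at h

theorem hY_comm (i j : Fin m) : Commute (hY i : H K m q) (hY j) := by
  have h := hmk_rel (HRel.Y_comm (K := K) (q := q) i j)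
  rwa [map_mul, map_mul] at h

theorem hT_hY_hT (i : ℕ) (hi : i + 1 < m) :
    (hT i hi * hY ⟨i, Nat.lt_of_succ_lt hi⟩ * hT i hi : H K m q) = hY ⟨i + 1, hi⟩ := by
  have h := hmk_rel (HRel.T_Y_T (K := K) (q := q) i hi)
  rw [map_mul, map_mul] at h
  exact h

theorem hT_hY (i : ℕ) (hi : i + 1 < m) (j : Fin m) (h : (j : ℕ) ≠ i) (h' : (j : ℕ) ≠ i + 1) :
    Commute (hT i hi : H K m q) (hY j) := by
  have h := hmk_rel (HRel.T_Y (q := q) i hi j h h')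
  rwa [map_mul, map_mul] at h

end HeckeRelations

section TensorGenerators

variable {K : Type u} [Field K] {r n : ℕ} {q : Kˣ} (μ : Comp r n)

theorem commute_singleAlgHom {k l : Fin r} (hkl : k ≠ l) (x : H K (μ.1 k) q) (y : H K (μ.1 l) q) :
    Commute (PiTensorProduct.singleAlgHom k x : Hmu K q μ) (PiTensorProduct.singleAlgHom l y) := by
  rw [PiTensorProduct.singleAlgHom_apply, PiTensorProduct.singleAlgHom_apply, Commute, SemiconjBy,
    PiTensorProduct.tprod_mul_tprod, PiTensorProduct.tprod_mul_tprod]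
  congr 1
  exact Pi.mulSingle_commute (f := fun k => H K (μ.1 k) q) hkl x y

variable (K q)

/-- The generator `T_{a+1}` of the `k`-th factor of `Hmu`; it is zero if there is no such
generator, which spares a proof of `a + 1 < μ_k` in the argument. -/
def HT (k : Fin r) (a : ℕ) : Hmu K q μ :=
  if h : a + 1 < μ.1 k then PiTensorProduct.singleAlgHom k (hT a h) else 0

/-- The generator `Y_{a+1}` of the `k`-th factor of `Hmu`; it is zero if there is no such
generator. -/
def HY (k : Fin r) (a : ℕ) : Hmu K q μ :=
  if h : a < μ.1 k then PiTensorProduct.singleAlgHom k (hY ⟨a, h⟩) else 0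

/-- The generator `Y_{a+1}⁻¹` of the `k`-th factor of `Hmu`; it is zero if there is no such
generator. -/
def HYinv (k : Fin r) (a : ℕ) : Hmu K q μ :=
  if h : a < μ.1 k then PiTensorProduct.singleAlgHom k (hYinv ⟨a, h⟩) else 0

theorem HT_sq (k : Fin r) (a : ℕ) (h : a + 1 < μ.1 k) :
    HT K q μ k a * HT K q μ k a = 1 + qq q • HT K q μ k a := by
  simp only [HT, dif_pos h]
  rw [← map_mul, hT_sq, map_add, map_one, map_smul]

theorem HT_braid (k : Fin r) (a : ℕ) (h : a + 1 + 1 < μ.1 k) :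
    HT K q μ k a * HT K q μ k (a + 1) * HT K q μ k a =
      HT K q μ k (a + 1) * HT K q μ k a * HT K q μ k (a + 1) := by
  simp only [HT, dif_pos h, dif_pos (Nat.lt_of_succ_lt h)]
  simp only [← map_mul, hT_braid]

theorem HT_comm (k l : Fin r) (a b : ℕ) (h : k = l → a + 2 ≤ b ∨ b + 2 ≤ a) :
    Commute (HT K q μ k a) (HT K q μ l b) := by
  unfold HT
  split_ifs with h1 h2
  · by_cases hkl : k = l
    · subst hkl
      exact (hT_comm a b h1 h2 (h rfl)).map _
    · exact commute_singleAlgHom μ hkl _ _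
  · exact Commute.zero_right _
  · exact Commute.zero_left _
  · exact Commute.zero_left _

theorem HY_comm (k l : Fin r) (a b : ℕ) : Commute (HY K q μ k a) (HY K q μ l b) := by
  unfold HY
  split_ifs with h1 h2
  · by_cases hkl : k = l
    · subst hkl
      exact (hY_comm _ _).map _
    · exact commute_singleAlgHom μ hkl _ _
  · exact Commute.zero_right _
  · exact Commute.zero_left _
  · exact Commute.zero_left _

theorem HT_HY_comm (k l : Fin r) (a b : ℕ) (h : k = l → b ≠ a ∧ b ≠ a + 1) :
    Commute (HT K q μ k a) (HY K q μ l b) := by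
  unfold HT HY
  split_ifs with h1 h2
  · by_cases hkl : k = l
    · subst hkl
      exact (hT_hY a h1 ⟨b, h2⟩ (h rfl).1 (h rfl).2).map _
    · exact commute_singleAlgHom μ hkl _ _
  · exact Commute.zero_right _
  · exact Commute.zero_left _
  · exact Commute.zero_left _

theorem HY_HYinv (k : Fin r) (a : ℕ) (h : a < μ.1 k) : HY K q μ k a * HYinv K q μ k a = 1 := by
  simp only [HY, HYinv, dif_pos h]
  rw [← map_mul, hY_hYinv, map_one]

theorem HYinv_HY (k : Fin r) (a : ℕ) (h : a < μ.1 k) : HYinv K q μ k a * HY K q μ k a = 1 := by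
  simp only [HY, HYinv, dif_pos h]
  rw [← map_mul, hYinv_hY, map_one]

theorem HT_HY_HT (k : Fin r) (a : ℕ) (h : a + 1 < μ.1 k) :
    HT K q μ k a * HY K q μ k a * HT K q μ k a = HY K q μ k (a + 1) := by
  simp only [HT, HY, dif_pos h, dif_pos (Nat.lt_of_succ_lt h)]
  rw [← map_mul, ← map_mul, hT_hY_hT]

end TensorGenerators

/-! ### The model of an induced module -/

section Model

variable {K : Type u} [Field K] {r n : ℕ} {q : Kˣ} {μ : Comp r n}

variable (μ) in
/-- The colourings of the places in which each colour `k` occurs `μ_k` times. -/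
abbrev Colouring : Type := {c : Fin n → Fin r // HasContent μ c}

/-- The colouring obtained by exchanging the colours of `i` and `i + 1`. -/
def Colouring.swap (c : Colouring μ) (i : ℕ) (hi : i + 1 < n) : Colouring μ :=
  ⟨c.1 ∘ sw i hi, c.2.comp_sw i hi⟩

variable (μ) in
/-- The colouring of the places by the blocks of `μ`. -/
def Colouring.std : Colouring μ := ⟨blk μ, hasContent_blk μ⟩

theorem Colouring.swap_swap (c : Colouring μ) (i : ℕ) (hi : i + 1 < n) :
    (c.swap i hi).swap i hi = c := Subtype.ext (comp_sw_sw _ _ _)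

variable {W : Type u} [AddCommGroup W] [Module K W] (α : Hmu K q μ →ₐ[K] Module.End K W)

/-- The action of `g_{i+1}` on the model: on the component of `c` it is given by a generator `T` if
`i` and `i + 1` have the same colour, and it exchanges components otherwise. The component of `c`
stands for the translate by the sorting element of `c` of the component of the standard colouring,
so that the generator `T` is found by sorting: if `i` is the `a`-th place of colour `k`, it is the
`a`-th generator of the `k`-th factor. -/
def modelG (i : ℕ) (hi : i + 1 < n) : Module.End K (Colouring μ → W) where
  toFun f c := if c.1 ⟨i, Nat.lt_of_succ_lt hi⟩ = c.1 ⟨i + 1, hi⟩ then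
      α (HT K q μ (c.1 ⟨i, Nat.lt_of_succ_lt hi⟩) (rank c.1 ⟨i, Nat.lt_of_succ_lt hi⟩)) (f c)
    else f (c.swap i hi)
  map_add' f g := funext fun c => by simp only [Pi.add_apply, map_add]; split_ifs <;> rfl
  map_smul' a f := funext fun c => by
    simp only [Pi.smul_apply, map_smul, RingHom.id_apply]; split_ifs <;> rfl

/-- The action of `X_{j+1}` on the model, by the generator `Y` attached to the colour of `j`. -/
def modelX (j : Fin n) : Module.End K (Colouring μ → W) where
  toFun f c := α (HY K q μ (c.1 j) (rank c.1 j)) (f c)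
  map_add' _ _ := funext fun _ => map_add _ _ _
  map_smul' _ _ := funext fun _ => map_smul _ _ _

/-- The action of `X_{j+1}⁻¹` on the model. -/
def modelXinv (j : Fin n) : Module.End K (Colouring μ → W) where
  toFun f c := α (HYinv K q μ (c.1 j) (rank c.1 j)) (f c)
  map_add' _ _ := funext fun _ => map_add _ _ _
  map_smul' _ _ := funext fun _ => map_smul _ _ _

theorem modelG_of_eq {i : ℕ} {hi : i + 1 < n} (f : Colouring μ → W) {c : Colouring μ}
    (h : c.1 ⟨i, Nat.lt_of_succ_lt hi⟩ = c.1 ⟨i + 1, hi⟩) : modelG α i hi f c =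
      α (HT K q μ (c.1 ⟨i, Nat.lt_of_succ_lt hi⟩) (rank c.1 ⟨i, Nat.lt_of_succ_lt hi⟩)) (f c) :=
  if_pos h

theorem modelG_of_ne {i : ℕ} {hi : i + 1 < n} (f : Colouring μ → W) {c : Colouring μ}
    (h : c.1 ⟨i, Nat.lt_of_succ_lt hi⟩ ≠ c.1 ⟨i + 1, hi⟩) :
    modelG α i hi f c = f (c.swap i hi) :=
  if_neg h

theorem modelX_apply (j : Fin n) (f : Colouring μ → W) (c : Colouring μ) :
    modelX α j f c = α (HY K q μ (c.1 j) (rank c.1 j)) (f c) := rfl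

theorem modelXinv_apply (j : Fin n) (f : Colouring μ → W) (c : Colouring μ) :
    modelXinv α j f c = α (HYinv K q μ (c.1 j) (rank c.1 j)) (f c) := rfl

theorem act_mul (x y : Hmu K q μ) (w : W) : α x (α y w) = α (x * y) w := by
  rw [map_mul, Module.End.mul_apply]

theorem Colouring.swap_apply (c : Colouring μ) (i : ℕ) (hi : i + 1 < n) (x : Fin n) :
    (c.swap i hi).1 x = c.1 (sw i hi x) := rfl

theorem Colouring.rank_swap {c : Colouring μ} {i : ℕ} {hi : i + 1 < n}
    (h : c.1 ⟨i, Nat.lt_of_succ_lt hi⟩ ≠ c.1 ⟨i + 1, hi⟩) (x : Fin n) :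
    rank (c.swap i hi).1 x = rank c.1 (sw i hi x) := rank_comp_sw h x

theorem HasContent.rank_succ_lt {c : Fin n → Fin r} (hc : HasContent μ c) {i : ℕ} {hi : i + 1 < n}
    (h : c ⟨i, Nat.lt_of_succ_lt hi⟩ = c ⟨i + 1, hi⟩) :
    rank c ⟨i, Nat.lt_of_succ_lt hi⟩ + 1 < μ.1 (c ⟨i, Nat.lt_of_succ_lt hi⟩) := by
  have := hc.rank_lt ⟨i + 1, hi⟩
  rwa [rank_succ h, ← h] at this

theorem modelG_comm {i j : ℕ} (hi : i + 1 < n) (hj : j + 1 < n) (hij : i + 2 ≤ j) :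
    modelG α i hi * modelG α j hj = modelG α j hj * modelG α i hi := by
  refine LinearMap.ext fun f => funext fun c => ?_
  simp only [Module.End.mul_apply]
  have a1 : sw i hi ⟨j, Nat.lt_of_succ_lt hj⟩ = ⟨j, Nat.lt_of_succ_lt hj⟩ :=
    sw_of_ne _ _ _ (by simp; omega) (by simp; omega)
  have a2 : sw i hi ⟨j + 1, hj⟩ = ⟨j + 1, hj⟩ :=
    sw_of_ne _ _ _ (by simp; omega) (by simp; omega)
  have b1 : sw j hj ⟨i, Nat.lt_of_succ_lt hi⟩ = ⟨i, Nat.lt_of_succ_lt hi⟩ :=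
    sw_of_ne _ _ _ (by simp; omega) (by simp; omega)
  have b2 : sw j hj ⟨i + 1, hi⟩ = ⟨i + 1, hi⟩ :=
    sw_of_ne _ _ _ (by simp; omega) (by simp; omega)
  by_cases h1 : c.1 ⟨i, Nat.lt_of_succ_lt hi⟩ = c.1 ⟨i + 1, hi⟩ <;>
    by_cases h2 : c.1 ⟨j, Nat.lt_of_succ_lt hj⟩ = c.1 ⟨j + 1, hj⟩
  · rw [modelG_of_eq α _ h1, modelG_of_eq α _ h2, modelG_of_eq α _ h2, modelG_of_eq α _ h1,
      act_mul, act_mul, (HT_comm K q μ _ _ _ _ _).eq]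
    intro h
    have h3 := rank_lt_rank (c := c.1) (i := ⟨i + 1, hi⟩) (j := ⟨j, Nat.lt_of_succ_lt hj⟩)
      (h1 ▸ h) (by simp [Fin.lt_def]; omega)
    rw [rank_succ h1] at h3
    exact Or.inl h3
  · have h2' : (c.swap j hj).1 ⟨i, Nat.lt_of_succ_lt hi⟩ = (c.swap j hj).1 ⟨i + 1, hi⟩ := by
      simpa only [Colouring.swap_apply, b1, b2] using h1
    rw [modelG_of_eq α _ h1, modelG_of_ne α _ h2, modelG_of_ne α _ h2, modelG_of_eq α _ h2',
      Colouring.rank_swap h2, Colouring.swap_apply, b1]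
  · have h1' : (c.swap i hi).1 ⟨j, Nat.lt_of_succ_lt hj⟩ = (c.swap i hi).1 ⟨j + 1, hj⟩ := by
      simpa only [Colouring.swap_apply, a1, a2] using h2
    rw [modelG_of_ne α _ h1, modelG_of_eq α _ h2, modelG_of_ne α _ h1, modelG_of_eq α _ h1',
      Colouring.rank_swap h1, Colouring.swap_apply, a1]
  · have h1' : (c.swap i hi).1 ⟨j, Nat.lt_of_succ_lt hj⟩ ≠ (c.swap i hi).1 ⟨j + 1, hj⟩ := by
      simpa only [Colouring.swap_apply, a1, a2] using h2
    have h2' : (c.swap j hj).1 ⟨i, Nat.lt_of_succ_lt hi⟩ ≠ (c.swap j hj).1 ⟨i + 1, hi⟩ := by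
      simpa only [Colouring.swap_apply, b1, b2] using h1
    rw [modelG_of_ne α _ h1, modelG_of_ne α _ h2, modelG_of_ne α _ h1', modelG_of_ne α _ h2']
    congr 1
    refine Subtype.ext (funext fun x => congrArg c.1 (sw_comm i j hi hj (Or.inl hij) x))

theorem modelG_braid (i : ℕ) (hi : i + 1 < n) (hi' : i + 1 + 1 < n) :
    modelG α i hi * modelG α (i + 1) hi' * modelG α i hi =
      modelG α (i + 1) hi' * modelG α i hi * modelG α (i + 1) hi' := by
  refine LinearMap.ext fun f => funext fun c => ?_
  simp only [Module.End.mul_apply]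
  have e0 : sw (i + 1) hi' ⟨i, Nat.lt_of_succ_lt hi⟩ = ⟨i, Nat.lt_of_succ_lt hi⟩ :=
    sw_of_ne _ _ _ (by simp) (by simp; omega)
  have e2 : sw i hi ⟨i + 1 + 1, hi'⟩ = ⟨i + 1 + 1, hi'⟩ :=
    sw_of_ne _ _ _ (by simp; omega) (by simp)
  have A : ∀ d : Colouring μ, (d.swap i hi).1 ⟨i, Nat.lt_of_succ_lt hi⟩ = d.1 ⟨i + 1, hi⟩ :=
    fun d => by rw [Colouring.swap_apply, sw_lo]
  have B : ∀ d : Colouring μ, (d.swap i hi).1 ⟨i + 1, hi⟩ = d.1 ⟨i, Nat.lt_of_succ_lt hi⟩ :=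
    fun d => by rw [Colouring.swap_apply, sw_hi]
  have C : ∀ d : Colouring μ, (d.swap i hi).1 ⟨i + 1 + 1, hi'⟩ = d.1 ⟨i + 1 + 1, hi'⟩ :=
    fun d => by rw [Colouring.swap_apply, e2]
  have A' : ∀ d : Colouring μ, (d.swap (i + 1) hi').1 ⟨i, Nat.lt_of_succ_lt hi⟩ =
    d.1 ⟨i, Nat.lt_of_succ_lt hi⟩ := fun d => by rw [Colouring.swap_apply, e0]
  have B' : ∀ d : Colouring μ, (d.swap (i + 1) hi').1 ⟨i + 1, hi⟩ = d.1 ⟨i + 1 + 1, hi'⟩ :=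
    fun d => by rw [Colouring.swap_apply, sw_lo]
  have C' : ∀ d : Colouring μ, (d.swap (i + 1) hi').1 ⟨i + 1 + 1, hi'⟩ = d.1 ⟨i + 1, hi⟩ :=
    fun d => by rw [Colouring.swap_apply, sw_hi]
  -- The five cases are the coincidences among the colours of the places `i`, `i + 1`, `i + 2`.
  by_cases h01 : c.1 ⟨i, Nat.lt_of_succ_lt hi⟩ = c.1 ⟨i + 1, hi⟩
  · by_cases h12 : c.1 ⟨i + 1, hi⟩ = c.1 ⟨i + 1 + 1, hi'⟩
    · -- Only if the three colours agree is the braid relation of the affine Hecke algebra needed.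
      rw [modelG_of_eq α _ h01, modelG_of_eq α _ h12, modelG_of_eq α _ h01,
        modelG_of_eq α _ h12, modelG_of_eq α _ h01, modelG_of_eq α _ h12, act_mul, act_mul,
        act_mul, act_mul, rank_succ h01, ← h01, HT_braid]
      have := c.2.rank_succ_lt (hi := hi') h12
      rwa [rank_succ h01, ← h01] at this
    · have h1 : (c.swap (i + 1) hi').1 ⟨i, Nat.lt_of_succ_lt hi⟩ ≠
          (c.swap (i + 1) hi').1 ⟨i + 1, hi⟩ := by
        rw [A', B', h01]; exact h12
      have h2 : ((c.swap (i + 1) hi').swap i hi).1 ⟨i + 1, hi⟩ =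
          ((c.swap (i + 1) hi').swap i hi).1 ⟨i + 1 + 1, hi'⟩ := by
        rw [B, C, A', C', h01]
      rw [modelG_of_eq α _ h01, modelG_of_ne α _ h12, modelG_of_ne α _ h1,
        modelG_of_ne α _ h12, modelG_of_ne α _ h1, modelG_of_eq α _ h2, Colouring.rank_swap h1,
        sw_hi, Colouring.rank_swap h12, e0, B, A']
  · by_cases h12 : c.1 ⟨i + 1, hi⟩ = c.1 ⟨i + 1 + 1, hi'⟩
    · have h1 : (c.swap i hi).1 ⟨i + 1, hi⟩ ≠ (c.swap i hi).1 ⟨i + 1 + 1, hi'⟩ := by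
        rw [B, C, ← h12]; exact h01
      have h2 : ((c.swap i hi).swap (i + 1) hi').1 ⟨i, Nat.lt_of_succ_lt hi⟩ =
          ((c.swap i hi).swap (i + 1) hi').1 ⟨i + 1, hi⟩ := by
        rw [A', B', A, C, h12]
      rw [modelG_of_ne α _ h01, modelG_of_ne α _ h1, modelG_of_eq α _ h2, modelG_of_eq α _ h12,
        modelG_of_ne α _ h01, modelG_of_ne α _ h1, Colouring.rank_swap h1, e0,
        Colouring.rank_swap h01, sw_lo, A', A]
    · have k1 := h01
      by_cases h02 : c.1 ⟨i, Nat.lt_of_succ_lt hi⟩ = c.1 ⟨i + 1 + 1, hi'⟩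
      · have h1 : (c.swap i hi).1 ⟨i + 1, hi⟩ = (c.swap i hi).1 ⟨i + 1 + 1, hi'⟩ := by
          rw [B, C, h02]
        have h2 : (c.swap (i + 1) hi').1 ⟨i, Nat.lt_of_succ_lt hi⟩ =
          (c.swap (i + 1) hi').1 ⟨i + 1, hi⟩ := by rw [A', B', h02]
        have h3 : (c.swap i hi).1 ⟨i, Nat.lt_of_succ_lt hi⟩ ≠ (c.swap i hi).1 ⟨i + 1, hi⟩ := by
          rw [A, B]; exact Ne.symm h01
        have h4 : (c.swap (i + 1) hi').1 ⟨i + 1, hi⟩ ≠ (c.swap (i + 1) hi').1 ⟨i + 1 + 1, hi'⟩ := by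
          rw [B', C']; exact Ne.symm h12
        rw [modelG_of_ne α _ h01, modelG_of_eq α _ h1, modelG_of_ne α _ h3, modelG_of_ne α _ h12,
          modelG_of_eq α _ h2, modelG_of_ne α _ h4, Colouring.swap_swap, Colouring.swap_swap,
          Colouring.rank_swap h01, Colouring.rank_swap h12, sw_hi, e0, B, A']
      · have h1 : (c.swap i hi).1 ⟨i + 1, hi⟩ ≠ (c.swap i hi).1 ⟨i + 1 + 1, hi'⟩ := by
          rw [B, C]; exact h02
        have h2 : (c.swap (i + 1) hi').1 ⟨i, Nat.lt_of_succ_lt hi⟩ ≠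
          (c.swap (i + 1) hi').1 ⟨i + 1, hi⟩ := by rw [A', B']; exact h02
        have h3 : ((c.swap i hi).swap (i + 1) hi').1 ⟨i, Nat.lt_of_succ_lt hi⟩ ≠
          ((c.swap i hi).swap (i + 1) hi').1 ⟨i + 1, hi⟩ := by rw [A', B', A, C]; exact h12
        have h4 : ((c.swap (i + 1) hi').swap i hi).1 ⟨i + 1, hi⟩ ≠
          ((c.swap (i + 1) hi').swap i hi).1 ⟨i + 1 + 1, hi'⟩ := by
          rw [B, C, A', C']; exact h01
        rw [modelG_of_ne α _ h01, modelG_of_ne α _ h1, modelG_of_ne α _ h3, modelG_of_ne α _ h12,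
          modelG_of_ne α _ h2, modelG_of_ne α _ h4]
        congr 1
        exact Subtype.ext (funext fun x => congrArg c.1 (sw_braid i hi hi' x))

theorem modelG_X_G (i : ℕ) (hi : i + 1 < n) :
    modelG α i hi * modelX α ⟨i, Nat.lt_of_succ_lt hi⟩ * modelG α i hi =
      modelX α ⟨i + 1, hi⟩ := by
  refine LinearMap.ext fun f => funext fun c => ?_
  simp only [Module.End.mul_apply]
  by_cases h : c.1 ⟨i, Nat.lt_of_succ_lt hi⟩ = c.1 ⟨i + 1, hi⟩
  · rw [modelG_of_eq α _ h, modelX_apply, modelG_of_eq α _ h, act_mul, act_mul,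
      HT_HY_HT K q μ _ _ (c.2.rank_succ_lt h), modelX_apply, ← h, rank_succ h]
  · have h' : (c.swap i hi).1 ⟨i, Nat.lt_of_succ_lt hi⟩ ≠ (c.swap i hi).1 ⟨i + 1, hi⟩ := by
      rw [Colouring.swap_apply, Colouring.swap_apply, sw_lo, sw_hi]; exact Ne.symm h
    rw [modelG_of_ne α _ h, modelX_apply, modelG_of_ne α _ h', Colouring.swap_swap,
      Colouring.rank_swap h, Colouring.swap_apply, sw_lo, modelX_apply]

theorem modelX_comm (i j : Fin n) : Commute (modelX α i) (modelX α j) :=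
  LinearMap.ext fun f => funext fun c => by
    simp only [Module.End.mul_apply, modelX_apply, act_mul]
    rw [(HY_comm K q μ _ _ _ _).eq]

theorem modelG_X_of_lt (i : ℕ) (hi : i + 1 < n) (j : Fin n) (hj : (j : ℕ) < i) :
    modelG α i hi * modelX α j = modelX α j * modelG α i hi := by
  refine LinearMap.ext fun f => funext fun c => ?_
  simp only [Module.End.mul_apply, modelX_apply]
  by_cases h : c.1 ⟨i, Nat.lt_of_succ_lt hi⟩ = c.1 ⟨i + 1, hi⟩
  · rw [modelG_of_eq α _ h, modelX_apply, modelG_of_eq α _ h, act_mul, act_mul,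
      (HT_HY_comm K q μ _ _ _ _ _).eq]
    intro h'
    have := rank_lt_rank (c := c.1) (i := j) (j := ⟨i, Nat.lt_of_succ_lt hi⟩) h'.symm hj
    omega
  · rw [modelG_of_ne α _ h, modelX_apply, modelG_of_ne α _ h, Colouring.rank_swap h,
      Colouring.swap_apply, sw_of_ne i hi j (by omega) (by omega)]

theorem modelX_Xinv (j : Fin n) : modelX α j * modelXinv α j = 1 :=
  LinearMap.ext fun f => funext fun c => by
    rw [Module.End.mul_apply, modelX_apply, modelXinv_apply, act_mul,
      HY_HYinv K q μ _ _ (c.2.rank_lt j), map_one]; rfl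

theorem modelXinv_X (j : Fin n) : modelXinv α j * modelX α j = 1 :=
  LinearMap.ext fun f => funext fun c => by
    rw [Module.End.mul_apply, modelXinv_apply, modelX_apply, act_mul,
      HYinv_HY K q μ _ _ (c.2.rank_lt j), map_one]; rfl

variable [IsAlgClosed K] (S : SimpleFamily K r)

variable (W) in
/-- The action of `t_{j+1}` on the model: it acts on the component of `c` by the scalar of
the colour of `j`. -/
def modelT (j : Fin n) : Module.End K (Colouring μ → W) where
  toFun f c := zeta S (c.1 j) • f c
  map_add' _ _ := funext fun _ => smul_add _ _ _
  map_smul' _ _ := funext fun _ => smul_comm _ _ _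

theorem modelT_apply (j : Fin n) (f : Colouring μ → W) (c : Colouring μ) :
    modelT W S j f c = zeta S (c.1 j) • f c := rfl

theorem modelT_pow_apply (j : Fin n) (s : ℕ) (f : Colouring μ → W) (c : Colouring μ) :
    (modelT W S j ^ s) f c = zeta S (c.1 j) ^ s • f c := by
  induction s with
  | zero => simp
  | succ s ih => rw [pow_succ', Module.End.mul_apply, modelT_apply, ih, pow_succ', mul_smul]

theorem modelG_T (i : ℕ) (hi : i + 1 < n) (j : Fin n) :
    modelG α i hi * modelT W S j = modelT W S (sw i hi j) * modelG α i hi := by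
  refine LinearMap.ext fun f => funext fun c => ?_
  simp only [Module.End.mul_apply, modelT_apply]
  by_cases h : c.1 ⟨i, Nat.lt_of_succ_lt hi⟩ = c.1 ⟨i + 1, hi⟩
  · rw [modelG_of_eq α _ h, modelG_of_eq α _ h, modelT_apply, map_smul,
      show c.1 (sw i hi j) = c.1 j from congrFun (comp_sw_eq c.1 i hi h) j]
  · rw [modelG_of_ne α _ h, modelG_of_ne α _ h, modelT_apply]; rfl

theorem modelT_sum_apply [NeZero r] [NeZero (r : K)] (i j : Fin n) (f : Colouring μ → W)
    (c : Colouring μ) :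
    ((r : K)⁻¹ • ∑ s ∈ Finset.range r, modelT W S i ^ s * modelT W S j ^ (r - s) :
      Module.End K (Colouring μ → W)) f c =
      if c.1 i = c.1 j then f c else 0 := by
  simp only [LinearMap.smul_apply, LinearMap.sum_apply, Pi.smul_apply, Finset.sum_apply,
    Module.End.mul_apply, modelT_pow_apply, smul_smul]
  rw [← Finset.sum_smul, smul_smul, zeta_sum]
  split_ifs <;> simp

theorem modelG_sq [NeZero r] [NeZero (r : K)] (i : ℕ) (hi : i + 1 < n) :
    modelG α i hi ^ 2 = 1 + qq q • (((r : K)⁻¹ • ∑ s ∈ Finset.range r,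
      modelT W S ⟨i, Nat.lt_of_succ_lt hi⟩ ^ s * modelT W S ⟨i + 1, hi⟩ ^ (r - s)) *
        modelG α i hi) := by
  refine LinearMap.ext fun f => funext fun c => ?_
  rw [pow_two, LinearMap.add_apply, LinearMap.smul_apply, Module.End.mul_apply,
    Module.End.mul_apply, Pi.add_apply, Pi.smul_apply, modelT_sum_apply, Module.End.one_apply]
  by_cases h : c.1 ⟨i, Nat.lt_of_succ_lt hi⟩ = c.1 ⟨i + 1, hi⟩
  · rw [if_pos h, modelG_of_eq α _ h, modelG_of_eq α _ h, act_mul,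
      HT_sq K q μ _ _ (c.2.rank_succ_lt h), map_add, map_one, map_smul]; rfl
  · have h' : (c.swap i hi).1 ⟨i, Nat.lt_of_succ_lt hi⟩ ≠ (c.swap i hi).1 ⟨i + 1, hi⟩ := by
      rw [Colouring.swap_apply, Colouring.swap_apply, sw_lo, sw_hi]; exact Ne.symm h
    rw [if_neg h, modelG_of_ne α _ h, modelG_of_ne α _ h', Colouring.swap_swap, smul_zero, add_zero]

/-- The images of the generators of the affine Yokonuma-Hecke algebra on the model. -/
def modelGen (hn : 0 < n) : YGen n → Module.End K (Colouring μ → W)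
  | YGen.t j => modelT W S j
  | YGen.g i hi => modelG α i hi
  | YGen.X => modelX α ⟨0, hn⟩
  | YGen.Xinv => modelXinv α ⟨0, hn⟩

variable [NeZero r] [NeZero (r : K)]

theorem modelGen_rel (hn : 0 < n) ⦃a b⦄ (h : YRel K r n q a b) :
    FreeAlgebra.lift K (modelGen α S hn) a = FreeAlgebra.lift K (modelGen α S hn) b := by
  induction h with
  | g_comm i j hi hj hij =>
    simp only [map_mul, FreeAlgebra.lift_ι_apply, modelGen]
    rcases hij with h | h
    · exact modelG_comm α hi hj h
    · exact (modelG_comm α hj hi h).symm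
  | braid i hi hi' =>
    simpa only [map_mul, FreeAlgebra.lift_ι_apply, modelGen] using modelG_braid α i hi hi'
  | t_comm i j =>
    simp only [map_mul, FreeAlgebra.lift_ι_apply, modelGen]
    exact LinearMap.ext fun f => funext fun c => smul_comm _ _ _
  | g_t i hi j =>
    simpa only [map_mul, FreeAlgebra.lift_ι_apply, modelGen] using modelG_T α S i hi j
  | t_pow j =>
    simp only [map_pow, map_one, FreeAlgebra.lift_ι_apply, modelGen]
    refine LinearMap.ext fun f => funext fun c => ?_
    rw [modelT_pow_apply, zeta_pow, one_smul]; rfl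
  | g_sq i hi =>
    simpa only [map_mul, map_pow, map_add, map_one, map_smul, fe, map_sum,
      FreeAlgebra.lift_ι_apply, modelGen, qq] using modelG_sq α S i hi
  | X_Xinv =>
    simpa only [map_mul, map_one, FreeAlgebra.lift_ι_apply, modelGen] using modelX_Xinv α _
  | Xinv_X =>
    simpa only [map_mul, map_one, FreeAlgebra.lift_ι_apply, modelGen] using modelXinv_X α _
  | gXgX h =>
    -- On the model `g_1 X_1 g_1` is the action of `X_2`, and the operators `X_j` commute.
    simp only [map_mul, FreeAlgebra.lift_ι_apply, modelGen]
    have h1 := modelG_X_G α 0 h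
    rw [h1, mul_assoc (modelX α _), mul_assoc (modelX α _), h1, (modelX_comm α _ _).eq]
  | g_X i hi hpos =>
    simpa only [map_mul, FreeAlgebra.lift_ι_apply, modelGen] using
      modelG_X_of_lt α i hi ⟨0, hn⟩ hpos
  | t_X j =>
    simp only [map_mul, FreeAlgebra.lift_ι_apply, modelGen]
    exact LinearMap.ext fun f => funext fun c => (map_smul (α _) (zeta S (c.1 j)) (f c)).symm

/-- The model of the induced module: for an `Hmu`-module `W`, the affine Yokonuma-Hecke algebra acts
on the sum of copies of `W` indexed by the colourings in which each `k` occurs `μ_k` times. -/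
def model (hn : 0 < n) : Y K r n q →ₐ[K] Module.End K (Colouring μ → W) :=
  RingQuot.liftAlgHom K ⟨FreeAlgebra.lift K (modelGen α S hn), modelGen_rel α S hn⟩

theorem model_ymk (hn : 0 < n) (x : FreeAlgebra K (YGen n)) :
    model α S hn (ymk x) = FreeAlgebra.lift K (modelGen α S hn) x :=
  RingQuot.liftAlgHom_mkAlgHom_apply K _ (modelGen_rel α S hn) x

theorem model_t (hn : 0 < n) (j : Fin n) : model α S hn (yt j) = modelT W S j := by
  rw [yt, model_ymk, FreeAlgebra.lift_ι_apply]; rfl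

theorem model_g (hn : 0 < n) (i : ℕ) (hi : i + 1 < n) :
    model α S hn (yg i hi) = modelG α i hi := by
  rw [yg, model_ymk, FreeAlgebra.lift_ι_apply]; rfl

theorem model_X (hn : 0 < n) (k : ℕ) (hk : k < n) :
    model α S hn (yXv k hk) = modelX α ⟨k, hk⟩ := by
  induction k with
  | zero =>
    change model α S hn (ymk (fX K n)) = _
    rw [model_ymk, FreeAlgebra.lift_ι_apply]; rfl
  | succ k ih =>
    change model α S hn (yg k hk * yXv k _ * yg k hk) = _
    rw [map_mul, map_mul, ih, model_g, modelG_X_G]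

theorem model_Xinv (hn : 0 < n) (k : ℕ) (hk : k < n) :
    model α S hn ((yX k hk)⁻¹ : (Y K r n q)ˣ).val = modelXinv α ⟨k, hk⟩ := by
  refine left_inv_eq_right_inv (a := modelX α ⟨k, hk⟩) ?_ (modelX_Xinv α _)
  rw [← model_X α S hn, ← map_mul, Units.inv_mul, map_one]

end Model

/-! ### The homomorphism from `Ymu` to the affine Hecke algebras -/

section TensorFactors

variable {K : Type u} [Field K] {r n : ℕ} {q : Kˣ} {μ : Comp r n}

theorem prod_ofFn_single {E : Type*} [Monoid E] {s : ℕ} (x : Fin s → E) (k : Fin s)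
    (h : ∀ l, l ≠ k → x l = 1) : (List.ofFn x).prod = x k := by
  induction s with
  | zero => exact k.elim0
  | succ s ih =>
    rw [List.ofFn_succ, List.prod_cons]
    refine Fin.cases (fun h => ?_) (fun k h => ?_) k h
    · rw [List.prod_eq_one, mul_one]
      intro y hy
      obtain ⟨i, rfl⟩ := List.mem_ofFn.mp hy
      exact h _ (Fin.succ_ne_zero i)
    · rw [h 0 (Fin.succ_ne_zero k).symm, one_mul]
      exact ih (fun i => x i.succ) k fun l hl => h _ fun e => hl (Fin.succ_injective _ e)

/-- The factors of the homomorphism `tensorLift f` are the `f k`. -/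
theorem tensorLift_single {E : Type u} [Ring E] [Algebra K E] {s : ℕ} {A : Fin s → Type u}
    [∀ k, Ring (A k)] [∀ k, Algebra K (A k)] (f : ∀ k, A k →ₐ[K] E)
    (hf : ∀ k l, k ≠ l → ∀ x y, Commute (f k x) (f l y)) (k : Fin s) (a : A k) :
    tensorLift f hf (PiTensorProduct.singleAlgHom k a) = f k a := by
  rw [PiTensorProduct.singleAlgHom_apply, tensorLift_tprod, prod_ofFn_single _ k]
  · simp
  · intro l hl
    simp [Pi.mulSingle_eq_of_ne hl]

/-- The algebra `Hmu` is generated by the images of its tensor factors. -/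
theorem mem_of_singleAlgHom_mem (B : Subalgebra K (Hmu K q μ))
    (h : ∀ k x, PiTensorProduct.singleAlgHom k x ∈ B) (x : Hmu K q μ) : x ∈ B := by
  let f : ∀ k, H K (μ.1 k) q →ₐ[K] Hmu K q μ := fun k =>
    PiTensorProduct.singleAlgHom (A := fun k => H K (μ.1 k) q) k
  have hf : ∀ k l, k ≠ l → ∀ x y, Commute (f k x) (f l y) := fun k l hkl x y =>
    commute_singleAlgHom μ hkl x y
  have h1 : tensorLift f hf = AlgHom.id K (Hmu K q μ) :=
    PiTensorProduct.algHom_ext fun k => AlgHom.ext fun a => tensorLift_single f hf k a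
  induction x using PiTensorProduct.induction_on with
  | smul_tprod c a =>
    refine B.smul_mem ?_ c
    rw [← AlgHom.id_apply (R := K) (PiTensorProduct.tprod K a), ← h1, tensorLift_tprod]
    refine B.list_prod_mem fun y hy => ?_
    obtain ⟨i, rfl⟩ := List.mem_ofFn.mp hy
    exact h _ _
  | add x y hx hy => exact B.add_mem hx hy

end TensorFactors

section TScalars

variable {K : Type u} [Field K] [IsAlgClosed K] {r n : ℕ} (S : SimpleFamily K r) {μ : Comp r n}

theorem Vrep_mulSingle (j : Fin n) : Vrep S μ (Pi.mulSingle j (Multiplicative.ofAdd 1)) =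
    zeta S (blk μ j) • LinearMap.id := by
  rw [Vrep_scalar, Finset.prod_eq_single j]
  · rw [Pi.mulSingle_eq_same]; rfl
  · intro l _ hl
    rw [Pi.mulSingle_eq_of_ne hl, scal_one]
  · simp

end TScalars

section Corner

variable {K : Type u} [Field K] [IsAlgClosed K] {r n : ℕ} [NeZero r] [NeZero (r : K)] {q : Kˣ}
  (S : SimpleFamily K r) {μ : Comp r n} (hn : 0 < n)

open Classical in
/-- The subalgebra `Ymu` preserves the component of the model attached to the colouring by the
blocks of `μ`, and it acts there through elements of `Hmu`. The element of `Hmu` is the same for all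
modules `W`. -/
theorem exists_corner (b : Y K r n q) (hb : b ∈ Ymu q μ) : ∃ x : Hmu K q μ,
    ∀ (W : Type u) [AddCommGroup W] [Module K W] (α : Hmu K q μ →ₐ[K] Module.End K W) (w : W),
      model α S hn b (Pi.single (Colouring.std μ) w) = Pi.single (Colouring.std μ) (α x w) := by
  induction hb using Algebra.adjoin_induction with
  | mem b hb =>
    rcases hb with ((⟨j, rfl⟩ | ⟨k, hk, rfl⟩) | ⟨k, hk, rfl⟩) | ⟨i, hi, hb, rfl⟩
    · refine ⟨zeta S (blk μ j) • 1, fun W _ _ α w => funext fun c => ?_⟩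
      rw [model_t, modelT_apply, map_smul, map_one]
      rcases eq_or_ne c (Colouring.std μ) with rfl | hc
      · simp [Colouring.std]
      · simp [Pi.single_eq_of_ne hc]
    · refine ⟨HY K q μ (blk μ ⟨k, hk⟩) (rank (blk μ) ⟨k, hk⟩), fun W _ _ α w => funext fun c => ?_⟩
      rw [model_X, modelX_apply]
      rcases eq_or_ne c (Colouring.std μ) with rfl | hc
      · simp [Colouring.std]
      · simp [Pi.single_eq_of_ne hc]
    · refine ⟨HYinv K q μ (blk μ ⟨k, hk⟩) (rank (blk μ) ⟨k, hk⟩),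
        fun W _ _ α w => funext fun c => ?_⟩
      rw [model_Xinv, modelXinv_apply]
      rcases eq_or_ne c (Colouring.std μ) with rfl | hc
      · simp [Colouring.std]
      · simp [Pi.single_eq_of_ne hc]
    · refine ⟨HT K q μ (blk μ ⟨i, Nat.lt_of_succ_lt hi⟩) (rank (blk μ) ⟨i, Nat.lt_of_succ_lt hi⟩),
        fun W _ _ α w => funext fun c => ?_⟩
      rw [model_g]
      rcases eq_or_ne c (Colouring.std μ) with rfl | hc
      · rw [modelG_of_eq α _ hb]
        simp [Colouring.std]
      · rw [Pi.single_eq_of_ne hc]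
        by_cases h : c.1 ⟨i, Nat.lt_of_succ_lt hi⟩ = c.1 ⟨i + 1, hi⟩
        · rw [modelG_of_eq α _ h, Pi.single_eq_of_ne hc, map_zero]
        · rw [modelG_of_ne α _ h, Pi.single_eq_of_ne]
          intro h'
          apply h
          have h1 : ∀ x, c.1 (sw i hi x) = blk μ x := fun x => congrFun (congrArg Subtype.val h') x
          have h2 := h1 ⟨i + 1, hi⟩
          have h3 := h1 ⟨i, Nat.lt_of_succ_lt hi⟩
          rw [sw_hi] at h2
          rw [sw_lo] at h3
          rw [h2, h3, hb]
  | algebraMap a =>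
    refine ⟨algebraMap K _ a, fun W _ _ α w => ?_⟩
    rw [AlgHom.commutes, AlgHom.commutes, Module.algebraMap_end_apply, Module.algebraMap_end_apply,
      Pi.single_smul]
  | add a b _ _ ha hb =>
    obtain ⟨x, hx⟩ := ha
    obtain ⟨y, hy⟩ := hb
    refine ⟨x + y, fun W _ _ α w => ?_⟩
    rw [map_add, LinearMap.add_apply, hx, hy, map_add, LinearMap.add_apply, Pi.single_add]
  | mul a b _ _ ha hb =>
    obtain ⟨x, hx⟩ := ha
    obtain ⟨y, hy⟩ := hb
    refine ⟨x * y, fun W _ _ α w => ?_⟩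
    rw [map_mul, Module.End.mul_apply, hy, hx, map_mul, Module.End.mul_apply]

open Classical in
/-- The element in `exists_corner` is unique, by its action on `1` in the regular module. -/
theorem corner_unique {b : Y K r n q} {x y : Hmu K q μ}
    (hx : ∀ (W : Type u) [AddCommGroup W] [Module K W] (α : Hmu K q μ →ₐ[K] Module.End K W) (w : W),
      model α S hn b (Pi.single (Colouring.std μ) w) = Pi.single (Colouring.std μ) (α x w))
    (hy : ∀ (W : Type u) [AddCommGroup W] [Module K W] (α : Hmu K q μ →ₐ[K] Module.End K W) (w : W),
      model α S hn b (Pi.single (Colouring.std μ) w) = Pi.single (Colouring.std μ) (α y w)) :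
    x = y := by
  have := (hx _ (Algebra.lmul K (Hmu K q μ)) 1).symm.trans (hy _ (Algebra.lmul K (Hmu K q μ)) 1)
  simpa using Pi.single_injective _ this

/-- The element of `Hmu` through which an element of `Ymu` acts on the component of the model
attached to the colouring by the blocks of `μ`. -/
def cornerFun (b : Ymu q μ) : Hmu K q μ := (exists_corner S hn b.1 b.2).choose

open Classical in
theorem cornerFun_spec (b : Ymu q μ) (W : Type u) [AddCommGroup W] [Module K W]
    (α : Hmu K q μ →ₐ[K] Module.End K W) (w : W) :
    model α S hn b.1 (Pi.single (Colouring.std μ) w) =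
      Pi.single (Colouring.std μ) (α (cornerFun S hn b) w) :=
  (exists_corner S hn b.1 b.2).choose_spec W α w

/-- The homomorphism `Ymu → Hmu` which sends `g_i` to `T_i`, `X_j` to `Y_j` and `t_j` to the scalar
by which it acts on `V(μ)`. -/
def corner : Ymu q μ →ₐ[K] Hmu K q μ where
  toFun := cornerFun S hn
  map_one' := corner_unique S hn (cornerFun_spec S hn 1) fun W _ _ α w => by simp
  map_zero' := corner_unique S hn (cornerFun_spec S hn 0) fun W _ _ α w => by simp
  map_mul' a b := corner_unique S hn (cornerFun_spec S hn (a * b)) fun W _ _ α w => by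
    rw [MulMemClass.coe_mul, map_mul, Module.End.mul_apply, cornerFun_spec, cornerFun_spec, map_mul,
      Module.End.mul_apply]
  map_add' a b := corner_unique S hn (cornerFun_spec S hn (a + b)) fun W _ _ α w => by
    rw [AddMemClass.coe_add, map_add, LinearMap.add_apply, cornerFun_spec, cornerFun_spec, map_add,
      LinearMap.add_apply, Pi.single_add]
  commutes' a := corner_unique S hn (cornerFun_spec S hn (algebraMap K _ a)) fun W _ _ α w => by
    rw [show ((algebraMap K (Ymu q μ) a : Ymu q μ) : Y K r n q) = algebraMap K _ a from rfl,
      AlgHom.commutes, AlgHom.commutes, Module.algebraMap_end_apply, Module.algebraMap_end_apply,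
      Pi.single_smul]

open Classical in
theorem corner_eq {b : Ymu q μ} {x : Hmu K q μ}
    (h : ∀ (W : Type u) [AddCommGroup W] [Module K W] (α : Hmu K q μ →ₐ[K] Module.End K W) (w : W),
      model α S hn b.1 (Pi.single (Colouring.std μ) w) (Colouring.std μ) = α x w) :
    corner S hn b = x := by
  have h1 := h _ (Algebra.lmul K (Hmu K q μ)) 1
  rw [cornerFun_spec] at h1
  change cornerFun S hn b = x
  simpa using h1

theorem corner_t (j : Fin n) (h : yt j ∈ Ymu q μ) :
    corner S hn ⟨yt j, h⟩ = zeta S (blk μ j) • 1 :=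
  corner_eq S hn fun W _ _ α w => by
    rw [model_t, modelT_apply]
    simp [Colouring.std]

theorem corner_X (k : ℕ) (hk : k < n) (h : yXv k hk ∈ Ymu q μ) :
    corner S hn ⟨yXv k hk, h⟩ = HY K q μ (blk μ ⟨k, hk⟩) (rank (blk μ) ⟨k, hk⟩) :=
  corner_eq S hn fun W _ _ α w => by
    rw [model_X, modelX_apply]
    simp [Colouring.std]

theorem corner_Xinv (k : ℕ) (hk : k < n) (h : ((yX k hk)⁻¹ : (Y K r n q)ˣ).val ∈ Ymu q μ) :
    corner S hn ⟨((yX k hk)⁻¹ : (Y K r n q)ˣ).val, h⟩ =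
      HYinv K q μ (blk μ ⟨k, hk⟩) (rank (blk μ) ⟨k, hk⟩) :=
  corner_eq S hn fun W _ _ α w => by
    rw [model_Xinv, modelXinv_apply]
    simp [Colouring.std]

theorem corner_g (i : ℕ) (hi : i + 1 < n)
    (hb : blk μ ⟨i, Nat.lt_of_succ_lt hi⟩ = blk μ ⟨i + 1, hi⟩) (h : yg i hi ∈ Ymu q μ) :
    corner S hn ⟨yg i hi, h⟩ = HT K q μ (blk μ ⟨i, Nat.lt_of_succ_lt hi⟩)
      (rank (blk μ) ⟨i, Nat.lt_of_succ_lt hi⟩) :=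
  corner_eq S hn fun W _ _ α w => by
    rw [model_g, modelG_of_eq α _ hb]
    simp [Colouring.std]

theorem corner_mg (k : Fin r) (a : ℕ) (ha : a + 1 < μ.1 k) :
    corner S hn (mg q μ k a ha) = PiTensorProduct.singleAlgHom k (hT a ha) :=
  (corner_g S hn _ _ (by rw [blk_place μ k a, blk_place_succ μ k a ha]) (mg q μ k a ha).2).trans (by
    rw [rank_blk, blk_place, HT, dif_pos ha])

theorem corner_mX (k : Fin r) (j : Fin (μ.1 k)) :
    corner S hn (mX q μ k j) = PiTensorProduct.singleAlgHom k (hY j) :=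
  (corner_X S hn _ _ (mX q μ k j).2).trans (by rw [rank_blk, blk_place, HY, dif_pos j.2])

theorem corner_mXinv (k : Fin r) (j : Fin (μ.1 k)) :
    corner S hn (mXinv q μ k j) = PiTensorProduct.singleAlgHom k (hYinv j) :=
  (corner_Xinv S hn _ _ (mXinv q μ k j).2).trans (by rw [rank_blk, blk_place, HYinv, dif_pos j.2])

theorem corner_surjective : Function.Surjective (corner S hn : Ymu q μ →ₐ[K] Hmu K q μ) := by
  intro x
  refine mem_of_singleAlgHom_mem (corner S hn).range (fun k x => ?_) x
  obtain ⟨x, rfl⟩ := hmk_surjective x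
  induction x using FreeAlgebra.induction with
  | grade0 c =>
    rw [AlgHom.commutes, AlgHom.commutes]
    exact Subalgebra.algebraMap_mem _ _
  | grade1 z =>
    cases z with
    | T i hi => exact ⟨_, corner_mg S hn k i hi⟩
    | Y j => exact ⟨_, corner_mX S hn k j⟩
    | Yinv j => exact ⟨_, corner_mXinv S hn k j⟩
  | mul a b ha hb => rw [map_mul, map_mul]; exact Subalgebra.mul_mem _ ha hb
  | add a b ha hb => rw [map_add, map_add]; exact Subalgebra.add_mem _ ha hb

variable (q μ) in
/-- The homomorphism `ρ_μ : Ymu → End(V(μ)) ⊗ Hmu`. As `V(μ)` is one-dimensional, `End(V(μ))`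
consists of scalars, which can be moved to the second factor: `ρ_μ(b) = 1 ⊗ corner b`. -/
def rho : Ymu q μ →ₐ[K] Module.End K (Vsp S μ) ⊗[K] Hmu K q μ :=
  Algebra.TensorProduct.includeRight.comp (corner S hn)

theorem rho_apply (b : Ymu q μ) : rho q S μ hn b = 1 ⊗ₜ corner S hn b := rfl

theorem isTensorAction_rho : IsTensorAction q μ S (rho q S μ hn) where
  t j := by
    rw [rho_apply, show corner S hn (mt q μ j) = _ from corner_t S hn j (mt q μ j).2,
      Vrep_mulSingle, TensorProduct.tmul_smul, TensorProduct.smul_tmul']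
    rfl
  g k a ha := by rw [rho_apply, corner_mg]
  X k j := by rw [rho_apply, corner_mX]
  Xinv k j := by rw [rho_apply, corner_mXinv]

theorem vAct_rho_tmul {W : Type u} [AddCommGroup W] [Module K W]
    (α : Hmu K q μ →ₐ[K] Module.End K W) (b : Ymu q μ) (v : Vsp S μ) (w : W) :
    vAct (rho q S μ hn) α b (v ⊗ₜ w) = v ⊗ₜ α (corner S hn b) w := by
  simp only [vAct, AlgHom.comp_apply, rho_apply]
  rw [Algebra.TensorProduct.map_tmul, Module.endTensorEndAlgHom_apply]
  simp

end Corner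

section OneDimensional

variable {K : Type u} [Field K] [IsAlgClosed K] {r n : ℕ}
  (S : SimpleFamily K r) (μ : Comp r n)

theorem exists_generator_Vsp :
    ∃ v : Vsp S μ, v ≠ 0 ∧ ∃ f : Vsp S μ →ₗ[K] K, ∀ x, x = f x • v := by
  let b := Module.basisUnique Unit (finrank_Vsp S μ)
  exact ⟨b (), b.ne_zero (), b.coord (), fun x => by
    conv_lhs => rw [← b.sum_repr x]
    simp⟩

/-- A vector which spans the line `V(μ)`. -/
def vgen : Vsp S μ := (exists_generator_Vsp S μ).choose

/-- The coordinate on the line `V(μ)` with respect to `vgen`. -/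
def vcoord : Vsp S μ →ₗ[K] K := (exists_generator_Vsp S μ).choose_spec.2.choose

theorem vcoord_smul_vgen (x : Vsp S μ) : vcoord S μ x • vgen S μ = x :=
  ((exists_generator_Vsp S μ).choose_spec.2.choose_spec x).symm

theorem vcoord_vgen : vcoord S μ (vgen S μ) = 1 := by
  have h : vgen S μ ≠ 0 := (exists_generator_Vsp S μ).choose_spec.1
  refine smul_left_injective K h ?_
  simp only [vcoord_smul_vgen, one_smul]

/-- As `V(μ)` is a line, all tensors are pure. -/
theorem exists_eq_vgen_tmul {W : Type u} [AddCommGroup W] [Module K W] (w : Vsp S μ ⊗[K] W) :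
    ∃ x, w = vgen S μ ⊗ₜ x := by
  induction w using TensorProduct.induction_on with
  | zero => exact ⟨0, by simp⟩
  | tmul v x =>
    exact ⟨vcoord S μ v • x, by rw [← TensorProduct.smul_tmul, vcoord_smul_vgen]⟩
  | add a b ha hb =>
    obtain ⟨x, rfl⟩ := ha
    obtain ⟨y, rfl⟩ := hb
    exact ⟨x + y, (TensorProduct.tmul_add _ _ _).symm⟩

theorem eq_zero_of_vgen_tmul {W : Type u} [AddCommGroup W] [Module K W] {x : W}
    (h : vgen S μ ⊗ₜ[K] x = 0) : x = 0 := by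
  have := congrArg ((TensorProduct.lid K W).toLinearMap ∘ₗ (vcoord S μ).rTensor W) h
  simpa [vcoord_vgen] using this

end OneDimensional

/-! ### Weight spaces of modules over the affine Yokonuma-Hecke algebra -/

section Generators

variable {K : Type u} [Field K] {r n : ℕ} {q : Kˣ} {μ : Comp r n}

theorem yX_mem_Ymu (k : ℕ) (hk : k < n) : (yXv k hk : Y K r n q) ∈ Ymu q μ :=
  Algebra.subset_adjoin (Or.inl (Or.inl (Or.inr ⟨k, hk, rfl⟩)))

theorem yXinv_mem_Ymu (k : ℕ) (hk : k < n) : ((yX k hk)⁻¹ : (Y K r n q)ˣ).val ∈ Ymu q μ :=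
  Algebra.subset_adjoin (Or.inl (Or.inr ⟨k, hk, rfl⟩))

theorem yg_mem_Ymu (i : ℕ) (hi : i + 1 < n)
    (h : blk μ ⟨i, Nat.lt_of_succ_lt hi⟩ = blk μ ⟨i + 1, hi⟩) : (yg i hi : Y K r n q) ∈ Ymu q μ :=
  Algebra.subset_adjoin (Or.inr ⟨i, hi, h, rfl⟩)

theorem ymk_surjective (a : Y K r n q) : ∃ b, ymk b = a :=
  RingQuot.mkAlgHom_surjective K (YRel K r n q) a

variable {N : Type u} [AddCommGroup N] [Module K N] [Module (Y K r n q) N]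
  [IsScalarTower K (Y K r n q) N]

/-- A product of elements with a common eigenvector acts on it by the product of the eigenvalues. -/
theorem list_prod_smul {m : ℕ} (a : Fin m → Y K r n q) (κ : Fin m → K) (x : N)
    (h : ∀ j, a j • x = κ j • x) : (List.ofFn a).prod • x = (∏ j, κ j) • x := by
  induction m with
  | zero => simp
  | succ m ih =>
    rw [List.ofFn_succ, List.prod_cons, Fin.prod_univ_succ, mul_smul,
      ih (fun j => a j.succ) (fun j => κ j.succ) fun j => h _, smul_algebra_smul_comm, h, smul_smul,
      mul_comm]

end Generators

section Weights

variable {K : Type u} [Field K] [IsAlgClosed K] {r n : ℕ} {q : Kˣ} (S : SimpleFamily K r)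
variable (q) (N : Type u) [AddCommGroup N] [Module K N] [Module (Y K r n q) N]
  [IsScalarTower K (Y K r n q) N]

/-- The weight space of a colouring `c`: the vectors on which each `t_j` acts by the scalar of the
colour of `j`. -/
def weightSpace (c : Fin n → Fin r) : Submodule K N where
  carrier := {x | ∀ j, (yt j : Y K r n q) • x = zeta S (c j) • x}
  zero_mem' j := by simp
  add_mem' hx hy j := by rw [smul_add, hx j, hy j, smul_add]
  smul_mem' a x hx j := by rw [smul_algebra_smul_comm, hx j, smul_comm]

variable {q N S}

theorem map_mem_weightSpace {N' : Type u} [AddCommGroup N'] [Module K N'] [Module (Y K r n q) N']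
    [IsScalarTower K (Y K r n q) N'] (f : N →ₗ[Y K r n q] N') {c : Fin n → Fin r} {x : N}
    (hx : x ∈ weightSpace q S N c) : f x ∈ weightSpace q S N' c := fun j => by
  rw [← map_smul, hx j, LinearMap.map_smul_of_tower]

theorem yt_pow_smul {c : Fin n → Fin r} {x : N} (hx : x ∈ weightSpace q S N c) (j : Fin n) (s : ℕ) :
    (yt j ^ s : Y K r n q) • x = zeta S (c j) ^ s • x := by
  induction s with
  | zero => simp
  | succ s ih => rw [pow_succ', mul_smul, ih, smul_algebra_smul_comm, hx j, smul_smul, pow_succ]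

theorem yg_smul_mem {c : Fin n → Fin r} {x : N} (hx : x ∈ weightSpace q S N c) (i : ℕ)
    (hi : i + 1 < n) : (yg i hi : Y K r n q) • x ∈ weightSpace q S N (c ∘ sw i hi) := fun j => by
  have h := yg_t (K := K) (r := r) (q := q) i hi (sw i hi j)
  rw [sw_sw] at h
  rw [smul_smul, ← h, mul_smul, hx, smul_algebra_smul_comm]
  rfl

theorem yX_smul_mem {c : Fin n → Fin r} {x : N} (hx : x ∈ weightSpace q S N c) (k : ℕ)
    (hk : k < n) : (yXv k hk : Y K r n q) • x ∈ weightSpace q S N c := fun j => by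
  rw [smul_smul, ← (yX_t k hk j).eq, mul_smul, hx, smul_algebra_smul_comm]

theorem yXinv_smul_mem {c : Fin n → Fin r} {x : N} (hx : x ∈ weightSpace q S N c) (k : ℕ)
    (hk : k < n) : ((yX k hk)⁻¹ : (Y K r n q)ˣ).val • x ∈ weightSpace q S N c := fun j => by
  rw [smul_smul, ← ((yX_t k hk j).units_inv_left).eq, mul_smul, hx, smul_algebra_smul_comm]

theorem aeval_yt_smul {c : Fin n → Fin r} {x : N} (hx : x ∈ weightSpace q S N c) (j : Fin n)
    (p : Polynomial K) :
    (Polynomial.aeval (yt j) p : Y K r n q) • x = p.eval (zeta S (c j)) • x := by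
  induction p using Polynomial.induction_on' with
  | add p p' hp hp' => rw [map_add, add_smul, hp, hp', Polynomial.eval_add, add_smul]
  | monomial s a =>
    rw [Polynomial.aeval_monomial, Polynomial.eval_monomial, mul_smul, yt_pow_smul hx, mul_smul,
      algebraMap_smul]

variable {μ : Comp r n}

theorem sortElt_smul_mem {c : Fin n → Fin r} (hc : HasContent μ c) {x : N}
    (hx : x ∈ weightSpace q S N (blk μ)) :
    (sortElt K q c).val • x ∈ weightSpace q S N c := fun j => by
  rw [smul_smul, yt_mul_sortElt, mul_smul, hx, smul_algebra_smul_comm, blk_sortPlace hc]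

theorem sortElt_inv_smul_mem {c : Fin n → Fin r} (hc : HasContent μ c) {x : N}
    (hx : x ∈ weightSpace q S N c) :
    (sortElt K q c)⁻¹.val • x ∈ weightSpace q S N (blk μ) := fun j => by
  obtain ⟨i, hi⟩ := exists_sortPlace_eq c j
  obtain rfl : (⟨sortPlace c i, sortPlace_lt c i⟩ : Fin n) = j := Fin.ext hi
  have h : (yt ⟨sortPlace c i, sortPlace_lt c i⟩ : Y K r n q) * (sortElt K q c)⁻¹.val =
      (sortElt K q c)⁻¹.val * yt i := by
    rw [Units.mul_inv_eq_iff_eq_mul, mul_assoc, yt_mul_sortElt, Units.inv_mul_cancel_left]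
  rw [smul_smul, h, mul_smul, hx, smul_algebra_smul_comm, blk_sortPlace hc]

variable [NeZero r] [NeZero (r : K)]

theorem ye_smul_of_ne {c : Fin n → Fin r} {x : N}
    (hx : x ∈ weightSpace q S N c) {i : ℕ} {hi : i + 1 < n}
    (h : c ⟨i, Nat.lt_of_succ_lt hi⟩ ≠ c ⟨i + 1, hi⟩) : (ye i hi : Y K r n q) • x = 0 := by
  have h1 := zeta_sum S (c ⟨i, Nat.lt_of_succ_lt hi⟩) (c ⟨i + 1, hi⟩)
  rw [if_neg h] at h1
  rw [ye_eq, smul_assoc, Finset.sum_smul]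
  rw [Finset.sum_congr rfl fun s _ => by
    rw [mul_smul, yt_pow_smul hx, smul_algebra_smul_comm, yt_pow_smul hx, smul_smul, mul_comm]]
  rw [← Finset.sum_smul, smul_smul, h1, zero_smul]

/-- On weight vectors whose colours at `i` and `i + 1` differ, `g_i` is an involution. -/
theorem yg_yg_smul {c : Fin n → Fin r} {x : N} (hx : x ∈ weightSpace q S N c) {i : ℕ}
    {hi : i + 1 < n} (h : c ⟨i, Nat.lt_of_succ_lt hi⟩ ≠ c ⟨i + 1, hi⟩) :
    (yg i hi : Y K r n q) • (yg i hi : Y K r n q) • x = x := by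
  rw [smul_smul, yg_sq, add_smul, one_smul, smul_assoc, mul_smul,
    ye_smul_of_ne (yg_smul_mem hx i hi), smul_zero, add_zero]
  simpa [sw_lo, sw_hi] using h.symm

/-- On weight vectors whose colours at `i` and `i + 1` differ, `g_i` exchanges `X_i` and `X_{i+1}`,
since `X_{i+1} = g_i X_i g_i` and `g_i` is an involution. -/
theorem yX_yg_smul {c : Fin n → Fin r} {x : N} (hx : x ∈ weightSpace q S N c) {i : ℕ}
    {hi : i + 1 < n} (h : c ⟨i, Nat.lt_of_succ_lt hi⟩ ≠ c ⟨i + 1, hi⟩) (k : Fin n) :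
    (yXv k k.2 : Y K r n q) • (yg i hi : Y K r n q) • x =
      (yg i hi : Y K r n q) • (yXv (sw i hi k) (sw i hi k).2 : Y K r n q) • x := by
  have hX : (yXv (i + 1) hi : Y K r n q) = yg i hi * yXv i (Nat.lt_of_succ_lt hi) * yg i hi := rfl
  by_cases h1 : (k : ℕ) = i
  · obtain rfl : k = ⟨i, Nat.lt_of_succ_lt hi⟩ := Fin.ext h1
    rw [sw_lo]
    simp only [hX, mul_smul]
    rw [yg_yg_smul (yX_smul_mem (yg_smul_mem hx i hi) i _)]
    simpa [sw_lo, sw_hi] using h.symm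
  by_cases h2 : (k : ℕ) = i + 1
  · obtain rfl : k = ⟨i + 1, hi⟩ := Fin.ext h2
    rw [sw_hi]
    simp only [hX, mul_smul]
    rw [yg_yg_smul hx h]
  rw [sw_of_ne i hi k h1 h2, smul_smul, smul_smul]
  rcases Nat.lt_or_ge k i with h3 | h3
  · rw [(yX_g_gt _ _ _ _ h3).eq]
  · rw [(yX_g_lt _ _ _ _ (by omega)).eq]

/-- If `c` has different colours at `i` and `i + 1`, then `g_i` exchanges the translates by the
sorting elements of `c` and of `c ∘ s_i`. -/
theorem yg_sortElt_smul {c : Fin n → Fin r} (hc : HasContent μ c) {x : N}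
    (hx : x ∈ weightSpace q S N (blk μ)) {i : ℕ} {hi : i + 1 < n}
    (h : c ⟨i, Nat.lt_of_succ_lt hi⟩ ≠ c ⟨i + 1, hi⟩) :
    (yg i hi : Y K r n q) • (sortElt K q c).val • x = (sortElt K q (c ∘ sw i hi)).val • x := by
  rcases lt_or_gt_of_ne h with h1 | h1
  · have hd : Descent (c ∘ sw i hi) i hi := by simpa [Descent, sw_lo, sw_hi] using h1
    rw [sortElt_of_descent _ i hi hd, comp_sw_sw, Units.val_mul, mul_smul]; rfl
  · rw [sortElt_of_descent c i hi h1, Units.val_mul, mul_smul]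
    refine yg_yg_smul (sortElt_smul_mem (hc.comp_sw i hi) hx) ?_
    simpa [sw_lo, sw_hi] using h.symm

/-- On vectors of standard weight, `X_k` moves through the sorting element, to the place of `k`
after sorting. -/
theorem yX_sortElt_smul {c : Fin n → Fin r} (hc : HasContent μ c) {x : N}
    (hx : x ∈ weightSpace q S N (blk μ)) (k : Fin n) :
    (yXv k k.2 : Y K r n q) • (sortElt K q c).val • x =
      (sortElt K q c).val • (yXv (sortPlace c k) (sortPlace_lt c k) : Y K r n q) • x := by
  induction c using colouring_induction generalizing k with
  | mono c hm => simp [sortElt_of_monotone hm, sortPlace_of_monotone hm]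
  | desc c i hi hd ih =>
    have h := ih _ hd.toLex_lt (hc.comp_sw i hi) (sw i hi k)
    simp only [sortPlace_comp_sw hd.ne, sw_sw] at h
    rw [sortElt_of_descent c i hi hd, Units.val_mul, mul_smul, mul_smul, ← h]
    refine yX_yg_smul (sortElt_smul_mem (hc.comp_sw i hi) hx) ?_ k
    simpa [sw_lo, sw_hi] using hd.ne.symm

theorem yXinv_sortElt_smul {c : Fin n → Fin r} (hc : HasContent μ c) {x : N}
    (hx : x ∈ weightSpace q S N (blk μ)) (k : Fin n) :
    ((yX k k.2)⁻¹ : (Y K r n q)ˣ).val • (sortElt K q c).val • x =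
      (sortElt K q c).val • ((yX (sortPlace c k) (sortPlace_lt c k))⁻¹ : (Y K r n q)ˣ).val • x := by
  have h := yX_sortElt_smul hc (yXinv_smul_mem hx (sortPlace c k) (sortPlace_lt c k)) k
  have h' : (yXv (sortPlace c k) (sortPlace_lt c k) : Y K r n q) •
      ((yX (sortPlace c k) (sortPlace_lt c k))⁻¹ : (Y K r n q)ˣ).val • x = x := by
    rw [smul_smul, Units.mul_inv, one_smul]
  rw [h'] at h
  rw [← h, smul_smul, Units.inv_mul, one_smul]

end Weights

section Projections

variable {K : Type u} [Field K] [IsAlgClosed K] {r n : ℕ} {q : Kˣ} (S : SimpleFamily K r)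

/-- The element of the affine Yokonuma-Hecke algebra which projects onto the eigenspace of `t_j`
attached to the colour `k`. -/
def eigenProj (j : Fin n) (k : Fin r) : Y K r n q :=
  Polynomial.aeval (yt j) (Lagrange.basis Finset.univ (zeta S) k)

theorem commute_eigenProj {a : Y K r n q} {j : Fin n} (h : Commute a (yt j)) (k : Fin r) :
    Commute a (eigenProj S j k) := by
  unfold eigenProj
  induction Lagrange.basis Finset.univ (zeta S) k using Polynomial.induction_on' with
  | add p p' hp hp' => rw [map_add]; exact hp.add_right hp'
  | monomial s c =>
    rw [Polynomial.aeval_monomial]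
    exact (Algebra.commute_algebraMap_right c a).mul_right (h.pow_right s)

variable [NeZero r]

open Polynomial in
/-- The scalars `zeta S k` are all roots of `X ^ r - 1`. -/
theorem nodal_zeta : Lagrange.nodal Finset.univ (zeta S) = X ^ r - 1 := by
  have hr : 0 < r := NeZero.pos r
  have hdeg : (X ^ r - 1 : K[X]).degree = r := by
    simpa using degree_X_pow_sub_C hr (1 : K)
  refine Polynomial.eq_of_degree_sub_lt_of_eval_index_eq (s := Finset.univ) (v := zeta S)
    (zeta_injective S).injOn ?_ fun i hi => ?_
  · have h1 : (Lagrange.nodal Finset.univ (zeta S)).degree = r := by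
      rw [Lagrange.degree_nodal]; simp
    have h2 := degree_sub_lt_left (h1.trans hdeg.symm) Lagrange.nodal_ne_zero (by
      rw [Lagrange.nodal_monic.leadingCoeff]
      have := (monic_X_pow_sub_C (1 : K) hr.ne').leadingCoeff
      rw [map_one] at this
      rw [this])
    rw [h1] at h2
    simpa using h2
  · rw [Lagrange.eval_nodal_at_node hi]
    simp [zeta_pow]

theorem sum_eigenProj (j : Fin n) : ∑ k, eigenProj S j k = (1 : Y K r n q) := by
  unfold eigenProj
  rw [← map_sum, Lagrange.sum_basis (zeta_injective S).injOn Finset.univ_nonempty, map_one]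

open Polynomial in
theorem yt_mul_eigenProj (j : Fin n) (k : Fin r) :
    yt j * eigenProj S j k = zeta S k • (eigenProj S j k : Y K r n q) := by
  have h0 : (Polynomial.X - C (zeta S k)) * Lagrange.basis Finset.univ (zeta S) k =
      C (Lagrange.nodalWeight Finset.univ (zeta S) k) * (Polynomial.X ^ r - 1) := by
    rw [Lagrange.basis_eq_prod_sub_inv_mul_nodal_div (Finset.mem_univ k), mul_left_comm,
      ← nodal_zeta S, Lagrange.nodal_eq_mul_nodal_erase (Finset.mem_univ k),
      mul_div_cancel_left₀ _ (X_sub_C_ne_zero _)]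
  have h := congrArg (aeval (yt j : Y K r n q)) h0
  simp only [map_mul, map_sub, aeval_X, aeval_C, map_pow, map_one, yt_pow, sub_self, mul_zero,
    sub_mul, ← Algebra.smul_def] at h
  exact sub_eq_zero.mp h

variable {N : Type u} [AddCommGroup N] [Module K N] [Module (Y K r n q) N]
  [IsScalarTower K (Y K r n q) N]

theorem eigenProj_smul {c : Fin n → Fin r} {x : N} (hx : x ∈ weightSpace q S N c) (j : Fin n)
    (k : Fin r) : (eigenProj S j k : Y K r n q) • x = (if c j = k then 1 else 0 : K) • x := by
  rw [eigenProj, aeval_yt_smul hx]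
  split_ifs with h
  · rw [h, Lagrange.eval_basis_self (zeta_injective S).injOn (Finset.mem_univ _)]
  · rw [Lagrange.eval_basis_of_ne (Ne.symm h) (Finset.mem_univ _)]

/-- The element of the affine Yokonuma-Hecke algebra which projects onto the weight space of `b`. -/
def weightProj (b : Fin n → Fin r) : Y K r n q := (List.ofFn fun j => eigenProj S j (b j)).prod

theorem weightProj_smul (b : Fin n → Fin r) {c : Fin n → Fin r} {x : N}
    (hx : x ∈ weightSpace q S N c) :
    (weightProj S b : Y K r n q) • x = if c = b then x else 0 := by
  rw [weightProj, list_prod_smul _ _ x fun j => eigenProj_smul S hx j (b j)]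
  split_ifs with h
  · simp [h]
  · obtain ⟨j, hj⟩ := Function.ne_iff.mp h
    rw [Finset.prod_eq_zero (Finset.mem_univ j) (if_neg hj), zero_smul]

/-- Each module is spanned by weight vectors: the `t_j` commute, and each of them is diagonalizable
because `X ^ r - 1` is the product of the distinct factors `X - zeta S k`. -/
theorem span_weightSpace (x : N) :
    x ∈ Submodule.span K {y | ∃ c : Fin n → Fin r, y ∈ weightSpace q S N c} := by
  -- Induction on the number `m` of elements `t_j` which act by scalars on the spanning vectors.
  have key : ∀ m ≤ n, ∀ x : N, x ∈ Submodule.span K {y | ∃ c : Fin n → Fin r,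
      ∀ j : Fin n, (j : ℕ) < m → (yt j : Y K r n q) • y = zeta S (c j) • y} := by
    intro m
    induction m with
    | zero =>
      intro _ x
      exact Submodule.subset_span ⟨fun _ => 0, fun j hj => absurd hj (Nat.not_lt_zero _)⟩
    | succ m ih =>
      intro hm x
      have hx := ih (by omega) x
      induction hx using Submodule.span_induction with
      | zero => exact Submodule.zero_mem _
      | add x y _ _ hx hy => exact Submodule.add_mem _ hx hy
      | smul a x _ hx => exact Submodule.smul_mem _ a hx
      | mem y hy =>
        obtain ⟨c, hc⟩ := hy
        rw [← one_smul (Y K r n q) y, ← sum_eigenProj S ⟨m, hm⟩, Finset.sum_smul]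
        refine Submodule.sum_mem _ fun k _ => Submodule.subset_span
          ⟨Function.update c ⟨m, hm⟩ k, fun j hj => ?_⟩
        by_cases hjm : j = ⟨m, hm⟩
        · subst hjm
          rw [smul_smul, yt_mul_eigenProj, smul_assoc, Function.update_self]
        · have hj' : (j : ℕ) < m := by
            have : (j : ℕ) ≠ m := fun e => hjm (Fin.ext e)
            omega
          rw [Function.update_of_ne hjm, smul_smul, (commute_eigenProj S (yt_comm j ⟨m, hm⟩) k).eq,
            mul_smul, hc j hj', smul_algebra_smul_comm]
  refine Submodule.span_mono ?_ (key n le_rfl x)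
  rintro y ⟨c, hc⟩
  exact ⟨c, fun j => hc j j.2⟩

end Projections

instance instFintypeComp (r n : ℕ) : Fintype (Comp r n) := Fintype.ofFinite _

instance instFintypeColouring {r n : ℕ} (μ : Comp r n) : Fintype (Colouring μ) := Fintype.ofFinite _

section Spanning

variable {K : Type u} [Field K] [IsAlgClosed K] {r n : ℕ} [NeZero r] [NeZero (r : K)] {q : Kˣ}
  {S : SimpleFamily K r} {N : Type u} [AddCommGroup N] [Module K N] [Module (Y K r n q) N]
  [IsScalarTower K (Y K r n q) N] {μ : Comp r n}

/-- If `U` is a `Ymu`-stable subspace of the weight space of the colouring by blocks, then the sum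
of its translates by the sorting elements is stable under the affine Yokonuma-Hecke algebra. -/
theorem exists_sortElt_sum (hn : 0 < n) {U : Submodule K N} (hU : U ≤ weightSpace q S N (blk μ))
    (hstab : ∀ b ∈ Ymu q μ, ∀ x ∈ U, b • x ∈ U) (a : Y K r n q) {x : N} (hx : x ∈ U) :
    ∃ u : Colouring μ → N, (∀ c, u c ∈ U) ∧ a • x = ∑ c, (sortElt K q c.1).val • u c := by
  classical
  let R : Submodule K N := Submodule.span K
    {z | ∃ (c : Colouring μ) (u : N), u ∈ U ∧ z = (sortElt K q c.1).val • u}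
  have hgen : ∀ (c : Colouring μ) (u : N), u ∈ U → (sortElt K q c.1).val • u ∈ R :=
    fun c u hu => Submodule.subset_span ⟨c, u, hu, rfl⟩
  -- If `i` and `i + 1` have the same colour then `g_i d_c = d_c g_j` with `g_j ∈ Ymu`; otherwise
  -- `g_i d_c` acts as the sorting element of `c ∘ s_i`.
  have hg : ∀ (i : ℕ) (hi : i + 1 < n) (c : Colouring μ) (u : N), u ∈ U →
      (yg i hi : Y K r n q) • (sortElt K q c.1).val • u ∈ R := by
    intro i hi c u hu
    by_cases h : c.1 ⟨i, Nat.lt_of_succ_lt hi⟩ = c.1 ⟨i + 1, hi⟩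
    · have hlt : sortPlace c.1 ⟨i, Nat.lt_of_succ_lt hi⟩ + 1 < n := by
        rw [← sortPlace_succ h]; exact sortPlace_lt _ _
      have h1 := congrArg Units.val (ygU_mul_sortElt (K := K) (q := q) c.1 i hi h _ hlt rfl)
      have h2 : blk μ ⟨sortPlace c.1 ⟨i, Nat.lt_of_succ_lt hi⟩, Nat.lt_of_succ_lt hlt⟩ =
          blk μ ⟨sortPlace c.1 ⟨i, Nat.lt_of_succ_lt hi⟩ + 1, hlt⟩ := by
        have h3 := blk_sortPlace c.2 ⟨i + 1, hi⟩
        simp only [sortPlace_succ h] at h3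
        rw [h3, blk_sortPlace c.2, h]
      change (yg i hi * (sortElt K q c.1).val : Y K r n q) =
        (sortElt K q c.1).val * yg _ hlt at h1
      rw [smul_smul, h1, mul_smul]
      exact hgen c _ (hstab _ (yg_mem_Ymu _ _ h2) _ hu)
    · rw [yg_sortElt_smul c.2 (hU hu) h]
      exact hgen (c.swap i hi) u hu
  have hstable : ∀ (a : Y K r n q) (z : N), z ∈ R → a • z ∈ R := by
    intro a
    obtain ⟨a, rfl⟩ := ymk_surjective a
    induction a using FreeAlgebra.induction with
    | grade0 c =>
      intro z hz
      rw [AlgHom.commutes, algebraMap_smul]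
      exact R.smul_mem c hz
    | mul a b ha hb => intro z hz; rw [map_mul, mul_smul]; exact ha _ (hb _ hz)
    | add a b ha hb => intro z hz; rw [map_add, add_smul]; exact R.add_mem (ha _ hz) (hb _ hz)
    | grade1 y =>
      intro z hz
      induction hz using Submodule.span_induction with
      | zero => rw [smul_zero]; exact R.zero_mem
      | add x y _ _ hx hy => rw [smul_add]; exact R.add_mem hx hy
      | smul a x _ hx => rw [smul_algebra_smul_comm]; exact R.smul_mem a hx
      | mem z hz =>
        obtain ⟨c, u, hu, rfl⟩ := hz
        cases y with
        | t j =>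
          have := sortElt_smul_mem c.2 (hU hu) j
          change (yt j : Y K r n q) • _ ∈ R
          rw [this]
          exact R.smul_mem _ (hgen c u hu)
        | g i hi => exact hg i hi c u hu
        | X =>
          have := yX_sortElt_smul c.2 (hU hu) ⟨0, hn⟩
          change (yXv 0 hn : Y K r n q) • _ ∈ R
          rw [this]
          exact hgen c _ (hstab _ (yX_mem_Ymu _ _) _ hu)
        | Xinv =>
          have := yXinv_sortElt_smul c.2 (hU hu) ⟨0, hn⟩
          change ((yX 0 hn)⁻¹ : (Y K r n q)ˣ).val • _ ∈ R
          rw [this]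
          exact hgen c _ (hstab _ (yXinv_mem_Ymu _ _) _ hu)
  have hx' : x ∈ R := by
    have := hgen (Colouring.std μ) x hx
    rwa [Colouring.std, sortElt_of_monotone (blk_monotone μ), Units.val_one, one_smul] at this
  have hax := hstable a x hx'
  generalize a • x = z at hax ⊢
  induction hax using Submodule.span_induction with
  | zero => exact ⟨fun _ => 0, fun _ => U.zero_mem, by simp⟩
  | add y z _ _ hy hz =>
    obtain ⟨u, hu, rfl⟩ := hy
    obtain ⟨v, hv, rfl⟩ := hz
    exact ⟨fun c => u c + v c, fun c => U.add_mem (hu c) (hv c), by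
      simp only [smul_add, Finset.sum_add_distrib]⟩
  | smul b y _ hy =>
    obtain ⟨u, hu, rfl⟩ := hy
    exact ⟨fun c => b • u c, fun c => U.smul_mem b (hu c), by
      simp only [smul_algebra_smul_comm, Finset.smul_sum]⟩
  | mem z hz =>
    obtain ⟨c, u, hu, rfl⟩ := hz
    refine ⟨Pi.single c u, fun c' => ?_, ?_⟩
    · rcases eq_or_ne c' c with rfl | h
      · rwa [Pi.single_eq_same]
      · rw [Pi.single_eq_of_ne h]; exact U.zero_mem
    · rw [Finset.sum_eq_single c, Pi.single_eq_same]
      · intro c' _ h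
        rw [Pi.single_eq_of_ne h, smul_zero]
      · intro h; exact absurd (Finset.mem_univ c) h

end Spanning

/-! ### Induced modules -/

section InducedModules

variable {K : Type u} [Field K] {A : Type u} [Ring A] [Algebra K A] {B : Subalgebra K A}
variable {W : Type u} [AddCommGroup W] [Module K W] {θ : B →ₐ[K] Module.End K W}

instance instKModuleInd : Module K (Ind B θ) :=
  inferInstanceAs (Module K ((A ⊗[K] W) ⧸ indRel B θ))

instance instIsScalarTowerInd : IsScalarTower K A (Ind B θ) :=
  inferInstanceAs (IsScalarTower K A ((A ⊗[K] W) ⧸ indRel B θ))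

theorem smul_indMk (a b : A) (w : W) : a • indMk B θ b w = indMk B θ (a * b) w := rfl

theorem indMk_mul (a : A) (b : B) (w : W) : indMk B θ (a * b) w = indMk B θ a (θ b w) :=
  (Submodule.Quotient.eq _).mpr (Submodule.subset_span ⟨a, b, w, rfl⟩)

theorem indMk_eq_smul (a : A) (w : W) : indMk B θ a w = a • indMk B θ 1 w := by
  rw [smul_indMk, mul_one]

variable (B θ) in
/-- The canonical map from a `B`-module to the module induced from it. -/
def indOne : W →ₗ[K] Ind B θ where
  toFun w := indMk B θ 1 w
  map_add' _ _ := congrArg Submodule.Quotient.mk (TensorProduct.tmul_add _ _ _)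
  map_smul' _ _ := congrArg Submodule.Quotient.mk (TensorProduct.tmul_smul _ _ _)

theorem smul_indOne (b : B) (w : W) : (b : A) • indOne B θ w = indOne B θ (θ b w) := by
  change (b : A) • indMk B θ 1 w = indMk B θ 1 (θ b w)
  rw [← indMk_mul, smul_indMk, one_mul, mul_one]

theorem span_indOne (z : Ind B θ) : z ∈ Submodule.span A (Set.range (indOne B θ)) := by
  obtain ⟨x, rfl⟩ := Submodule.Quotient.mk_surjective (indRel B θ) z
  induction x using TensorProduct.induction_on with
  | zero => exact Submodule.zero_mem _
  | add x y hx hy => exact Submodule.add_mem _ hx hy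
  | tmul a w =>
    change indMk B θ a w ∈ _
    rw [indMk_eq_smul]
    exact Submodule.smul_mem _ a (Submodule.subset_span ⟨w, rfl⟩)

variable {Z : Type u} [AddCommGroup Z] [Module K Z] [Module A Z] [IsScalarTower K A Z]

/-- Frobenius reciprocity: a `B`-homomorphism `W → Z` extends to the induced module. -/
def indLift (L : W →ₗ[K] Z) (hL : ∀ (b : B) w, L (θ b w) = (b : A) • L w) : Ind B θ →ₗ[A] Z :=
  Submodule.liftQ (indRel B θ)
    (TensorProduct.AlgebraTensorModule.lift (LinearMap.toSpanSingleton A (W →ₗ[K] Z) L)) (by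
      rw [indRel, Submodule.span_le]
      rintro _ ⟨a, b, w, rfl⟩
      simp [hL, mul_smul])

end InducedModules

section InducedWeights

variable {K : Type u} [Field K] [IsAlgClosed K] {r n : ℕ} [NeZero r] [NeZero (r : K)] {q : Kˣ}
  (S : SimpleFamily K r) {μ : Comp r n} (hn : 0 < n)
  {W : Type u} [AddCommGroup W] [Module K W] (α : Hmu K q μ →ₐ[K] Module.End K W)

variable (W) in
/-- The operators `1 ⊗ f` on `V(μ) ⊗ W`. -/
def idTensor : Module.End K W →ₐ[K] Module.End K (Vsp S μ ⊗[K] W) :=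
  Module.End.lTensorAlgHom K W (Vsp S μ)

theorem vAct_rho (b : Ymu q μ) :
    vAct (rho q S μ hn) α b = idTensor S W (α (corner S hn b)) :=
  TensorProduct.ext' fun v w => vAct_rho_tmul S hn α b v w

theorem indOne_mem_weightSpace (w : Vsp S μ ⊗[K] W) :
    indOne (Ymu q μ) (vAct (rho q S μ hn) α) w ∈ weightSpace q S _ (blk μ) := fun j => by
  have h := smul_indOne (θ := vAct (rho q S μ hn) α) (mt q μ j) w
  rw [vAct_rho, show corner S hn (mt q μ j) = _ from corner_t S hn j _, map_smul, map_smul,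
    map_one, map_one, LinearMap.smul_apply, map_smul] at h
  exact h

/-- Each element of the induced module is a sum of elements `d_c ⊗ w_c`, where `d_c` is the sorting
element of the colouring `c`. -/
theorem exists_indOne_sum (z : Ind (Ymu q μ) (vAct (rho q S μ hn) α)) :
    ∃ w : Colouring μ → Vsp S μ ⊗[K] W, z = ∑ c, (sortElt K q c.1).val • indOne _ _ (w c) := by
  have hz := span_indOne z
  induction hz using Submodule.span_induction with
  | zero => exact ⟨0, by simp⟩
  | add x y _ _ hx hy =>
    obtain ⟨w, rfl⟩ := hx
    obtain ⟨w', rfl⟩ := hy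
    exact ⟨w + w', by simp [Finset.sum_add_distrib]⟩
  | mem z hz =>
    classical
    obtain ⟨w, rfl⟩ := hz
    refine ⟨Pi.single (Colouring.std μ) w, ?_⟩
    rw [Finset.sum_eq_single (Colouring.std μ), Pi.single_eq_same, Colouring.std,
      sortElt_of_monotone (blk_monotone μ), Units.val_one, one_smul]
    · intro c' _ h
      rw [Pi.single_eq_of_ne h, map_zero, smul_zero]
    · intro h; exact absurd (Finset.mem_univ _) h
  | smul a x _ hx =>
    obtain ⟨w, rfl⟩ := hx
    let U := LinearMap.range (indOne (Ymu q μ) (vAct (rho q S μ hn) α))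
    have hU : U ≤ weightSpace q S _ (blk μ) := by
      rintro _ ⟨w, rfl⟩
      exact indOne_mem_weightSpace S hn α w
    have hstab : ∀ b ∈ Ymu q μ, ∀ x ∈ U, b • x ∈ U := by
      rintro b hb _ ⟨w, rfl⟩
      exact ⟨_, (smul_indOne ⟨b, hb⟩ w).symm⟩
    have key : ∀ c : Colouring μ, ∃ v : Colouring μ → Vsp S μ ⊗[K] W,
        (a * (sortElt K q c.1).val) • indOne (Ymu q μ) (vAct (rho q S μ hn) α) (w c) =
          ∑ c', (sortElt K q c'.1).val • indOne _ _ (v c') := by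
      intro c
      obtain ⟨u, hu, h⟩ := exists_sortElt_sum hn hU hstab (a * (sortElt K q c.1).val) ⟨w c, rfl⟩
      choose v hv using hu
      exact ⟨v, by rw [h]; simp only [hv]⟩
    choose v hv using key
    refine ⟨fun c' => ∑ c, v c c', ?_⟩
    simp only [map_sum, Finset.smul_sum, smul_smul, hv]
    exact Finset.sum_comm

/-- The canonical map from `V(μ) ⊗ W` to the induced module is injective: the composition with the
homomorphism from the induced module to the model is the inclusion of a component. -/
theorem indOne_injective :
    Function.Injective (indOne (Ymu q μ) (vAct (rho q S μ hn) α)) := by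
  classical
  rw [← LinearMap.ker_eq_bot, LinearMap.ker_eq_bot']
  intro w hw
  let α' : Hmu K q μ →ₐ[K] Module.End K (Vsp S μ ⊗[K] W) := (idTensor S W).comp α
  let f : Y K r n q ⊗[K] (Vsp S μ ⊗[K] W) →ₗ[K] (Colouring μ → Vsp S μ ⊗[K] W) :=
    TensorProduct.lift (LinearMap.mk₂ K
      (fun a w => model α' S hn a (Pi.single (Colouring.std μ) w))
      (fun _ _ _ => by rw [map_add]; rfl) (fun _ _ _ => by rw [map_smul]; rfl)
      (fun _ _ _ => by rw [Pi.single_add, map_add])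
      (fun _ _ _ => by rw [Pi.single_smul, map_smul]))
  have hf : ∀ a w, f (a ⊗ₜ w) = model α' S hn a (Pi.single (Colouring.std μ) w) := fun _ _ => rfl
  have hsmul : ∀ (a : Y K r n q) x, f (a • x) = model α' S hn a (f x) := by
    intro a x
    induction x using TensorProduct.induction_on with
    | zero => simp
    | add x y hx hy => rw [smul_add, map_add, hx, hy, map_add, map_add]
    | tmul b w => rw [TensorProduct.smul_tmul', hf, hf, smul_eq_mul, map_mul, Module.End.mul_apply]
  have hrel : ∀ x ∈ indRel (Ymu q μ) (vAct (rho q S μ hn) α), f x = 0 := by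
    intro x hx
    induction hx using Submodule.span_induction with
    | zero => exact map_zero f
    | add x y _ _ hx hy => rw [map_add, hx, hy, add_zero]
    | smul a x _ hx => rw [hsmul, hx, map_zero]
    | mem x hx =>
      obtain ⟨a, b, w, rfl⟩ := hx
      rw [map_sub, hf, hf, map_mul, Module.End.mul_apply, cornerFun_spec, sub_eq_zero, vAct_rho]
      rfl
  have h1 : f (1 ⊗ₜ w) = 0 := hrel _ ((Submodule.Quotient.mk_eq_zero _).mp hw)
  rw [hf, map_one, Module.End.one_apply] at h1
  simpa using h1

theorem finite_ind [Module.Finite K W] :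
    Module.Finite K (Ind (Ymu q μ) (vAct (rho q S μ hn) α)) := by
  have hfin : ∀ k, Module.Finite K (S.V k) := S.finite
  have hV : Module.Finite K (Vsp S μ) := inferInstance
  let f : (Colouring μ → Vsp S μ ⊗[K] W) →ₗ[K] Ind (Ymu q μ) (vAct (rho q S μ hn) α) :=
    ∑ c, (Algebra.lsmul K K _ (sortElt K q c.1).val ∘ₗ indOne _ _) ∘ₗ LinearMap.proj c
  refine Module.Finite.of_surjective f fun z => ?_
  obtain ⟨w, rfl⟩ := exists_indOne_sum S hn α z
  exact ⟨w, by simp [f]⟩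

end InducedWeights

/-! ### Weight spaces as spaces of homomorphisms -/

section HomSpaces

variable {K : Type u} [Field K] [IsAlgClosed K] {r n : ℕ} [NeZero r] {q : Kˣ}
  (S : SimpleFamily K r) {μ : Comp r n} {N : Type u} [AddCommGroup N] [Module K N]
  [Module (Y K r n q) N] [IsScalarTower K (Y K r n q) N]

theorem ev_mem_weightSpace (φ : HomMu q S μ N) (v : Vsp S μ) :
    ev φ v ∈ weightSpace q S N (blk μ) := fun j => by
  have h := ev_T φ (Pi.mulSingle j (Multiplicative.ofAdd 1)) v
  have h1 := tHomOne_pow (K := K) (q := q) (r := r) j 1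
  rw [Vrep_mulSingle, tHom_single] at h
  simp only [Nat.cast_one, Int.cast_one, pow_one] at h1
  rw [h1, LinearMap.smul_apply, map_smul] at h
  exact h.symm

/-- A weight vector for the colouring by blocks defines a homomorphism from `V(μ)`. -/
def homOfWeight {x : N} (hx : x ∈ weightSpace q S N (blk μ)) : HomMu q S μ N :=
  mkHom ((vcoord S μ).smulRight x) fun h v => by
    -- Equivariance for the generators of `T` suffices.
    let M : Submonoid (T r n) :=
      { carrier := {h | ∀ v, (vcoord S μ).smulRight x (Vrep S μ h v) =
          (tHom h : Y K r n q) • (vcoord S μ).smulRight x v}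
        one_mem' := fun v => by rw [map_one, map_one, one_smul]; rfl
        mul_mem' := fun {g h} hg hh v => by
          rw [map_mul, Module.End.mul_apply, hg, hh, smul_smul, ← map_mul] }
    have key : ∀ j, (Pi.mulSingle j (Multiplicative.ofAdd 1) : T r n) ∈ M := by
      intro j v
      have h1 := tHomOne_pow (K := K) (q := q) (r := r) j 1
      simp only [Nat.cast_one, Int.cast_one, pow_one] at h1
      rw [Vrep_mulSingle, tHom_single, h1, LinearMap.smulRight_apply, LinearMap.smulRight_apply,
        smul_algebra_smul_comm, hx j, LinearMap.smul_apply, map_smul, smul_smul, smul_eq_mul,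
        mul_comm]
      rfl
    have hM : h ∈ M := by
      refine Submonoid.pi_mem_of_mulSingle_mem h fun j => ?_
      obtain ⟨s, hs⟩ := exists_eq_ofAdd (h j)
      have h2 : h j = (Multiplicative.ofAdd (1 : ZMod r)) ^ s := by
        rw [hs, ← ofAdd_nsmul]; simp
      rw [h2, Pi.mulSingle_pow]
      exact M.pow_mem (key j) s
    exact hM v

theorem ev_homOfWeight {x : N} (hx : x ∈ weightSpace q S N (blk μ)) (v : Vsp S μ) :
    ev (homOfWeight S hx) v = vcoord S μ v • x := rfl

theorem ev_ext_vgen {φ ψ : HomMu q S μ N} (h : ev φ (vgen S μ) = ev ψ (vgen S μ)) : φ = ψ :=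
  ev_ext fun v => by rw [← vcoord_smul_vgen S μ v, map_smul, map_smul, h]

end HomSpaces

section Evaluation

variable {K : Type u} [Field K] [IsAlgClosed K] {r n : ℕ} [NeZero r] [NeZero (r : K)] {q : Kˣ}
  (S : SimpleFamily K r) {μ : Comp r n} (hn : 0 < n)
  {N : Type u} [AddCommGroup N] [Module K N] [Module (Y K r n q) N]
  [IsScalarTower K (Y K r n q) N]

/-- A tensor factor of `Hmu` acts on `Hom_{KT}(V(μ), I_μ N)` through `actOne`. -/
theorem actMu_single (k : Fin r) (x : H K (μ.1 k) q) (φ : HomMu q S μ N) :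
    actMu q S N μ (PiTensorProduct.singleAlgHom k x) φ = actOne S μ N k x φ := by
  rw [actMu]
  exact LinearMap.congr_fun (tensorLift_single (fun k => actOne S μ N k) _ k x) φ

/-- The action of `Hmu` on `Hom_{KT}(V(μ), I_μ N)` is given by the action of `Ymu` on the values. -/
theorem ev_corner (b : Ymu q μ) (φ : HomMu q S μ N) (v : Vsp S μ) :
    ev (actMu q S N μ (corner S hn b) φ) v = (b : Y K r n q) • ev φ v := by
  obtain ⟨b, hb⟩ := b
  induction hb using Algebra.adjoin_induction generalizing φ with
  | mem b hb =>
    rcases hb with ((⟨j, rfl⟩ | ⟨k, hk, rfl⟩) | ⟨k, hk, rfl⟩) | ⟨i, hi, hb, rfl⟩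
    · rw [show corner S hn ⟨yt j, _⟩ = _ from corner_t S hn j (mt q μ j).2, map_smul, map_one,
        ev_mem_weightSpace S φ v j]
      rfl
    · obtain ⟨l, a, ha, rfl⟩ := exists_place μ ⟨k, hk⟩
      exact (congrArg (fun x => ev (actMu q S N μ x φ) v) (corner_mX S hn l ⟨a, ha⟩)).trans
        (by rw [actMu_single]; exact actOne_Y l ⟨a, ha⟩ φ v)
    · obtain ⟨l, a, ha, rfl⟩ := exists_place μ ⟨k, hk⟩
      exact (congrArg (fun x => ev (actMu q S N μ x φ) v) (corner_mXinv S hn l ⟨a, ha⟩)).trans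
        (by rw [actMu_single]; exact actOne_Yinv l ⟨a, ha⟩ φ v)
    · obtain ⟨l, a, ha, rfl⟩ := exists_place μ ⟨i, Nat.lt_of_succ_lt hi⟩
      have ha' : a + 1 < μ.1 l := by
        obtain ⟨l', a', ha', h⟩ := exists_place μ ⟨place μ l a ha + 1, hi⟩
        rw [blk_place] at hb
        have h1 : blk μ ⟨place μ l a ha + 1, hi⟩ = l' := by
          rw [show (⟨place μ l a ha + 1, hi⟩ : Fin n) = ⟨place μ l' a' ha', place_lt μ l' a' ha'⟩
            from Fin.ext h, blk_place]
        obtain rfl := hb.trans h1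
        have h2 := place_add μ l a' a ha' ha
        change place μ l a ha + 1 = place μ l a' ha' at h
        omega
      exact (congrArg (fun x => ev (actMu q S N μ x φ) v) (corner_mg S hn l a ha')).trans
        (by rw [actMu_single]; exact actOne_T l a ha' φ v)
  | algebraMap a =>
    rw [show (⟨algebraMap K _ a, _⟩ : Ymu q μ) = algebraMap K (Ymu q μ) a from rfl, AlgHom.commutes,
      AlgHom.commutes, Module.algebraMap_end_apply]
    exact (algebraMap_smul (Y K r n q) a (ev φ v)).symm
  | add a b ha hb iha ihb =>
    rw [show (⟨a + b, _⟩ : Ymu q μ) = ⟨a, ha⟩ + ⟨b, hb⟩ from rfl, map_add, map_add,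
      LinearMap.add_apply, ev_add, iha, ihb, ← add_smul]
    rfl
  | mul a b ha hb iha ihb =>
    rw [show (⟨a * b, _⟩ : Ymu q μ) = ⟨a, ha⟩ * ⟨b, hb⟩ from rfl, map_mul, map_mul,
      Module.End.mul_apply, iha, ihb, smul_smul]
    rfl

end Evaluation

/-! ### Unit and counit -/

section Parts

variable {K : Type u} [Field K] {r n : ℕ} {q : Kˣ}
  {P : Type u} [AddCommGroup P] [Module K P] [Module (Hrn K r n q) P]
  [IsScalarTower K (Hrn K r n q) P]

variable (q P) in
/-- The projection of `P` to its component `P_μ`. -/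
def partProj (μ : Comp r n) : P →ₗ[K] part q P μ :=
  (Algebra.lsmul K K P (Pi.single μ 1 : Hrn K r n q)).rangeRestrict

theorem coe_partProj (μ : Comp r n) (p : P) :
    (partProj q P μ p : P) = (Pi.single μ 1 : Hrn K r n q) • p := rfl

theorem partProj_smul (μ : Comp r n) (a : Hrn K r n q) (p : P) :
    partProj q P μ (a • p) = partAct P μ (a μ) (partProj q P μ p) := by
  refine Subtype.ext ?_
  change (Pi.single μ 1 : Hrn K r n q) • a • p =
    (Pi.single μ (a μ) : Hrn K r n q) • (Pi.single μ 1 : Hrn K r n q) • p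
  rw [smul_smul, smul_smul]
  congr 1
  funext ν
  by_cases h : ν = μ
  · subst h; simp
  · simp [Pi.single_eq_of_ne h]

theorem partProj_coe (μ : Comp r n) (x : part q P μ) : partProj q P μ x = x :=
  Subtype.ext (single_one_smul P μ x)

theorem partProj_coe_of_ne {μ ν : Comp r n} (h : μ ≠ ν) (x : part q P ν) :
    partProj q P μ x = 0 := by
  refine Subtype.ext ?_
  rw [coe_partProj, ← single_one_smul P ν x, smul_smul]
  rw [show (Pi.single μ 1 * Pi.single ν 1 : Hrn K r n q) = 0 from ?_, zero_smul]; rfl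
  funext κ
  by_cases hκ : κ = μ
  · subst hκ; simp [Pi.single_eq_of_ne h]
  · simp [Pi.single_eq_of_ne hκ]

theorem sum_partProj (p : P) : ∑ μ : Comp r n, (partProj q P μ p : P) = p := by
  simp only [coe_partProj]
  rw [← Finset.sum_smul, Finset.univ_sum_single (fun _ => 1 : Hrn K r n q)]
  exact one_smul _ p

theorem partProj_apply {P' : Type u} [AddCommGroup P'] [Module K P'] [Module (Hrn K r n q) P']
    [IsScalarTower K (Hrn K r n q) P'] (f : P' →ₗ[Hrn K r n q] P) (μ : Comp r n) (p : P') :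
    partProj q P μ (f p) = partMap μ f (partProj q P' μ p) :=
  Subtype.ext (map_smul f _ _).symm

end Parts

section WeightSums

variable {K : Type u} [Field K] [IsAlgClosed K] {r n : ℕ} [NeZero r] {q : Kˣ}
  {S : SimpleFamily K r} {N : Type u} [AddCommGroup N] [Module K N] [Module (Y K r n q) N]
  [IsScalarTower K (Y K r n q) N]

/-- In a double sum of weight vectors for pairwise distinct colourings, a weight projection selects
one summand. -/
theorem weightProj_smul_sum (y : ∀ μ : Comp r n, Colouring μ → N)
    (hy : ∀ μ c, y μ c ∈ weightSpace q S N c.1) (μ : Comp r n) (c : Colouring μ) :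
    (weightProj S c.1 : Y K r n q) • ∑ ν, ∑ d, y ν d = y μ c := by
  classical
  simp only [Finset.smul_sum, weightProj_smul S c.1 (hy _ _)]
  rw [Finset.sum_eq_single μ, Finset.sum_eq_single c, if_pos rfl]
  · intro d _ hd
    exact if_neg fun h => hd (Subtype.ext h)
  · intro h; exact absurd (Finset.mem_univ _) h
  · intro ν _ hν
    exact Finset.sum_eq_zero fun d _ => if_neg fun h => hν (d.2.unique
      (show HasContent μ d.1 by rw [h]; exact c.2))
  · intro h; exact absurd (Finset.mem_univ _) h

end WeightSums

section Adjunction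

variable {K : Type u} [Field K] [IsAlgClosed K] {r n : ℕ} [NeZero r] [NeZero (r : K)] {q : Kˣ}
  {S : SimpleFamily K r} (hn : 0 < n)
  {N : Type u} [AddCommGroup N] [Module K N] [Module (Y K r n q) N]
  [IsScalarTower K (Y K r n q) N]
  {P : Type u} [AddCommGroup P] [Module K P] [Module (Hrn K r n q) P]
  [IsScalarTower K (Hrn K r n q) P]

/-- A homomorphism into `F(N)` maps `P_μ` to the component of `μ`. -/
theorem apply_eq_zero_of_mem_part (e : P →ₗ[Hrn K r n q] FObj r n q S N) {μ ν : Comp r n}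
    (h : ν ≠ μ) (x : part q P μ) : e x ν = 0 := by
  rw [← single_one_smul P μ x, map_smul, Pi.smul_apply', Pi.single_eq_of_ne h, zero_smul]

/-- The map `v ⊗ x ↦ e(x)(v)` attached to a homomorphism `e : P → F(N)`. -/
def evalPart (e : P →ₗ[Hrn K r n q] FObj r n q S N) (μ : Comp r n) :
    Vsp S μ ⊗[K] part q P μ →ₗ[K] N :=
  TensorProduct.lift (LinearMap.mk₂ K (fun v x => ev (e x μ) v)
    (fun _ _ _ => map_add _ _ _) (fun _ _ _ => map_smul _ _ _)
    (fun v x y => by rw [Submodule.coe_add, map_add, Pi.add_apply, ev_add])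
    (fun c v x => by rw [Submodule.coe_smul, LinearMap.map_smul_of_tower, Pi.smul_apply, ev_smul]))

theorem evalPart_tmul (e : P →ₗ[Hrn K r n q] FObj r n q S N) (μ : Comp r n) (v : Vsp S μ)
    (x : part q P μ) : evalPart e μ (v ⊗ₜ x) = ev (e x μ) v := rfl

theorem evalPart_mem_weightSpace (e : P →ₗ[Hrn K r n q] FObj r n q S N) (μ : Comp r n)
    (w : Vsp S μ ⊗[K] part q P μ) : evalPart e μ w ∈ weightSpace q S N (blk μ) := by
  obtain ⟨x, rfl⟩ := exists_eq_vgen_tmul S μ w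
  exact ev_mem_weightSpace S _ _

theorem evalPart_vAct (e : P →ₗ[Hrn K r n q] FObj r n q S N) (μ : Comp r n) (b : Ymu q μ)
    (w : Vsp S μ ⊗[K] part q P μ) :
    evalPart e μ (vAct (rho q S μ hn) (partAct P μ) b w) = (b : Y K r n q) • evalPart e μ w := by
  obtain ⟨x, rfl⟩ := exists_eq_vgen_tmul S μ w
  rw [vAct_rho_tmul, evalPart_tmul, evalPart_tmul, ← ev_corner S hn b]
  change ev (e ((Pi.single μ (corner S hn b) : Hrn K r n q) • (x : P)) μ) _ = _
  rw [map_smul, Pi.smul_apply', Pi.single_eq_same]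
  rfl

theorem evalPart_injective {e : P →ₗ[Hrn K r n q] FObj r n q S N} (he : Function.Injective e)
    (μ : Comp r n) : Function.Injective (evalPart e μ) := by
  rw [← LinearMap.ker_eq_bot, LinearMap.ker_eq_bot']
  intro w hw
  obtain ⟨x, rfl⟩ := exists_eq_vgen_tmul S μ w
  rw [evalPart_tmul] at hw
  have h : e x = 0 := by
    funext ν
    by_cases h : ν = μ
    · subst h
      exact ev_ext_vgen S hw
    · exact apply_eq_zero_of_mem_part e h x
  have hx : x = 0 := Subtype.ext (he (h.trans (map_zero e).symm))
  rw [hx, TensorProduct.tmul_zero]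

/-- The homomorphism `a ⊗ (v ⊗ x) ↦ a e(x)(v)` from the `μ`-component of `G(P)` to `N` attached to
`e : P → F(N)`. -/
def counitAt (e : P →ₗ[Hrn K r n q] FObj r n q S N) (μ : Comp r n) :
    Ind (Ymu q μ) (vAct (rho q S μ hn) (partAct P μ)) →ₗ[Y K r n q] N :=
  indLift (evalPart e μ) (evalPart_vAct hn e μ)

theorem counitAt_mk (e : P →ₗ[Hrn K r n q] FObj r n q S N) (μ : Comp r n) (a : Y K r n q)
    (w : Vsp S μ ⊗[K] part q P μ) :
    counitAt hn e μ (indMk _ _ a w) = a • evalPart e μ w := rfl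

theorem counitAt_smul_indOne (e : P →ₗ[Hrn K r n q] FObj r n q S N) (μ : Comp r n) (a : Y K r n q)
    (w : Vsp S μ ⊗[K] part q P μ) :
    counitAt hn e μ (a • indOne _ _ w) = a • evalPart e μ w := by
  rw [← counitAt_mk hn, indMk_eq_smul]; rfl

/-- The homomorphism `G(P) → N` attached to a homomorphism `P → F(N)`; for the identity of `F(N)` it
is the counit `GF(N) → N`. -/
def counitMap (e : P →ₗ[Hrn K r n q] FObj r n q S N) :
    GObj (fun μ => rho q S μ hn) P →ₗ[Y K r n q] N where
  toFun z := ∑ μ, counitAt hn e μ (z μ)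
  map_add' y z := by
    rw [← Finset.sum_add_distrib]
    exact Finset.sum_congr rfl fun μ _ => (counitAt hn e μ).map_add (y μ) (z μ)
  map_smul' a z := by
    rw [RingHom.id_apply, Finset.smul_sum]
    exact Finset.sum_congr rfl fun μ _ => (counitAt hn e μ).map_smul a (z μ)

theorem counitMap_apply (e : P →ₗ[Hrn K r n q] FObj r n q S N)
    (z : GObj (fun μ => rho q S μ hn) P) : counitMap hn e z = ∑ μ, counitAt hn e μ (z μ) := rfl

theorem counitMap_injective {e : P →ₗ[Hrn K r n q] FObj r n q S N} (he : Function.Injective e) :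
    Function.Injective (counitMap hn e) := by
  rw [← LinearMap.ker_eq_bot, LinearMap.ker_eq_bot']
  intro z hz
  choose w hw using fun μ => exists_indOne_sum S hn (partAct P μ) (z μ)
  -- The image of `∑ d_c ⊗ w_c` is the sum of the `d_c w_c`, which lie in different weight spaces.
  have h1 : ∑ μ, ∑ c : Colouring μ, (sortElt K q c.1).val • evalPart e μ (w μ c) = 0 := by
    rw [← hz, counitMap_apply]
    refine Finset.sum_congr rfl fun μ _ => ?_
    rw [hw μ, map_sum]
    exact Finset.sum_congr rfl fun c _ => (counitAt_smul_indOne hn e μ _ _).symm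
  have h2 : ∀ μ (c : Colouring μ), w μ c = 0 := by
    intro μ c
    have h3 := weightProj_smul_sum (q := q) (S := S)
      (fun μ (c : Colouring μ) => (sortElt K q c.1).val • evalPart e μ (w μ c))
      (fun μ c => sortElt_smul_mem c.2 (evalPart_mem_weightSpace e μ _)) μ c
    rw [h1, smul_zero] at h3
    have h4 : evalPart e μ (w μ c) = 0 := by
      rw [← one_smul (Y K r n q) (evalPart e μ (w μ c)), ← Units.inv_mul (sortElt K q c.1),
        mul_smul, ← h3, smul_zero]
    exact evalPart_injective he μ (h4.trans (map_zero _).symm)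
  funext μ
  rw [hw μ]
  simp only [h2, map_zero, smul_zero, Finset.sum_const_zero]
  rfl

theorem counitMap_surjective {e : P →ₗ[Hrn K r n q] FObj r n q S N} (he : Function.Surjective e) :
    Function.Surjective (counitMap hn e) := by
  classical
  intro x
  have hx := span_weightSpace (n := n) (q := q) S x
  induction hx using Submodule.span_induction with
  | zero => exact ⟨0, map_zero _⟩
  | add x y _ _ hx hy =>
    obtain ⟨a, rfl⟩ := hx
    obtain ⟨b, rfl⟩ := hy
    exact ⟨a + b, map_add _ _ _⟩
  | smul c x _ hx =>
    obtain ⟨a, rfl⟩ := hx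
    exact ⟨algebraMap K (Y K r n q) c • a, by rw [map_smul, algebraMap_smul]⟩
  | mem x hx =>
    obtain ⟨c, hx⟩ := hx
    obtain ⟨μ, hc⟩ := exists_hasContent c
    -- A vector `x` of weight `c` is `d_c x'` with `x' = d_c⁻¹ x` of standard weight, that is, a
    -- value of an element `φ` of `Hom_{KT}(V(μ), I_μ N)`.
    let φ := homOfWeight S (sortElt_inv_smul_mem hc hx)
    obtain ⟨p, hp⟩ := he (Pi.single μ φ)
    let y : part q P μ := ⟨(Pi.single μ 1 : Hrn K r n q) • p, single_smul_mem P μ 1 p⟩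
    have hy : e y μ = φ := by
      change e ((Pi.single μ 1 : Hrn K r n q) • p) μ = φ
      rw [map_smul, hp, Pi.smul_apply', Pi.single_eq_same, Pi.single_eq_same, one_smul]
    let z : GObj (fun μ => rho q S μ hn) P :=
      Pi.single (M := fun μ => Ind (Ymu q μ) (vAct (rho q S μ hn) (partAct P μ))) μ
        (indMk _ _ (sortElt K q c).val (vgen S μ ⊗ₜ y))
    refine ⟨z, ?_⟩
    rw [counitMap_apply, Finset.sum_eq_single μ]
    · simp only [z, Pi.single_eq_same]
      rw [counitAt_mk, evalPart_tmul, hy, ev_homOfWeight, vcoord_vgen, one_smul, smul_smul,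
        Units.mul_inv, one_smul]
    · intro ν _ hν
      simp only [z, Pi.single_eq_of_ne hν, map_zero]
    · intro h; exact absurd (Finset.mem_univ _) h

theorem counitMap_GMap {P' : Type u} [AddCommGroup P'] [Module K P'] [Module (Hrn K r n q) P']
    [IsScalarTower K (Hrn K r n q) P'] (e : P →ₗ[Hrn K r n q] FObj r n q S N)
    (f : P' →ₗ[Hrn K r n q] P) (z : GObj (fun μ => rho q S μ hn) P') :
    counitMap hn e (GMap (fun μ => rho q S μ hn) f z) = counitMap hn (e.comp f) z := by
  rw [counitMap_apply, counitMap_apply]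
  refine Finset.sum_congr rfl fun μ _ => ?_
  have h : (counitAt hn e μ).comp (GMapAt (fun μ => rho q S μ hn) f μ) =
      counitAt hn (e.comp f) μ := by
    refine ind_hom_ext _ _ fun a w => ?_
    obtain ⟨x, rfl⟩ := exists_eq_vgen_tmul S μ w
    rw [LinearMap.comp_apply, GMapAt_mk, counitAt_mk, counitAt_mk, LinearMap.lTensor_tmul,
      evalPart_tmul, evalPart_tmul]
    rfl
  exact LinearMap.congr_fun h (z μ)

theorem counitMap_FMap {N' : Type u} [AddCommGroup N'] [Module K N'] [Module (Y K r n q) N']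
    [IsScalarTower K (Y K r n q) N'] (e : P →ₗ[Hrn K r n q] FObj r n q S N)
    (f : N →ₗ[Y K r n q] N') (z : GObj (fun μ => rho q S μ hn) P) :
    counitMap hn ((FMap q S N N' f).comp e) z = f (counitMap hn e z) := by
  rw [counitMap_apply, counitMap_apply, map_sum]
  refine Finset.sum_congr rfl fun μ _ => ?_
  have h : counitAt hn ((FMap q S N N' f).comp e) μ = f.comp (counitAt hn e μ) := by
    refine ind_hom_ext _ _ fun a w => ?_
    obtain ⟨x, rfl⟩ := exists_eq_vgen_tmul S μ w
    rw [LinearMap.comp_apply, counitAt_mk, counitAt_mk, map_smul, evalPart_tmul, evalPart_tmul]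
    exact congrArg (a • ·) (ev_homMap q S N N' f μ (e x μ) _)
  exact LinearMap.congr_fun h (z μ)

/-- The inclusion of `V(μ) ⊗ P_μ` into `G(P)`, followed by a homomorphism `e : G(P) → N`. -/
def insertPart (e : GObj (fun μ => rho q S μ hn) P →ₗ[Y K r n q] N) (μ : Comp r n) :
    Vsp S μ ⊗[K] part q P μ →ₗ[K] N :=
  ((e.comp (LinearMap.single (Y K r n q)
    (fun μ => Ind (Ymu q μ) (vAct (rho q S μ hn) (partAct P μ))) μ)).restrictScalars K).comp
    (indOne _ _)

theorem insertPart_mem_weightSpace (e : GObj (fun μ => rho q S μ hn) P →ₗ[Y K r n q] N)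
    (μ : Comp r n) (w : Vsp S μ ⊗[K] part q P μ) :
    insertPart hn e μ w ∈ weightSpace q S N (blk μ) :=
  map_mem_weightSpace (e.comp (LinearMap.single (Y K r n q)
    (fun μ => Ind (Ymu q μ) (vAct (rho q S μ hn) (partAct P μ))) μ))
    (indOne_mem_weightSpace S hn (partAct P μ) w)

theorem smul_insertPart (e : GObj (fun μ => rho q S μ hn) P →ₗ[Y K r n q] N) (μ : Comp r n)
    (b : Ymu q μ) (w : Vsp S μ ⊗[K] part q P μ) : (b : Y K r n q) • insertPart hn e μ w =
      insertPart hn e μ (vAct (rho q S μ hn) (partAct P μ) b w) := by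
  unfold insertPart
  rw [LinearMap.comp_apply, LinearMap.comp_apply, ← smul_indOne, LinearMap.restrictScalars_apply,
    LinearMap.restrictScalars_apply, map_smul]

theorem insertPart_injective {e : GObj (fun μ => rho q S μ hn) P →ₗ[Y K r n q] N}
    (he : Function.Injective e) (μ : Comp r n) : Function.Injective (insertPart hn e μ) :=
  he.comp ((Pi.single_injective
    (M := fun μ => Ind (Ymu q μ) (vAct (rho q S μ hn) (partAct P μ))) μ).comp
    (indOne_injective S hn (partAct P μ)))

theorem apply_eq_sum_insertPart (e : GObj (fun μ => rho q S μ hn) P →ₗ[Y K r n q] N)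
    {z : GObj (fun μ => rho q S μ hn) P} {w : ∀ μ, Colouring μ → Vsp S μ ⊗[K] part q P μ}
    (hw : ∀ μ, z μ = ∑ c, (sortElt K q c.1).val • indOne _ _ (w μ c)) :
    e z = ∑ μ, ∑ c, (sortElt K q c.1).val • insertPart hn e μ (w μ c) := by
  have h1 : z = ∑ μ, LinearMap.single (Y K r n q)
      (fun μ => Ind (Ymu q μ) (vAct (rho q S μ hn) (partAct P μ))) μ (z μ) :=
    (Finset.univ_sum_single (M := fun μ =>
      Ind (Ymu q μ) (vAct (rho q S μ hn) (partAct P μ))) z).symm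
  conv_lhs => rw [h1]
  refine (map_sum e _ _).trans (Finset.sum_congr rfl fun μ _ => ?_)
  rw [hw μ, map_sum]
  refine (map_sum e _ _).trans (Finset.sum_congr rfl fun c _ => ?_)
  rw [map_smul]
  exact map_smul e _ _

/-- The homomorphism `P → F(N)` attached to a homomorphism `G(P) → N`; for the identity of `G(P)` it
is the unit `P → FG(P)`. -/
def unitMap (e : GObj (fun μ => rho q S μ hn) P →ₗ[Y K r n q] N) :
    P →ₗ[Hrn K r n q] FObj r n q S N where
  toFun p μ := homOfWeight S (insertPart_mem_weightSpace hn e μ (vgen S μ ⊗ₜ partProj q P μ p))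
  map_add' p p' := funext fun μ => ev_ext fun v => by
    rw [Pi.add_apply, ev_add, ev_homOfWeight, ev_homOfWeight, ev_homOfWeight, map_add,
      TensorProduct.tmul_add, map_add, smul_add]
  map_smul' a p := funext fun μ => ev_ext_vgen S (by
    obtain ⟨b, hb⟩ := corner_surjective S hn (a μ)
    rw [RingHom.id_apply, Pi.smul_apply', ev_homOfWeight, vcoord_vgen, one_smul, partProj_smul,
      ← hb, ← vAct_rho_tmul, ← smul_insertPart]
    refine Eq.trans ?_ (ev_corner S hn b _ _).symm
    rw [ev_homOfWeight, vcoord_vgen, one_smul])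

theorem ev_unitMap (e : GObj (fun μ => rho q S μ hn) P →ₗ[Y K r n q] N) (p : P) (μ : Comp r n) :
    ev (unitMap hn e p μ) (vgen S μ) = insertPart hn e μ (vgen S μ ⊗ₜ partProj q P μ p) :=
  (ev_homOfWeight S (insertPart_mem_weightSpace hn e μ (vgen S μ ⊗ₜ partProj q P μ p)) _).trans (by
    rw [vcoord_vgen, one_smul])

theorem unitMap_injective {e : GObj (fun μ => rho q S μ hn) P →ₗ[Y K r n q] N}
    (he : Function.Injective e) : Function.Injective (unitMap hn e) := by
  intro p p' h
  rw [← sum_partProj (r := r) (n := n) (q := q) p, ← sum_partProj (r := r) (n := n) (q := q) p']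
  refine Finset.sum_congr rfl fun μ _ => congrArg _ ?_
  have h1 := congrArg (fun φ : FObj r n q S N => ev (φ μ) (vgen S μ)) h
  simp only [ev_unitMap] at h1
  have h2 := insertPart_injective hn he μ h1
  rw [← sub_eq_zero, ← TensorProduct.tmul_sub] at h2
  exact sub_eq_zero.mp (eq_zero_of_vgen_tmul S μ h2)

theorem unitMap_surjective {e : GObj (fun μ => rho q S μ hn) P →ₗ[Y K r n q] N}
    (he : Function.Surjective e) : Function.Surjective (unitMap hn e) := by
  intro φ
  have key : ∀ μ, ∃ x : part q P μ, ev (φ μ) (vgen S μ) = insertPart hn e μ (vgen S μ ⊗ₜ x) := by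
    intro μ
    obtain ⟨z, hz⟩ := he (ev (φ μ) (vgen S μ))
    choose w hw using fun μ => exists_indOne_sum S hn (partAct P μ) (z μ)
    -- Comparison of the components of standard weight, for which the sorting element is `1`.
    have h1 := weightProj_smul_sum (q := q) (S := S)
      (fun μ (c : Colouring μ) => (sortElt K q c.1).val • insertPart hn e μ (w μ c))
      (fun μ c => sortElt_smul_mem c.2 (insertPart_mem_weightSpace hn e μ _)) μ (Colouring.std μ)
    rw [← apply_eq_sum_insertPart hn e hw, hz,
      weightProj_smul S _ (ev_mem_weightSpace S (φ μ) (vgen S μ)),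
      if_pos (show blk μ = (Colouring.std μ).1 from rfl)] at h1
    rw [Colouring.std, sortElt_of_monotone (blk_monotone μ), Units.val_one, one_smul] at h1
    obtain ⟨x, hx⟩ := exists_eq_vgen_tmul S μ (w μ ⟨blk μ, hasContent_blk μ⟩)
    exact ⟨x, by rw [h1, hx]⟩
  choose x hx using key
  refine ⟨∑ μ, (x μ : P), funext fun μ => ev_ext_vgen S ?_⟩
  rw [ev_unitMap, hx μ, map_sum, Finset.sum_eq_single μ, partProj_coe]
  · intro ν _ hν
    exact partProj_coe_of_ne hν.symm _
  · intro h; exact absurd (Finset.mem_univ _) h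

theorem unitMap_FMap {N' : Type u} [AddCommGroup N'] [Module K N'] [Module (Y K r n q) N']
    [IsScalarTower K (Y K r n q) N'] (e : GObj (fun μ => rho q S μ hn) P →ₗ[Y K r n q] N)
    (f : N →ₗ[Y K r n q] N') (p : P) :
    FMap q S N N' f (unitMap hn e p) = unitMap hn (f.comp e) p :=
  funext fun μ => ev_ext_vgen S (by
    rw [ev_unitMap]
    refine (ev_homMap q S N N' f μ (unitMap hn e p μ) _).trans ?_
    rw [ev_unitMap]
    rfl)

theorem GMap_single {P' : Type u} [AddCommGroup P'] [Module K P'] [Module (Hrn K r n q) P']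
    [IsScalarTower K (Hrn K r n q) P'] (f : P' →ₗ[Hrn K r n q] P) (μ : Comp r n)
    (x : Ind (Ymu q μ) (vAct (rho q S μ hn) (partAct P' μ))) :
    GMap (fun μ => rho q S μ hn) f (LinearMap.single (Y K r n q)
      (fun μ => Ind (Ymu q μ) (vAct (rho q S μ hn) (partAct P' μ))) μ x) =
    LinearMap.single (Y K r n q) (fun μ => Ind (Ymu q μ) (vAct (rho q S μ hn) (partAct P μ))) μ
      (GMapAt (fun μ => rho q S μ hn) f μ x) := by
  funext ν
  refine (Pi.apply_single (fun ν => GMapAt (fun μ => rho q S μ hn) f ν)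
    (fun ν => map_zero _) μ x ν).trans ?_
  rfl

theorem insertPart_GMap {P' : Type u} [AddCommGroup P'] [Module K P'] [Module (Hrn K r n q) P']
    [IsScalarTower K (Hrn K r n q) P'] (e : GObj (fun μ => rho q S μ hn) P →ₗ[Y K r n q] N)
    (f : P' →ₗ[Hrn K r n q] P) (μ : Comp r n) (w : Vsp S μ ⊗[K] part q P' μ) :
    insertPart hn (e.comp (GMap (fun μ => rho q S μ hn) f)) μ w =
      insertPart hn e μ ((partMap μ f).lTensor _ w) :=
  congrArg e (GMap_single hn f μ (indOne _ _ w))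

theorem unitMap_GMap {P' : Type u} [AddCommGroup P'] [Module K P'] [Module (Hrn K r n q) P']
    [IsScalarTower K (Hrn K r n q) P']
    (e : GObj (fun μ => rho q S μ hn) P →ₗ[Y K r n q] N) (f : P' →ₗ[Hrn K r n q] P) (p : P') :
    unitMap hn (e.comp (GMap (fun μ => rho q S μ hn) f)) p = unitMap hn e (f p) :=
  funext fun μ => ev_ext_vgen S (by
    rw [ev_unitMap, ev_unitMap, insertPart_GMap, LinearMap.lTensor_tmul, partProj_apply])

end Adjunction

/-! ### The equivalence of categories -/

section Equivalence

variable {K : Type u} [Field K] [IsAlgClosed K] {r n : ℕ} [NeZero r] [NeZero (r : K)] {q : Kˣ}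
  {S : SimpleFamily K r} (hn : 0 < n)

theorem fd_functorGAll (P : FDMod K (Hrn K r n q)) :
    fd K (Y K r n q) ((functorGAll fun μ => rho q S μ hn).obj P) := by
  have hP : Module.Finite K P.obj := P.property
  let _ : Module K (GObj (fun μ => rho q S μ hn) P.obj) := inferInstanceAs (Module K
    (∀ μ : Comp r n, Ind (Ymu q μ) (vAct (rho q S μ hn) (partAct P.obj μ))))
  have : IsScalarTower K (Y K r n q) (GObj (fun μ => rho q S μ hn) P.obj) :=
    inferInstanceAs (IsScalarTower K (Y K r n q)
      (∀ μ : Comp r n, Ind (Ymu q μ) (vAct (rho q S μ hn) (partAct P.obj μ))))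
  have hfin : ∀ μ : Comp r n,
      Module.Finite K (Ind (Ymu q μ) (vAct (rho q S μ hn) (partAct P.obj μ))) :=
    fun μ => finite_ind S hn (partAct P.obj μ)
  have : Module.Finite K (GObj (fun μ => rho q S μ hn) P.obj) := inferInstanceAs (Module.Finite K
    (∀ μ : Comp r n, Ind (Ymu q μ) (vAct (rho q S μ hn) (partAct P.obj μ))))
  exact fd_of K (GObj (fun μ => rho q S μ hn) P.obj)

/-- `counitMap` for objects of the categories of finite dimensional modules. -/
def counitLin (P : FDMod K (Hrn K r n q)) (N : FDMod K (Y K r n q))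
    (e : P.obj →ₗ[Hrn K r n q] FObj r n q S N.obj) :
    GObj (fun μ => rho q S μ hn) P.obj →ₗ[Y K r n q] N.obj := counitMap hn e

/-- `unitMap` for objects of the categories of finite dimensional modules. -/
def unitLin (P : FDMod K (Hrn K r n q)) (N : FDMod K (Y K r n q))
    (e : GObj (fun μ => rho q S μ hn) P.obj →ₗ[Y K r n q] N.obj) :
    P.obj →ₗ[Hrn K r n q] FObj r n q S N.obj := unitMap hn e

theorem counitLin_bijective (P : FDMod K (Hrn K r n q)) (N : FDMod K (Y K r n q))
    (e : P.obj →ₗ[Hrn K r n q] FObj r n q S N.obj) (he : Function.Bijective e) :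
    Function.Bijective (counitLin hn P N e) :=
  ⟨counitMap_injective hn he.1, counitMap_surjective hn he.2⟩

theorem unitLin_bijective (P : FDMod K (Hrn K r n q)) (N : FDMod K (Y K r n q))
    (e : GObj (fun μ => rho q S μ hn) P.obj →ₗ[Y K r n q] N.obj) (he : Function.Bijective e) :
    Function.Bijective (unitLin hn P N e) :=
  ⟨unitMap_injective hn he.1, unitMap_surjective hn he.2⟩

theorem counitLin_naturality {P P' : FDMod K (Hrn K r n q)} {N N' : FDMod K (Y K r n q)}
    (e : P.obj →ₗ[Hrn K r n q] FObj r n q S N.obj)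
    (e' : P'.obj →ₗ[Hrn K r n q] FObj r n q S N'.obj)
    (g : P.obj →ₗ[Hrn K r n q] P'.obj) (f : N.obj →ₗ[Y K r n q] N'.obj)
    (h : e'.comp g = (FMap q S N.obj N'.obj f).comp e) :
    (counitLin hn P' N' e').comp (GMap (fun μ => rho q S μ hn) g) = f.comp (counitLin hn P N e) :=
  LinearMap.ext fun z => (counitMap_GMap hn e' g z).trans
    ((LinearMap.congr_fun (congrArg (counitMap hn) h) z).trans (counitMap_FMap hn e f z))

theorem unitLin_naturality {P P' : FDMod K (Hrn K r n q)} {N N' : FDMod K (Y K r n q)}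
    (e : GObj (fun μ => rho q S μ hn) P.obj →ₗ[Y K r n q] N.obj)
    (e' : GObj (fun μ => rho q S μ hn) P'.obj →ₗ[Y K r n q] N'.obj)
    (g : P.obj →ₗ[Hrn K r n q] P'.obj) (f : N.obj →ₗ[Y K r n q] N'.obj)
    (h : e'.comp (GMap (fun μ => rho q S μ hn) g) = f.comp e) :
    (unitLin hn P' N' e').comp g = (FMap q S N.obj N'.obj f).comp (unitLin hn P N e) :=
  LinearMap.ext fun p => (unitMap_GMap hn e' g p).symm.trans
    ((LinearMap.congr_fun (congrArg (unitMap hn) h) p).trans (unitMap_FMap hn e f p).symm)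

variable (q S) in
/-- The natural isomorphism `GF ≅ id`. -/
def counitIso : functorF q S ⋙ functorG (fun μ => rho q S μ hn) (fd_functorGAll (S := S) hn) ≅
    𝟭 (FDMod K (Y K r n q)) :=
  NatIso.ofComponents
    (fun N => (fd K (Y K r n q)).isoMk
      (LinearEquiv.toModuleIso (LinearEquiv.ofBijective
        (counitLin (S := S) hn ((functorF q S).obj N) N LinearMap.id)
        (counitLin_bijective hn _ _ _ Function.bijective_id))))
    (fun {N N'} f => ObjectProperty.hom_ext _ (ModuleCat.hom_ext
      (counitLin_naturality hn (P := (functorF q S).obj N) (P' := (functorF q S).obj N')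
        LinearMap.id LinearMap.id (FMap q S N.obj N'.obj f.hom.hom) f.hom.hom rfl)))

variable (q S) in
/-- The natural isomorphism `id ≅ FG`. -/
def unitIso : 𝟭 (FDMod K (Hrn K r n q)) ≅
    functorG (fun μ => rho q S μ hn) (fd_functorGAll (S := S) hn) ⋙ functorF q S :=
  NatIso.ofComponents
    (fun P => (fd K (Hrn K r n q)).isoMk
      (LinearEquiv.toModuleIso (LinearEquiv.ofBijective
        (unitLin (S := S) hn P ((functorG (fun μ => rho q S μ hn)
          (fd_functorGAll (S := S) hn)).obj P) LinearMap.id)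
        (unitLin_bijective hn _ _ _ Function.bijective_id))))
    (fun {P P'} f => ObjectProperty.hom_ext _ (ModuleCat.hom_ext
      (unitLin_naturality hn
        (N := (functorG (fun μ => rho q S μ hn) (fd_functorGAll (S := S) hn)).obj P)
        (N' := (functorG (fun μ => rho q S μ hn) (fd_functorGAll (S := S) hn)).obj P')
        LinearMap.id LinearMap.id f.hom.hom (GMap (fun μ => rho q S μ hn) f.hom.hom) rfl)))

end Equivalence

end AYH

end

theorem theorem3p6 {K : Type u} [Field K] [IsAlgClosed K] (p : ℕ) [CharP K p] (r n : ℕ) [NeZero r]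
    (hn : 1 ≤ n) (hp : ¬ p ∣ r) (q : Kˣ) (S : AYH.SimpleFamily K r) :
    haveI : NeZero (r : K) := ⟨fun h => hp ((CharP.cast_eq_zero_iff K p r).mp h)⟩
    ∃ ρ : ∀ μ : AYH.Comp r n,
        AYH.Ymu q μ →ₐ[K] TensorProduct K (Module.End K (AYH.Vsp S μ)) (AYH.Hmu K q μ),
      (∀ μ, AYH.IsTensorAction q μ S (ρ μ)) ∧
      ∃ hfd : ∀ P, AYH.fd K (AYH.Y K r n q) ((AYH.functorGAll ρ).obj P),
      ∃ E : AYH.FDMod K (AYH.Y K r n q) ≌ AYH.FDMod K (AYH.Hrn K r n q),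
        E.functor = AYH.functorF q S ∧ E.inverse = AYH.functorG ρ hfd := by
  have : NeZero (r : K) := ⟨fun h => hp ((CharP.cast_eq_zero_iff K p r).mp h)⟩
  exact ⟨fun μ => AYH.rho q S μ hn, fun μ => AYH.isTensorAction_rho S hn, AYH.fd_functorGAll hn,
    CategoryTheory.Equivalence.mk _ _ (AYH.counitIso q S hn).symm (AYH.unitIso q S hn).symm,
    rfl, rfl⟩
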